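/- **Setting.** Let $I=\mathbb Z\times\{\pm1\}$, $\langle(j,\varsigma)\rangle=\max(|j|,1)$, $\mathfrak m_{(j,\varsigma)}=\varsigma j$. For $s>0$ let $\mathtt g_s$ be the space of sequences $x\in\mathbb C^I$ with $|x|_s=\big(\sum_k\langle k\rangle^2e^{2s\sqrt{\langle k\rangle}}|x_k|^2\big)^{1/2}<\infty$, and $B_r(\mathtt g_s)$ its open ball of radius $r$ about $0$. $\mathbb N^I_f$, $\mathbb Z^I_f$ denote finitely supported integer vectors and $|q|=\sum_k q_k$ for $q\in\mathbb N^I_f$. $\mathcal V_{s,r}$ is the space of vector fields $V=\sum_{k\in I,\,q\in\mathbb N^I_f}V^{(k)}_q x^q\partial_{x_k}$ with $V(0)=0$, $V_q^{(k)}=0$ whenever $\mathfrak m\cdot(q-e_k)\ne0$, and $\|V\|_{s,r}=\frac1r\sup_{|x|_s<r}|\underline V(x)|_s<\infty$, where $\underline V$ has the coefficients $|V_q^{(k)}|$. The degree of $x^q\partial_{x_k}$ is $|q|-1$; $\mathcal V^{\ge d}_{s,r}$ is the subspace spanned by degrees $\ge d$, and $\mathcal V_{s,r}^{(1\le d\le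 m)}$ by degrees between $1$ and $m$. $[X,Y]=\sum_k (X[Y^{(k)}]-Y[X^{(k)}])\partial_{x_k}$, $L_F=[F,\cdot]$, and $\exp(L_F)W=\sum_n L_F^nW/n!$ (coefficient by coefficient). For $\lambda\in\mathbb C^I$ put $\mathtt D(\lambda)=\sum_k\lambda_kx_k\partial_{x_k}$, $\mathcal M_\lambda=\{Q\in\mathbb N^I_f: Q\cdot\lambda=0,\ Q\cdot\mathfrak m=0\}$, $\Delta^{(k)}_\lambda=\{P\in\mathbb Z_f^I:P\cdot\lambda=0,\ P\cdot\mathfrak m=0,\ P+e_k\in\mathbb N_f^I\}$, $\Delta_\lambda=\bigcup_k\Delta_\lambda^{(k)}$. Let $\mathcal G_\lambda$ be the set of nonzero indecomposable elements (minimal generators) of the monoid $\mathcal M_\lambda$, and $\bar{\mathcal G}_\lambda$ the set of those $P\in\Delta_\lambda\setminus\mathcal M_\lambda$ not of the form $P'+Q$ with $P'\in\Delta_\lambda\setminus\mathcal M_\lambda$, $0\neq Q\in\mathcal M_\lambda$. Let $\mathcal J^{(1)}$ (resp. $\mathcal J^{(2)}$) be the set of $q\in\mathbb N_f^I$ with $q\ge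 Q$ (resp. $q\ge Q+Q'$) for some $Q$ (resp. $Q,Q'$) in $\mathcal G_\lambda$. $\mathcal I^{(0)},\mathcal I^{(1)},\mathcal I^{(2)}$ are the spaces of vector fields whose monomials $x^q\partial_{x_k}$ have $q$ in $\mathbb N^I_f\setminus\mathcal J^{(1)}$, $\mathcal J^{(1)}\setminus\mathcal J^{(2)}$, $\mathcal J^{(2)}$ respectively. Write $X_j$ for the component of $X$ in $\mathcal I^{(j)}$ and $|\!|\!|X|\!|\!|_{s,r}=\max_{0\le j\le2}\|X_j\|_{s,r}$. $\mathcal K^{\rm diag}$ is the space of vector fields all of whose monomials are $x^Qx_k\partial_{x_k}$ with $Q\in\mathcal M_\lambda$. **Assumptions on $\lambda$.** Let $\tau\in\mathbb R$ and $\gamma,C>0$. (a) $\lambda_k\ne0$ for all $k$; $\sup_{Q\in\mathcal G_\lambda}|Q|<\infty$ and $\sup_k\sup_{P\in\bar{\mathcal G}_\lambda\cap\Delta^{(k)}_\lambda}|P+e_k|<\infty$. (b) There are real $\varphi_k$ with $|\lambda_k-\langle k\rangle^2e^{i\varphi_k}|\le\frac12$ for all $k$, and $|e^{i\varphi_{(j,\varsigma)}}-e^{i\varphi_{(-j,-\varsigma)}}|\ge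 C$ whenever $\lambda_{(j,\varsigma)}\ne\lambda_{(-j,-\varsigma)}$. (c) $|\lambda\cdot p|\ge\gamma\prod_i(1+p_i^2\langle i\rangle^2)^{-\tau}$ for all $p\in\mathbb Z^I_f\setminus\Delta_\lambda$ with $p\cdot\mathfrak m=0$ and $p+e_k\in\mathbb N_f^I$ for some $k$. Let $\mathtt M_*$ be a natural number such that every monomial $x^q\partial_{x_k}$ of degree $\ge\mathtt M_*$ with $q-e_k\in\Delta_\lambda^{(k)}$ has $q\in\mathcal J^{(2)}$ (such numbers exist by (a)). **Lemma (Main KAM step).** There are absolute constants $\mathtt K_1,\mathtt K>0$ and, for all $\tau\in\mathbb R$, $C>0$, a constant $\mathtt c=\mathtt c(\tau,C)>0$ such that the following holds for all $\lambda,\gamma$ satisfying (a)–(c), all $\mathtt M_*$ as above, and all $s,\rho,\sigma>0$ and $r>5\rho$. Let $W=\mathtt D(\lambda)+Z+X+N$ with $Z\in\mathcal K^{\rm diag}\cap\mathcal V^{(1\le d\le \mathtt M_*-1)}_{s,r}$, $X\in\mathcal V_{s,r}^{\ge\mathtt M_*}\cap(\mathcal I^{(0)}\oplus\mathcal I^{(1)})$,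 $N\in\mathcal V^{\ge\mathtt M_*}_{s,r}\cap\mathcal I^{(2)}$, put $$\Theta=1+\frac{|\!|\!|Z|\!|\!|_{s,r}}\gamma+\frac{|\!|\!|N|\!|\!|_{s,r}}\gamma ,$$ and assume $$\Theta^3\,\frac{|\!|\!|X|\!|\!|_{s,r}}{\gamma}\le\mathtt K_1\frac{\rho^4}{r^4}e^{-2^8\mathtt c/\sigma^6}.$$ Then there is $F\in\mathcal V^{\ge\mathtt M_*}_{s+2\sigma,r-3\rho}\cap(\mathcal I^{(0)}\oplus\mathcal I^{(1)})$ with $$|\!|\!|F|\!|\!|_{s+2\sigma,r-3\rho}\le\frac{\rho}{8e(r-3\rho)},$$ and there are $X_+\in\mathcal V^{\ge\mathtt M_*}_{s+2\sigma,r-5\rho}\cap(\mathcal I^{(0)}\oplus\mathcal I^{(1)})$, $N_+\in\mathcal V^{\ge\mathtt M_*}_{s+2\sigma,r-5\rho}\cap\mathcal I^{(2)}$ with $$W_+:=\exp(L_F)W=\mathtt D(\lambda)+Z+X_++N_+ ,$$ such that: 1. For every $s_1\ge s+2\sigma$ the time-1 flow $\Phi_F:B_{r-5\rho}(\mathtt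 g_{s_1})\to B_{r-3\rho}(\mathtt g_{s_1})$ of $F$ is well defined and analytic, and $\sup_{u\in B_{r-5\rho}(\mathtt g_{s_1})}|\Phi_F(u)-u|_{s_1}\le(r+\rho)\|F\|_{s+2\sigma,r-3\rho}$. It conjugates $W$ to $W_+$: $d\Phi_F(x)\,W_+(x)=W(\Phi_F(x))$ in $\mathtt g_{s_1}$ for all $x\in B_{r-5\rho}(\mathtt g_{s'})$, $s'>s_1$. 2. The following bounds hold: $$|\!|\!|F|\!|\!|_{s+2\sigma,r-3\rho}\le\mathtt K\Big(\frac r\rho\Big)^3e^{2^8\mathtt c/\sigma^6}\frac{|\!|\!|X|\!|\!|_{s,r}}\gamma\,\Theta^3,$$ $$|\!|\!|X_+|\!|\!|_{s+2\sigma,r-5\rho}\le\mathtt K\Big(\frac r\rho\Big)^8\gamma^{-1}e^{2^9\mathtt c/\sigma^6}\,\Theta^7\,|\!|\!|X|\!|\!|_{s,r}^2,$$ $$|\!|\!|N-N_+|\!|\!|_{s+2\sigma,r-5\rho}\le\mathtt K\Big(\frac r\rho\Big)^8e^{2^9\mathtt c/\sigma^6}\,\Theta^7\Big(\frac{|\!|\!|Z|\!|\!|_{s,r}}\gamma+\frac{|\!|\!|N|\!|\!|_{s,r}}\gamma+\frac{|\!|\!|X|\!|\!|_{s,r}}\gamma\Big)|\!|\!|X|\!|\!|_{s,r}.$$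 -/

import Mathlib

open scoped ENNReal Nat

namespace ResonantNF

noncomputable section

/-- The index set `I = ℤ × {+1, -1}`. -/
abbrev Idx := ℤ × ℤˣ

/-- Finitely supported multi-indices `q ∈ ℕ^I`. -/
abbrev MIdx := Idx →₀ ℕ

/-- Formal vector fields `V = ∑ V_q^{(k)} x^q ∂/∂x_k`, given by their coefficients
`V k q = V_q^{(k)}`. -/
abbrev FVF := Idx → MIdx → ℂ

/-! ### The sequence spaces -/

/-- `⟨(j,σ)⟩ = max(|j|,1)`. -/
def bra (k : Idx) : ℝ := max |(k.1 : ℝ)| 1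

/-- `⟨k⟩ e^{s √⟨k⟩}`. -/
def weight (s : ℝ) (k : Idx) : ℝ := bra k * Real.exp (s * Real.sqrt (bra k))

/-- The weighted `ℓ²` norm `(∑_k ⟨k⟩² e^{2s√⟨k⟩} y_k²)^{1/2}` of a sequence of elements
of `[0,∞]`. -/
def wNorm (s : ℝ) (y : Idx → ℝ≥0∞) : ℝ≥0∞ :=
  (∑' k, (ENNReal.ofReal (weight s k) * y k) ^ 2) ^ (1 / 2 : ℝ)

/-- The sequences `x` for which `∑_k ⟨k⟩² e^{2s√⟨k⟩} |x_k|²` is finite. -/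
def gSub (s : ℝ) : Submodule ℂ (Idx → ℂ) where
  carrier := {x | Memℓp (fun k => (weight s k : ℂ) * x k) 2}
  zero_mem' := by
    have h : (fun k : Idx => (weight s k : ℂ) * (0 : Idx → ℂ) k) = 0 := by
      funext k; simp
    simp only [Set.mem_ofPred_eq, h]
    exact zero_memℓp
  add_mem' := by
    intro a b ha hb
    have h : (fun k : Idx => (weight s k : ℂ) * (a + b) k)
        = (fun k => (weight s k : ℂ) * a k) + (fun k => (weight s k : ℂ) * b k) := by
      funext k; simp [mul_add]
    simp only [Set.mem_ofPred_eq, h]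
    exact Memℓp.add ha hb
  smul_mem' := by
    intro c a ha
    have h : (fun k : Idx => (weight s k : ℂ) * (c • a) k)
        = c • (fun k => (weight s k : ℂ) * a k) := by
      funext k; simp [mul_left_comm]
    simp only [Set.mem_ofPred_eq, h]
    exact Memℓp.const_smul ha c

/-- The space `g_s`. -/
def G (s : ℝ) : Type := gSub s

instance (s : ℝ) : AddCommGroup (G s) := inferInstanceAs (AddCommGroup (gSub s))

instance (s : ℝ) : Module ℂ (G s) := inferInstanceAs (Module ℂ (gSub s))

instance (s : ℝ) : CoeFun (G s) (fun _ => Idx → ℂ) := ⟨fun x => Subtype.val x⟩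

/-- The map `x ↦ (⟨k⟩ e^{s√⟨k⟩} x_k)_k` from `g_s` to `ℓ²`. -/
def toEll (s : ℝ) : G s →ₗ[ℂ] lp (fun _ : Idx => ℂ) 2 where
  toFun x := ⟨fun k => (weight s k : ℂ) * x k, x.2⟩
  map_add' x y := by
    ext k
    exact mul_add (weight s k : ℂ) (x k) (y k)
  map_smul' c x := by
    ext k
    exact mul_left_comm (weight s k : ℂ) c (x k)

theorem bra_pos (k : Idx) : 0 < bra k := lt_of_lt_of_le one_pos (le_max_right _ _)

theorem weight_pos (s : ℝ) (k : Idx) : 0 < weight s k :=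
  mul_pos (bra_pos k) (Real.exp_pos _)

theorem toEll_injective (s : ℝ) : Function.Injective (toEll s) := by
  intro x y h
  apply Subtype.ext
  funext k
  have hk : (weight s k : ℂ) * x k = (weight s k : ℂ) * y k :=
    congrArg (fun z : lp (fun _ : Idx => ℂ) 2 => (z : Idx → ℂ) k) h
  exact mul_left_cancel₀ (by exact_mod_cast (weight_pos s k).ne') hk

/-- `g_s` carries the norm `|x|_s = (∑_k ⟨k⟩² e^{2s√⟨k⟩} |x_k|²)^{1/2}`. -/
instance (s : ℝ) : NormedAddCommGroup (G s) :=
  NormedAddCommGroup.induced (G s) (lp (fun _ : Idx => ℂ) 2) (toEll s) (toEll_injective s)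

instance (s : ℝ) : NormedSpace ℂ (G s) :=
  NormedSpace.induced ℂ (G s) (lp (fun _ : Idx => ℂ) 2) (toEll s)

/-- The norm of `g_s` is the weighted `ℓ²` norm. -/
theorem wNorm_eq_norm (s : ℝ) (x : G s) : wNorm s (fun k => ‖x k‖ₑ) = ENNReal.ofReal ‖x‖ := by
  have h1 : ‖x‖ = ‖toEll s x‖ := rfl
  have h2 : ∀ k, ‖(toEll s x : Idx → ℂ) k‖ₑ = ENNReal.ofReal (weight s k) * ‖x k‖ₑ := by
    intro k
    change ‖(weight s k : ℂ) * x k‖ₑ = _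
    rw [enorm_mul]
    congr 1
    rw [← ofReal_norm, Complex.norm_real, Real.norm_of_nonneg (weight_pos s k).le]
  have h3 := lp.hasSum_norm (p := 2) (by norm_num) (toEll s x)
  have h4 : HasSum (fun k => ‖(toEll s x : Idx → ℂ) k‖ ^ 2) (‖x‖ ^ 2) := by
    simpa [h1] using h3
  have h5 : ∑' k, (ENNReal.ofReal (weight s k) * ‖x k‖ₑ) ^ 2 = ENNReal.ofReal (‖x‖ ^ 2) := by
    rw [← h4.tsum_eq, ENNReal.ofReal_tsum_of_nonneg (fun k => by positivity) h4.summable]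
    refine tsum_congr fun k => ?_
    rw [← h2, ← ofReal_norm, ENNReal.ofReal_pow (norm_nonneg _)]
  unfold wNorm
  rw [h5, ENNReal.ofReal_rpow_of_nonneg (by positivity) (by norm_num), ← Real.sqrt_eq_rpow,
    Real.sqrt_sq (norm_nonneg x)]

/-! ### Momentum, small divisors, resonances -/

/-- `𝔪_{(j,σ)} = σ j`. -/
def mom (k : Idx) : ℤ := (k.2 : ℤ) * k.1

/-- `𝔪 · p`. -/
def momZ (p : Idx →₀ ℤ) : ℤ := p.sum fun h n => mom h * n

/-- `λ · p`. -/
def freqZ (lam : Idx → ℂ) (p : Idx →₀ ℤ) : ℂ := p.sum fun h n => lam h * (n : ℂ)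

/-- The inclusion of `ℕ^I_f` into `ℤ^I_f`. -/
def natToInt (q : MIdx) : Idx →₀ ℤ := q.mapRange (fun n : ℕ => (n : ℤ)) rfl

/-- `q - e_k ∈ ℤ^I_f`. -/
def shift (q : MIdx) (k : Idx) : Idx →₀ ℤ := natToInt q - Finsupp.single k 1

/-- The exponents of the monomial first integrals of `D(λ)`:
`M_λ = {Q ∈ ℕ^I_f : Q·λ = 0, Q·𝔪 = 0}`. -/
def resM (lam : Idx → ℂ) : Set MIdx := {Q | freqZ lam (natToInt Q) = 0 ∧ momZ (natToInt Q) = 0}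

/-- `Δ_λ^{(k)} = {P ∈ ℤ^I_f : P·λ = 0, P·𝔪 = 0, P + e_k ∈ ℕ^I_f}`. -/
def resDk (lam : Idx → ℂ) (k : Idx) : Set (Idx →₀ ℤ) :=
  {P | freqZ lam P = 0 ∧ momZ P = 0 ∧ ∃ q : MIdx, P + Finsupp.single k 1 = natToInt q}

/-- `Δ_λ = ⋃_k Δ_λ^{(k)}`. -/
def resD (lam : Idx → ℂ) : Set (Idx →₀ ℤ) := ⋃ k, resDk lam k

/-- `Δ_λ \ M_λ`. -/
def resOut (lam : Idx → ℂ) : Set (Idx →₀ ℤ) := resD lam \ (natToInt '' resM lam)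

/-- The generators `Q_i` of `M_λ`: its nonzero indecomposable elements. They generate `M_λ`
as a monoid, and every generating set contains them. -/
def genM (lam : Idx → ℂ) : Set MIdx :=
  {Q | Q ∈ resM lam ∧ Q ≠ 0 ∧ ∀ A ∈ resM lam, ∀ B ∈ resM lam, A + B = Q → A = 0 ∨ B = 0}

/-- The generators `P_j` of `Δ_λ \ M_λ` modulo `M_λ`: the elements that are not of the form
`P' + Q` with `P' ∈ Δ_λ \ M_λ` and `0 ≠ Q ∈ M_λ`. -/
def genOut (lam : Idx → ℂ) : Set (Idx →₀ ℤ) :=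
  {P | P ∈ resOut lam ∧ ∀ P' ∈ resOut lam, ∀ Q ∈ resM lam, P = P' + natToInt Q → Q = 0}

/-- `λ_k ≠ 0` for all `k`, and the generators have uniformly bounded degree. -/
def BoundedGenerators (lam : Idx → ℂ) : Prop :=
  (∀ k, lam k ≠ 0) ∧
  (∃ M : ℕ, ∀ Q ∈ genM lam, Q.degree ≤ M) ∧
  (∃ M₁ : ℕ, ∀ k, ∀ q : MIdx, shift q k ∈ genOut lam ∩ resDk lam k → q.degree ≤ M₁)

/-- `|λ_k - ⟨k⟩² e^{iθ_k}| ≤ 1/2` for all `k`, and the phases of `(j,σ)` and `(-j,-σ)` are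
separated by `C` whenever `λ_{(j,σ)} ≠ λ_{(-j,-σ)}`. -/
def Superlinear (C : ℝ) (lam : Idx → ℂ) : Prop :=
  ∃ θ : Idx → ℝ,
    (∀ k, ‖lam k - (bra k : ℂ) ^ 2 * Complex.exp (θ k * Complex.I)‖ ≤ 1 / 2) ∧
    ∀ (j : ℤ) (ε : ℤˣ), lam (j, ε) ≠ lam (-j, -ε) →
      C ≤ ‖Complex.exp (θ (j, ε) * Complex.I) - Complex.exp (θ (-j, -ε) * Complex.I)‖

/-- `λ` is `(γ,τ)`-Diophantine modulo `Δ_λ`. -/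
def DiophantineMod (γ τ : ℝ) (lam : Idx → ℂ) : Prop :=
  ∀ p : Idx →₀ ℤ, p ∉ resD lam → momZ p = 0 →
    (∃ k, ∃ q : MIdx, p + Finsupp.single k 1 = natToInt q) →
    γ * (p.prod fun i n => 1 / (1 + (n : ℝ) ^ 2 * bra i ^ 2) ^ τ) ≤ ‖freqZ lam p‖

/-- `J^{(1)}`: exponents divisible by one generator of `M_λ`. -/
def J1 (lam : Idx → ℂ) : Set MIdx := {q | ∃ Q ∈ genM lam, Q ≤ q}

/-- `J^{(2)}`: exponents divisible by the product of two generators of `M_λ`. -/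
def J2 (lam : Idx → ℂ) : Set MIdx := {q | ∃ Q ∈ genM lam, ∃ Q' ∈ genM lam, Q + Q' ≤ q}

/-- `J^{(0)}`: exponents divisible by no generator of `M_λ`. -/
def J0 (lam : Idx → ℂ) : Set MIdx := (J1 lam)ᶜ

/-- The degrees `m` such that no resonant vector field of order at least `m` has a nonzero
component in `I^{(0)}` or `I^{(1)}`: every resonant monomial `x^q ∂/∂x_k` of degree
`|q| - 1 ≥ m` has `q ∈ J^{(2)}`. -/
def resonanceDegrees (lam : Idx → ℂ) : Set ℕ :=
  {m | ∀ (k : Idx) (q : MIdx), shift q k ∈ resDk lam k → m + 1 ≤ q.degree → q ∈ J2 lam}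

/-! ### Vector fields -/

/-- The component `∑_q |V_q^{(k)}| |x^q|` of the majorant of `V`. -/
def majorant (V : FVF) (x : Idx → ℂ) (k : Idx) : ℝ≥0∞ :=
  ∑' q : MIdx, ‖V k q‖ₑ * q.prod fun i n => ‖x i‖ₑ ^ n

/-- The majorant norm `‖V‖_{s,r} = r⁻¹ sup_{|x|_s < r} |V̲(x)|_s` with values in `[0,∞]`. As the
coefficients of the majorant are nonnegative, the supremum may be taken over the moduli. -/
def majNorm (s r : ℝ) (V : FVF) : ℝ≥0∞ :=
  (⨆ (x : Idx → ℂ) (_ : wNorm s (fun k => ‖x k‖ₑ) < ENNReal.ofReal r), wNorm s (majorant V x))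
    / ENNReal.ofReal r

/-- `𝒱_{s,r}`: vector fields that vanish at `0`, preserve momentum and have finite majorant
norm. -/
def MemV (s r : ℝ) (V : FVF) : Prop :=
  (∀ k, V k 0 = 0) ∧ (∀ k q, momZ (shift q k) ≠ 0 → V k q = 0) ∧ majNorm s r V < ⊤

/-- `‖V‖_{s,r}` as a real number, for `V ∈ 𝒱_{s,r}`. -/
def vnorm (s r : ℝ) (V : FVF) : ℝ := (majNorm s r V).toReal

/-- Only exponents in `J` occur in `V`. -/
def SuppIn (J : Set MIdx) (V : FVF) : Prop := ∀ k q, V k q ≠ 0 → q ∈ J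

/-- `V` has order at least `d`, where `x^q ∂/∂x_k` has degree `|q| - 1`. -/
def OrderGE (d : ℕ) (V : FVF) : Prop := ∀ k q, V k q ≠ 0 → d + 1 ≤ q.degree

/-- All monomials of `V` have degree `|q| - 1 < d`. -/
def DegreeLT (d : ℕ) (V : FVF) : Prop := ∀ k q, V k q ≠ 0 → q.degree < d + 1

/-- `V` is diagonal and commutes with `D(λ)`: its monomials are `x^Q x_k ∂/∂x_k` with
`Q ∈ M_λ`. -/
def ResonantDiag (lam : Idx → ℂ) (V : FVF) : Prop :=
  ∀ k q, V k q ≠ 0 → ∃ Q ∈ resM lam, q = Q + Finsupp.single k 1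

/-- The projection on the exponents in `J`. -/
def proj (J : Set MIdx) (V : FVF) : FVF := fun k => J.indicator (V k)

/-- The split norm: the maximum of the norms of the projections on `I^{(0)}`, `I^{(1)}`,
`I^{(2)}`. -/
def bnorm (lam : Idx → ℂ) (s r : ℝ) (V : FVF) : ℝ :=
  max (max (vnorm s r (proj (J0 lam) V)) (vnorm s r (proj (J1 lam \ J2 lam) V)))
    (vnorm s r (proj (J2 lam) V))

/-- `D(λ) = ∑ λ_k x_k ∂/∂x_k`. -/
def diagField (lam : Idx → ℂ) : FVF :=
  fun k q => if q = Finsupp.single k 1 then lam k else 0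

/-- The value at `x` of the component `V^{(k)}`. -/
def evalVF (V : FVF) (x : Idx → ℂ) (k : Idx) : ℂ :=
  ∑' q : MIdx, V k q * q.prod fun i n => x i ^ n

/-- The Lie bracket `[X,Y] = ∑_k (X[Y^{(k)}] - Y[X^{(k)}]) ∂/∂x_k`, coefficient by coefficient.
The coefficient of `x^q` in `X^{(j)} ∂Y^{(k)}/∂x_j` is the sum of `p₂(j) X_{p₁}^{(j)} Y_{p₂}^{(k)}`
over `p₁ + p₂ = q + e_j`. For momentum preserving fields only finitely many `j` contribute. -/
def bracket (X Y : FVF) : FVF := fun k q =>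
  ∑' j : Idx, ∑ p ∈ (Finset.HasAntidiagonal.antidiagonal (q + Finsupp.single j 1) : Finset (MIdx × MIdx)),
    (p.2 j : ℂ) * (X j p.1 * Y k p.2 - Y j p.1 * X k p.2)

/-- `V = exp(L_F) W = ∑_n ad_F^n W / n!`, coefficient by coefficient. -/
def IsLieExp (F W V : FVF) : Prop :=
  ∀ k q, HasSum (fun n : ℕ => ((n ! : ℕ) : ℂ)⁻¹ * ((bracket F)^[n] W) k q) (V k q)

/-! ### Flows -/

/-- `c` solves `ẋ = F(x)` in the ball of radius `R` of `g_s` for times in `[0,1]`. -/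
def IsSolution (s R : ℝ) (F : FVF) (c : ℝ → G s) : Prop :=
  ∀ t ∈ Set.Icc (0 : ℝ) 1, ‖c t‖ < R ∧
    ∃ v : G s, (∀ k, v k = evalVF F (c t) k) ∧ HasDerivWithinAt c v (Set.Icc 0 1) t

/-- `Φ` is the well defined time-1 flow of `F` from the ball of radius `R₀` of `g_s` to the ball
of radius `R`: through every initial point in the first there is a solution on `[0,1]` inside the
second, and all of them end at `Φ u`. -/
def IsTimeOneFlow (s R₀ R : ℝ) (F : FVF) (Φ : G s → G s) : Prop :=
  ∀ u : G s, ‖u‖ < R₀ →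
    (∃ c, IsSolution s R F c ∧ c 0 = u ∧ c 1 = Φ u) ∧
    ∀ c, IsSolution s R F c → c 0 = u → c 1 = Φ u

/-- `Φ` conjugates `W` to `V` on the ball of radius `R₀`: `dΦ(x) V(x) = W(Φ(x))`. As `W` and `V`
may contain the unbounded field `D(λ)`, which maps `g_{s'}` to `g_s` only for `s' > s`, the point
`x` ranges over the balls of the `g_{s'}` with `s' > s`, and the two sides are elements of `g_s`. -/
def Conjugates (s R₀ : ℝ) (Φ : G s → G s) (W V : FVF) : Prop :=
  ∀ s', s < s' → ∀ x : G s, wNorm s' (fun k => ‖x k‖ₑ) < ENNReal.ofReal R₀ →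
    ∃ v w : G s, (∀ k, v k = evalVF V x k) ∧ (∀ k, w k = evalVF W (Φ x) k) ∧
      fderiv ℂ Φ x v = w

end

end ResonantNF

open ResonantNF

namespace ResonantNF

noncomputable section

/-! ### The weighted norm -/

/-! The change of variables is the time-one flow of a field F solving [F, D(λ)+Z+N] = -X on all
exponents outside `J2`. For such F the first bracket is [F,W] = -X + [F,X] + (the `J2` part of
[F,Z+N]) (`bracket_total`). In exp(L_F)W the term X cancels, and outside `J2` only D(λ), Z and terms
quadratic in X remain.

The equation is solvable because brackets with Z and N are triangular for the filtration "all
exponents ⊇ `J1` ⊇ `J2`". A bracket with N descends one level, since a derivative spoils at most one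
of the two generators dividing an exponent of N. A bracket with Z preserves the level and is
nilpotent of order two on each graded piece: what survives of [V,Z] in component k contains a factor
x_k, and bracketing such a field with Z again gains a full monomial of M_λ (`IdealStep`). The
bracket with D(λ) is diagonal on monomials, so on each level one correction of the naive solution is
exact (`IdealStep.homSol_eq`, `StepData.exists_homological`). No divisor vanishes there, because
resonant monomials of degree at least M_* lie in `J2`.

Divisors are bounded by `small_divisor`: momentum conservation and the quadratic growth of λ control
the largest index of q and the output index k by the remaining indices, unless these two cancel. The
loss is then exp(c/σ^6), apart from a factor absorbed by raising s by σ (`Bd.multiplier`). Products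
and brackets are estimated through majorants, power series with coefficients in [0,∞], where y^q
plus its derivative along h is at most (y+h)^q; this gives Cauchy estimates without contour
integrals (`SBd.act`, `Bd.lie`). The Lie series is summed from [F,W] onwards, where D(λ) no longer
occurs, so the unbounded field never has to be estimated.

For the flow, Picard-Lindelöf gives solutions. Along a solution c, a power series g satisfies
(g∘c)^{(n)} = F^n[g]∘c, so Taylor's formula identifies the time-one map with the convergent series ∑
F^n[x]/n!, which is analytic (`IsSolution.apply_one`, `Bd.analyticOnNhd`). Conjugation follows from
the Leibniz rule F^n[W[x_k]]/n! = ∑_{a+b=n} (ad_F^a W/a!)[F^b[x_k]/b!]: summed over n, the left side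
is W(Φ(x))_k and the right side is W_+ applied to Φ_k (`actDiv_act`, `conjugates_flow`). -/

theorem wNorm_mono {s : ℝ} {y z : Idx → ℝ≥0∞} (h : ∀ k, y k ≤ z k) : wNorm s y ≤ wNorm s z := by
  unfold wNorm
  gcongr with k
  exact h k

theorem wNorm_add_le (s : ℝ) (y z : Idx → ℝ≥0∞) :
    wNorm s (y + z) ≤ wNorm s y + wNorm s z := by
  let _ : MeasurableSpace Idx := ⊤
  have key := ENNReal.lintegral_Lp_add_le (μ := MeasureTheory.Measure.count)
    (f := fun k : Idx => ENNReal.ofReal (weight s k) * y k)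
    (g := fun k : Idx => ENNReal.ofReal (weight s k) * z k) (p := 2)
    (measurable_from_top.aemeasurable) (measurable_from_top.aemeasurable) (by norm_num)
  simp only [MeasureTheory.lintegral_count, Pi.add_apply, ← mul_add] at key
  simpa [wNorm] using key

theorem wNorm_const_mul (s : ℝ) (c : ℝ≥0∞) (y : Idx → ℝ≥0∞) :
    wNorm s (fun k => c * y k) = c * wNorm s y := by
  unfold wNorm
  have h : ∀ k, (ENNReal.ofReal (weight s k) * (c * y k)) ^ 2
      = c ^ 2 * (ENNReal.ofReal (weight s k) * y k) ^ 2 := fun k => by ring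
  simp only [h, ENNReal.tsum_mul_left]
  rw [ENNReal.mul_rpow_of_nonneg _ _ (by norm_num), ← ENNReal.rpow_natCast, ← ENNReal.rpow_mul]
  norm_num

theorem wNorm_zero (s : ℝ) : wNorm s (fun _ => 0) = 0 := by
  simp [wNorm]

theorem weight_mul_le_wNorm (s : ℝ) (y : Idx → ℝ≥0∞) (k : Idx) :
    ENNReal.ofReal (weight s k) * y k ≤ wNorm s y := by
  unfold wNorm
  calc ENNReal.ofReal (weight s k) * y k
      = ((ENNReal.ofReal (weight s k) * y k) ^ 2) ^ (1 / 2 : ℝ) := by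
        rw [← ENNReal.rpow_natCast, ← ENNReal.rpow_mul]; norm_num
    _ ≤ _ := by
        gcongr
        exact ENNReal.le_tsum (f := fun k => (ENNReal.ofReal (weight s k) * y k) ^ 2) k

theorem one_le_bra (k : Idx) : 1 ≤ bra k := le_max_right _ _

theorem apply_ne_top_of_wNorm_ne_top {s : ℝ} {y : Idx → ℝ≥0∞} (h : wNorm s y ≠ ⊤) (k : Idx) :
    y k ≠ ⊤ := by
  intro hk
  have h1 := weight_mul_le_wNorm s y k
  rw [hk, ENNReal.mul_top (by simp [weight_pos])] at h1
  exact h (top_le_iff.1 h1)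

theorem wNorm_finset_sum_le {ι : Type*} (s : ℝ) (F : Finset ι) (y : ι → Idx → ℝ≥0∞) :
    wNorm s (∑ n ∈ F, y n) ≤ ∑ n ∈ F, wNorm s (y n) := by
  classical
  induction F using Finset.induction_on with
  | empty => simpa using! (wNorm_zero s).le
  | insert a F ha ih =>
    rw [Finset.sum_insert ha, Finset.sum_insert ha]
    exact (wNorm_add_le s _ _).trans (by gcongr)

/-- Minkowski's inequality for countable sums: the finite inequality holds for every partial sum,
and the limit is taken on a finite set of indices before the supremum over such sets. -/
theorem wNorm_tsum_le (s : ℝ) (y : ℕ → Idx → ℝ≥0∞) :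
    wNorm s (fun k => ∑' n, y n k) ≤ ∑' n, wNorm s (y n) := by
  have hmono : ∀ B : ℝ≥0∞, (∀ N, wNorm s (fun k => ∑ n ∈ Finset.range N, y n k) ≤ B) →
      wNorm s (fun k => ∑' n, y n k) ≤ B := by
    intro B hB
    have hB2 : ∀ N, ∑' k, (ENNReal.ofReal (weight s k) * ∑ n ∈ Finset.range N, y n k) ^ 2
        ≤ B ^ 2 := by
      intro N
      have := ENNReal.rpow_le_rpow (hB N) (zero_le_two : (0:ℝ) ≤ 2)
      unfold wNorm at this
      rw [← ENNReal.rpow_mul] at this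
      norm_num at this
      exact this
    have h1 : ∀ F : Finset Idx, ∑ k ∈ F, (ENNReal.ofReal (weight s k) * ∑' n, y n k) ^ 2
        ≤ B ^ 2 := by
      intro F
      have ht : Filter.Tendsto (fun N => ∑ k ∈ F, (ENNReal.ofReal (weight s k) *
          ∑ n ∈ Finset.range N, y n k) ^ 2) Filter.atTop
          (nhds (∑ k ∈ F, (ENNReal.ofReal (weight s k) * ∑' n, y n k) ^ 2)) := by
        refine tendsto_finsetSum _ fun k _ => ?_
        refine ((ENNReal.continuous_pow 2).tendsto _).comp ?_
        exact ENNReal.Tendsto.const_mul (ENNReal.tendsto_nat_tsum _)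
          (Or.inr ENNReal.ofReal_ne_top)
      refine le_of_tendsto' ht fun N => ?_
      exact (ENNReal.sum_le_tsum F).trans (hB2 N)
    have h2 : ∑' k, (ENNReal.ofReal (weight s k) * ∑' n, y n k) ^ 2 ≤ B ^ 2 := by
      rw [ENNReal.tsum_eq_iSup_sum]
      exact iSup_le h1
    unfold wNorm
    calc _ ≤ (B ^ 2) ^ (1 / 2 : ℝ) := by gcongr
      _ = B := by rw [← ENNReal.rpow_natCast, ← ENNReal.rpow_mul]; norm_num
  refine hmono _ fun N => ?_
  have := wNorm_finset_sum_le s (Finset.range N) y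
  calc _ = wNorm s (∑ n ∈ Finset.range N, y n) := by
        congr 1; ext k; simp
    _ ≤ _ := this.trans (ENNReal.sum_le_tsum _)

/-- Increasing `s` by `σ` amounts to multiplying the entries by `e^{σ√⟨k⟩}`. -/
theorem wNorm_add_eq (s σ : ℝ) (y : Idx → ℝ≥0∞) :
    wNorm (s + σ) y
      = wNorm s (fun k => ENNReal.ofReal (Real.exp (σ * Real.sqrt (bra k))) * y k) := by
  unfold wNorm
  congr 1
  refine tsum_congr fun k => ?_
  rw [← mul_assoc, ← ENNReal.ofReal_mul (weight_pos s k).le]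
  congr 3
  unfold weight
  rw [mul_assoc, ← Real.exp_add]
  ring_nf

theorem wNorm_le_of_le {s s' : ℝ} (h : s ≤ s') (y : Idx → ℝ≥0∞) : wNorm s y ≤ wNorm s' y := by
  obtain ⟨σ, rfl⟩ : ∃ σ, s' = s + σ := ⟨s' - s, by ring⟩
  rw [wNorm_add_eq]
  refine wNorm_mono fun k => ?_
  calc y k = 1 * y k := (one_mul _).symm
    _ ≤ _ := by
      gcongr
      rw [ENNReal.one_le_ofReal]
      exact Real.one_le_exp (mul_nonneg (by linarith) (Real.sqrt_nonneg _))

/-! ### Monomials and power series with nonnegative coefficients -/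

/-- The monomial `x^q`. -/
def mono {M : Type*} [CommMonoid M] (x : Idx → M) (q : MIdx) : M := q.prod fun i n => x i ^ n

section mono

variable {M : Type*} [CommMonoid M]

@[simp] theorem mono_zero (x : Idx → M) : mono x 0 = 1 := by simp [mono]

theorem mono_add (x : Idx → M) (p q : MIdx) : mono x (p + q) = mono x p * mono x q := by
  classical
  exact Finsupp.prod_add_index' (by simp) (by intros; rw [pow_add])

@[simp] theorem mono_single (x : Idx → M) (i : Idx) (n : ℕ) :
    mono x (Finsupp.single i n) = x i ^ n := by simp [mono]

theorem mono_mul (x y : Idx → M) (q : MIdx) :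
    mono (fun i => x i * y i) q = mono x q * mono y q := by
  simp [mono, mul_pow, Finsupp.prod_mul]

theorem map_mono {N : Type*} [CommMonoid N] (f : M →* N) (x : Idx → M) (q : MIdx) :
    f (mono x q) = mono (fun i => f (x i)) q := by
  simp [mono, map_finsuppProd]

theorem mono_const (c : M) (q : MIdx) : mono (fun _ => c) q = c ^ q.degree := by
  rw [mono, Finsupp.prod, Finset.prod_pow_eq_pow_sum, Finsupp.degree_apply]

end mono

theorem mono_le_mono {x y : Idx → ℝ≥0∞} (h : ∀ i, x i ≤ y i) (q : MIdx) :
    mono x q ≤ mono y q :=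
  Finset.prod_le_prod' fun i _ => pow_le_pow_left' (h i) _

theorem enorm_mono (x : Idx → ℂ) (q : MIdx) : ‖mono x q‖ₑ = mono (fun i => ‖x i‖ₑ) q :=
  map_mono (⟨⟨fun z : ℂ => ‖z‖ₑ, by simp⟩, fun _ _ => enorm_mul _ _⟩ : ℂ →* ℝ≥0∞) x q

/-- The majorant series `∑ |f_q| y^q`. -/
def ser (f : MIdx → ℂ) (y : Idx → ℝ≥0∞) : ℝ≥0∞ := ∑' q, ‖f q‖ₑ * mono y q

/-- The majorant of a vector field. -/
def serV (V : FVF) (y : Idx → ℝ≥0∞) (k : Idx) : ℝ≥0∞ := ser (V k) y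

theorem ser_le_ser {f g : MIdx → ℂ} (h : ∀ q, ‖f q‖ₑ ≤ ‖g q‖ₑ) (y : Idx → ℝ≥0∞) :
    ser f y ≤ ser g y := by
  unfold ser
  gcongr with q
  exact h q

theorem ser_add_le (f g : MIdx → ℂ) (y : Idx → ℝ≥0∞) : ser (f + g) y ≤ ser f y + ser g y := by
  unfold ser
  rw [← ENNReal.tsum_add]
  gcongr with q
  rw [← add_mul]
  gcongr
  exact enorm_add_le _ _

/-! ### Bounded vector fields and functions -/

/-- The majorant of `V` maps the ball of radius `r` of `g_s` to that of radius `B`. -/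
def Bd (s r : ℝ) (V : FVF) (B : ℝ) : Prop :=
  ∀ y : Idx → ℝ≥0∞, wNorm s y < ENNReal.ofReal r → wNorm s (serV V y) ≤ ENNReal.ofReal B

/-- The majorant of `f` is at most `M` on the ball of radius `r` of `g_s`. -/
def SBd (s r : ℝ) (f : MIdx → ℂ) (M : ℝ) : Prop :=
  ∀ y : Idx → ℝ≥0∞, wNorm s y < ENNReal.ofReal r → ser f y ≤ ENNReal.ofReal M

theorem Bd.of_le {s r : ℝ} {V : FVF} {B B' : ℝ} (h : Bd s r V B) (hB : B ≤ B') : Bd s r V B' :=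
  fun y hy => (h y hy).trans (ENNReal.ofReal_le_ofReal hB)

theorem Bd.of_radius_le {s r r' : ℝ} {V : FVF} {B : ℝ} (h : Bd s r V B) (hr : r' ≤ r) :
    Bd s r' V B :=
  fun y hy => h y (hy.trans_le (ENNReal.ofReal_le_ofReal hr))

theorem Bd.of_norm_le {s r : ℝ} {V V' : FVF} {B : ℝ} (h : Bd s r V B)
    (hV : ∀ k q, ‖V' k q‖ ≤ ‖V k q‖) : Bd s r V' B :=
  fun y hy => (wNorm_mono fun k => ser_le_ser (fun q => by
    simpa [← ofReal_norm] using ENNReal.ofReal_le_ofReal (hV k q)) y).trans (h y hy)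

theorem Bd.add {s r : ℝ} {V V' : FVF} {B B' : ℝ} (h : Bd s r V B) (h' : Bd s r V' B')
    (hB : 0 ≤ B) (hB' : 0 ≤ B') : Bd s r (V + V') (B + B') := by
  intro y hy
  rw [ENNReal.ofReal_add hB hB']
  calc _ ≤ wNorm s (serV V y + serV V' y) := wNorm_mono fun k => ser_add_le _ _ _
    _ ≤ _ := (wNorm_add_le _ _ _).trans (add_le_add (h y hy) (h' y hy))

theorem Bd.neg {s r : ℝ} {V : FVF} {B : ℝ} (h : Bd s r V B) : Bd s r (-V) B :=
  h.of_norm_le fun k q => by simp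

theorem Bd.sub {s r : ℝ} {V V' : FVF} {B B' : ℝ} (h : Bd s r V B) (h' : Bd s r V' B')
    (hB : 0 ≤ B) (hB' : 0 ≤ B') : Bd s r (V - V') (B + B') := by
  rw [sub_eq_add_neg]
  exact h.add h'.neg hB hB'

theorem norm_proj_le (J : Set MIdx) (V : FVF) (k : Idx) (q : MIdx) : ‖proj J V k q‖ ≤ ‖V k q‖ := by
  unfold proj
  exact norm_indicator_le_norm_self _ _

theorem Bd.proj {s r : ℝ} {V : FVF} {B : ℝ} (h : Bd s r V B) (J : Set MIdx) :
    Bd s r (proj J V) B :=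
  h.of_norm_le (norm_proj_le J V)

theorem Bd.const_mul {s r : ℝ} {V : FVF} {B : ℝ} (h : Bd s r V B) (c : ℂ) :
    Bd s r (fun k q => c * V k q) (‖c‖ * B) := by
  intro y hy
  have h1 : serV (fun k q => c * V k q) y = fun k => ‖c‖ₑ * serV V y k := by
    funext k
    simp only [serV, ser, enorm_mul, mul_assoc, ENNReal.tsum_mul_left]
  rw [h1, wNorm_const_mul, ENNReal.ofReal_mul (norm_nonneg _), ofReal_norm]
  gcongr
  exact h y hy

/-- A series of vector fields with summable bounds. -/
theorem Bd.of_hasSum {s r : ℝ} {V : ℕ → FVF} {U : FVF} {B : ℕ → ℝ} {A : ℝ}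
    (h : ∀ n, Bd s r (V n) (B n)) (hB : ∀ n, 0 ≤ B n) (hA : HasSum B A)
    (hU : ∀ k q, HasSum (fun n => V n k q) (U k q)) : Bd s r U A := by
  intro y hy
  have h1 : ∀ k, serV U y k ≤ ∑' n, serV (V n) y k := by
    intro k
    unfold serV ser
    rw [ENNReal.tsum_comm]
    gcongr with q
    rw [ENNReal.tsum_mul_right, ← (hU k q).tsum_eq]
    gcongr
    exact enorm_tsum_le_tsum_enorm
  calc _ ≤ wNorm s (fun k => ∑' n, serV (V n) y k) := wNorm_mono h1
    _ ≤ ∑' n, wNorm s (serV (V n) y) := wNorm_tsum_le _ _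
    _ ≤ ∑' n, ENNReal.ofReal (B n) := by gcongr with n; exact h n y hy
    _ = ENNReal.ofReal A := by
      rw [← hA.tsum_eq, ENNReal.ofReal_tsum_of_nonneg hB hA.summable]

/-- Moduli of complex sequences exhaust the sequences of finite norm. -/
theorem exists_enorm_eq {s : ℝ} {y : Idx → ℝ≥0∞} (h : wNorm s y ≠ ⊤) :
    ∃ x : Idx → ℂ, (fun k => ‖x k‖ₑ) = y := by
  refine ⟨fun k => ((y k).toReal : ℂ), ?_⟩
  funext k
  rw [← ofReal_norm, Complex.norm_real, Real.norm_of_nonneg ENNReal.toReal_nonneg,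
    ENNReal.ofReal_toReal (apply_ne_top_of_wNorm_ne_top h k)]

/-- The norm is a supremum over complex sequences, whereas `Bd` quantifies over sequences in [0,∞];
a finite weighted norm forces finite entries, so the latter are moduli of the former. -/
theorem MemV.bd {s r : ℝ} {V : FVF} (hr : 0 < r) (h : MemV s r V) :
    Bd s r V (r * vnorm s r V) := by
  intro y hy
  obtain ⟨x, rfl⟩ := exists_enorm_eq (hy.trans ENNReal.ofReal_lt_top).ne
  have h1 : wNorm s (majorant V x) ≤
      ⨆ (x : Idx → ℂ) (_ : wNorm s (fun k => ‖x k‖ₑ) < ENNReal.ofReal r), wNorm s (majorant V x) :=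
    le_iSup₂ (f := fun (x : Idx → ℂ) (_ : wNorm s (fun k => ‖x k‖ₑ) < ENNReal.ofReal r) =>
      wNorm s (majorant V x)) x hy
  have h3 : ENNReal.ofReal r ≠ 0 := by simpa using hr
  rw [ENNReal.ofReal_mul hr.le, vnorm, ENNReal.ofReal_toReal h.2.2.ne, majNorm,
    ENNReal.mul_div_cancel h3 ENNReal.ofReal_ne_top]
  exact h1

theorem majNorm_le_of_bd {s r : ℝ} {V : FVF} {B : ℝ} (hr : 0 < r) (h : Bd s r V B) :
    majNorm s r V ≤ ENNReal.ofReal (B / r) := by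
  unfold majNorm
  rw [ENNReal.ofReal_div_of_pos hr]
  gcongr
  exact iSup₂_le fun x hx => h _ hx

theorem vnorm_le_of_bd {s r : ℝ} {V : FVF} {B : ℝ} (hr : 0 < r) (hB : 0 ≤ B) (h : Bd s r V B) :
    vnorm s r V ≤ B / r :=
  ENNReal.toReal_le_of_le_ofReal (by positivity) (majNorm_le_of_bd hr h)

theorem vnorm_nonneg (s r : ℝ) (V : FVF) : 0 ≤ vnorm s r V := ENNReal.toReal_nonneg

theorem bnorm_nonneg (lam : Idx → ℂ) (s r : ℝ) (V : FVF) : 0 ≤ bnorm lam s r V :=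
  (vnorm_nonneg s r _).trans (le_max_right _ _)

theorem bnorm_le_of_bd {lam : Idx → ℂ} {s r : ℝ} {V : FVF} {B : ℝ} (hr : 0 < r) (hB : 0 ≤ B)
    (h : Bd s r V B) : bnorm lam s r V ≤ B / r :=
  max_le (max_le (vnorm_le_of_bd hr hB (h.proj _)) (vnorm_le_of_bd hr hB (h.proj _)))
    (vnorm_le_of_bd hr hB (h.proj _))

/-- Vector fields without constant terms: the norm normalised by the radius is increasing. -/
theorem Bd.scale {s r r' : ℝ} {V : FVF} {B : ℝ} (h : Bd s r V B) (hV : ∀ k, V k 0 = 0)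
    (hr' : 0 < r') (hrr : r' ≤ r) : Bd s r' V (r' / r * B) := by
  intro y hy
  have hr : 0 < r := hr'.trans_le hrr
  have hc : 1 ≤ r / r' := (one_le_div hr').2 hrr
  have h1 : wNorm s (fun k => ENNReal.ofReal (r / r') * y k) < ENNReal.ofReal r := by
    rw [wNorm_const_mul]
    calc _ < ENNReal.ofReal (r / r') * ENNReal.ofReal r' := by
          refine ENNReal.mul_lt_mul_right ?_ ENNReal.ofReal_ne_top hy
          simp; positivity
      _ = ENNReal.ofReal r := by
          rw [← ENNReal.ofReal_mul (by positivity)]; congr 1; field_simp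
  -- Every monomial has degree at least one, so dilating y by r/r' ≥ 1 multiplies it by at least
  -- r/r'.
  have h2 : ∀ k, ENNReal.ofReal (r / r') * serV V y k
      ≤ serV V (fun k => ENNReal.ofReal (r / r') * y k) k := by
    intro k
    unfold serV ser
    rw [← ENNReal.tsum_mul_left]
    refine ENNReal.tsum_le_tsum fun q => ?_
    rw [mono_mul, mono_const, mul_left_comm]
    by_cases hq : q = 0
    · subst hq; simp [hV]
    · refine mul_le_mul_right (mul_le_mul_left ?_ _) _
      exact le_self_pow (by simpa using hc) ((Finsupp.degree_eq_zero_iff q).not.2 hq)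
  have h3 := (wNorm_mono h2).trans (h _ h1)
  rw [wNorm_const_mul] at h3
  rw [ENNReal.ofReal_mul (by positivity)]
  calc wNorm s (serV V y) = ENNReal.ofReal (r' / r) * (ENNReal.ofReal (r / r') *
        wNorm s (serV V y)) := by
        rw [← mul_assoc, ← ENNReal.ofReal_mul (by positivity)]
        have : r' / r * (r / r') = 1 := by field_simp
        simp [this]
    _ ≤ _ := by gcongr

/-! ### The action of vector fields on power series -/

/-- The pairs of exponents with sum `q`. -/
abbrev adiag (q : MIdx) : Finset (MIdx × MIdx) := Finset.HasAntidiagonal.antidiagonal q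

theorem mem_adiag {q : MIdx} {p : MIdx × MIdx} : p ∈ adiag q ↔ p.1 + p.2 = q :=
  Finset.HasAntidiagonal.mem_antidiagonal

/-- The coefficients of `X[f] = ∑_j X_j ∂f/∂x_j`. -/
def act (X : FVF) (f : MIdx → ℂ) : MIdx → ℂ := fun q =>
  ∑' j : Idx, ∑ p ∈ adiag (q + Finsupp.single j 1),
    (p.2 j : ℂ) * (X j p.1 * f p.2)

/-- The vector field with components `X[V_k]`. -/
def lie (X V : FVF) : FVF := fun k => act X (V k)

/-- The definition of `bracket` sums over p₁ + p₂ = q + e_j with weight p₂(j); terms with p₂(j) = 0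
vanish, and subtracting e_j from p₂ in the others gives the usual Cauchy product with ∂f/∂x_j. -/
theorem sum_antidiagonal_add_single {R : Type*} [CommSemiring R] (q : MIdx) (j : Idx)
    (g f : MIdx → R) :
    ∑ p ∈ adiag (q + Finsupp.single j 1),
        (p.2 j : R) * (g p.1 * f p.2)
      = ∑ p ∈ adiag q,
        g p.1 * (((p.2 j : R) + 1) * f (p.2 + Finsupp.single j 1)) := by
  classical
  symm
  refine Finset.sum_of_injOn (fun p : MIdx × MIdx => (p.1, p.2 + Finsupp.single j 1)) ?_ ?_ ?_ ?_
  · rintro ⟨a, b⟩ _ ⟨a', b'⟩ _ h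
    simpa using h
  · rintro ⟨a, b⟩ h
    simp only [Finset.mem_coe, mem_adiag] at h ⊢
    rw [← h, add_assoc]
  · rintro ⟨a, b⟩ h hn
    simp only [mem_adiag] at h
    by_cases hb : b j = 0
    · simp [hb]
    · exfalso
      apply hn
      have hle : Finsupp.single j 1 ≤ b := by
        simpa [Finsupp.single_le_iff] using Nat.one_le_iff_ne_zero.2 hb
      refine ⟨(a, b - Finsupp.single j 1), ?_, ?_⟩
      · simp only [Finset.mem_coe, mem_adiag]
        have h2 : a + (b - Finsupp.single j 1) + Finsupp.single j 1 = q + Finsupp.single j 1 := by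
          rw [add_assoc, tsub_add_cancel_of_le hle, h]
        exact add_right_cancel h2
      · simp only [Prod.mk.injEq, true_and]
        exact tsub_add_cancel_of_le hle
  · rintro ⟨a, b⟩ _
    simp only [Finsupp.coe_add, Pi.add_apply, Finsupp.single_eq_same, Nat.cast_add, Nat.cast_one]
    ring

theorem act_apply (X : FVF) (f : MIdx → ℂ) (q : MIdx) :
    act X f q = ∑' j : Idx, ∑ p ∈ adiag q,
        X j p.1 * (((p.2 j : ℂ) + 1) * f (p.2 + Finsupp.single j 1)) :=
  tsum_congr fun j => sum_antidiagonal_add_single q j (X j) f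

theorem tsum_mul_tsum_antidiagonal (a b : MIdx → ℝ≥0∞) :
    (∑' p, a p) * ∑' p, b p
      = ∑' q : MIdx, ∑ p ∈ adiag q, a p.1 * b p.2 := by
  calc (∑' p, a p) * ∑' p, b p = ∑' p : MIdx × MIdx, a p.1 * b p.2 := by
        rw [ENNReal.tsum_prod (f := fun i j => a i * b j), ← ENNReal.tsum_mul_right]
        simp_rw [ENNReal.tsum_mul_left]
    _ = _ := by
        rw [← Finset.HasAntidiagonal.sigmaAntidiagonalEquivProd.tsum_eq
          (f := fun p : MIdx × MIdx => a p.1 * b p.2), ENNReal.tsum_sigma']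
        refine tsum_congr fun q => ?_
        rw [tsum_fintype, ← Finset.sum_coe_sort (adiag q)
          (fun p : MIdx × MIdx => a p.1 * b p.2)]
        rfl

/-- The derivative of the monomial `x^q` in the direction `h`. -/
def dmono {R : Type*} [CommSemiring R] (x h : Idx → R) (q : MIdx) : R :=
  ∑ j ∈ q.support, (q j : R) * h j * mono x (q - Finsupp.single j 1)

theorem tsum_add_single {R : Type*} [AddCommMonoid R] [TopologicalSpace R] (j : Idx)
    {G : MIdx → R} (hG : ∀ q, q j = 0 → G q = 0) :
    ∑' p, G (p + Finsupp.single j 1) = ∑' q, G q := by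
  refine Function.Injective.tsum_eq (add_left_injective (Finsupp.single j 1)) fun q hq => ?_
  have hle : Finsupp.single j 1 ≤ q := by
    simpa [Finsupp.single_le_iff] using Nat.one_le_iff_ne_zero.2 fun h => hq (hG q h)
  exact ⟨q - Finsupp.single j 1, tsub_add_cancel_of_le hle⟩

/-- A directional derivative may be collected by variables or by monomials; with values in [0,∞] the
exchange of sums needs no hypothesis. -/
theorem tsum_mul_deriv_eq (f : MIdx → ℝ≥0∞) (y h : Idx → ℝ≥0∞) :
    ∑' j, h j * ∑' p : MIdx, ((p j : ℝ≥0∞) + 1) * f (p + Finsupp.single j 1) * mono y p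
      = ∑' q, f q * dmono y h q := by
  classical
  have h1 : ∀ j, h j * ∑' p : MIdx, ((p j : ℝ≥0∞) + 1) * f (p + Finsupp.single j 1) * mono y p
      = ∑' q : MIdx, f q * ((q j : ℝ≥0∞) * h j * mono y (q - Finsupp.single j 1)) := by
    intro j
    rw [← ENNReal.tsum_mul_left, ← tsum_add_single j
      (G := fun q : MIdx => f q * ((q j : ℝ≥0∞) * h j * mono y (q - Finsupp.single j 1)))
      (by intro q hq; simp [hq])]
    refine tsum_congr fun p => ?_
    simp only [Finsupp.coe_add, Pi.add_apply, Finsupp.single_eq_same, Nat.cast_add, Nat.cast_one,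
      add_tsub_cancel_right]
    ring
  simp_rw [h1]
  rw [ENNReal.tsum_comm]
  refine tsum_congr fun q => ?_
  rw [ENNReal.tsum_mul_left, dmono, tsum_eq_sum]
  intro j hj
  simp [Finsupp.notMem_support_iff.1 hj]

theorem dmono_add_single {R : Type*} [CommSemiring R] (x h : Idx → R) (q : MIdx) (i : Idx) :
    dmono x h (q + Finsupp.single i 1) = dmono x h q * x i + h i * mono x q := by
  classical
  have key : ∀ j, ((q + Finsupp.single i 1 : MIdx) j : R) * h j
        * mono x (q + Finsupp.single i 1 - Finsupp.single j 1)
      = (q j : R) * h j * mono x (q - Finsupp.single j 1) * x i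
        + if j = i then h i * mono x q else 0 := by
    intro j
    by_cases hji : j = i
    · subst hji
      simp only [Finsupp.coe_add, Pi.add_apply, Finsupp.single_eq_same, Nat.cast_add,
        Nat.cast_one, add_tsub_cancel_right, if_true]
      by_cases hq : q j = 0
      · simp [hq]
      · have hle : Finsupp.single j 1 ≤ q := by
          simpa [Finsupp.single_le_iff] using Nat.one_le_iff_ne_zero.2 hq
        have : mono x q = mono x (q - Finsupp.single j 1) * x j := by
          conv_lhs => rw [← tsub_add_cancel_of_le hle]
          rw [mono_add]; simp
        rw [this]; ring
    · have h0 : (Finsupp.single i 1 : MIdx) j = 0 := by simp [Ne.symm hji]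
      simp only [Finsupp.coe_add, Pi.add_apply, h0, add_zero, hji, if_false]
      by_cases hq : q j = 0
      · simp [hq]
      · have hle : Finsupp.single j 1 ≤ q := by
          simpa [Finsupp.single_le_iff] using Nat.one_le_iff_ne_zero.2 hq
        rw [← tsub_add_eq_add_tsub hle, mono_add]
        simp only [mono_single, pow_one]
        ring
  have hext : ∀ p : MIdx, p.support ⊆ (q + Finsupp.single i 1 : MIdx).support →
      dmono x h p = ∑ j ∈ (q + Finsupp.single i 1 : MIdx).support,
        (p j : R) * h j * mono x (p - Finsupp.single j 1) := by
    intro p hp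
    refine Finset.sum_subset hp fun j _ hj => ?_
    simp [Finsupp.notMem_support_iff.1 hj]
  rw [hext q (by
    intro j hj
    simp only [Finsupp.mem_support_iff, Finsupp.coe_add, Pi.add_apply] at hj ⊢
    omega)]
  unfold dmono
  simp_rw [key]
  rw [Finset.sum_add_distrib, Finset.sum_mul, Finset.sum_ite_eq', if_pos (by simp)]

theorem midx_induction {P : MIdx → Prop} (h0 : P 0)
    (h1 : ∀ q i, P q → P (q + Finsupp.single i 1)) (q : MIdx) : P q := by
  classical
  obtain ⟨n, hn⟩ : ∃ n, q.degree = n := ⟨_, rfl⟩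
  induction n generalizing q with
  | zero => rwa [(Finsupp.degree_eq_zero_iff q).1 hn]
  | succ n ih =>
    have hq : q ≠ 0 := by rintro rfl; simp at hn
    obtain ⟨i, hi⟩ := Finsupp.ne_iff.1 hq
    have hle : Finsupp.single i 1 ≤ q := by
      simpa [Finsupp.single_le_iff] using Nat.one_le_iff_ne_zero.2 hi
    have hd := congrArg Finsupp.degree (tsub_add_cancel_of_le hle)
    rw [map_add, Finsupp.degree_single, hn] at hd
    rw [← tsub_add_cancel_of_le hle]
    exact h1 _ i (ih _ (by omega))

/-- The left side consists of the terms of order zero and one in h of the expansion of the right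
side, and the others are nonnegative. This replaces Cauchy's formula: a derivative is bounded by a
value at a shifted point. -/
theorem mono_add_dmono_le (y h : Idx → ℝ≥0∞) (q : MIdx) :
    mono y q + dmono y h q ≤ mono (y + h) q := by
  induction q using midx_induction with
  | h0 => simp [dmono]
  | h1 q i ih =>
    rw [dmono_add_single, mono_add, mono_add, mono_single, mono_single, pow_one, pow_one]
    calc mono y q * y i + (dmono y h q * y i + h i * mono y q)
        = (mono y q + dmono y h q) * y i + mono y q * h i := by ring
      _ ≤ mono (y + h) q * y i + mono (y + h) q * h i := by
        gcongr
        exact (le_self_add).trans ih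
      _ = mono (y + h) q * (y + h) i := by rw [Pi.add_apply, mul_add]

/-- The majorant of `X[f]` is at most the derivative of the majorant of `f` along that of `X`. -/
theorem ser_act_le (X : FVF) (f : MIdx → ℂ) (y : Idx → ℝ≥0∞) :
    ser (act X f) y ≤ ∑' q, ‖f q‖ₑ * dmono y (serV X y) q := by
  rw [← tsum_mul_deriv_eq]
  calc ser (act X f) y
      ≤ ∑' q, (∑' j, ∑ p ∈ adiag q, (‖X j p.1‖ₑ * mono y p.1) *
          (((p.2 j : ℝ≥0∞) + 1) * ‖f (p.2 + Finsupp.single j 1)‖ₑ * mono y p.2)) := by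
        unfold ser
        refine ENNReal.tsum_le_tsum fun q => ?_
        rw [act_apply]
        refine (mul_le_mul_left enorm_tsum_le_tsum_enorm _).trans ?_
        rw [← ENNReal.tsum_mul_right]
        refine ENNReal.tsum_le_tsum fun j => ?_
        refine (mul_le_mul_left (enorm_sum_le _ _) _).trans ?_
        rw [Finset.sum_mul]
        refine Finset.sum_le_sum fun p hp => ?_
        rw [mem_adiag] at hp
        rw [← hp, mono_add, enorm_mul, enorm_mul]
        have : ‖((p.2 j : ℂ) + 1)‖ₑ = (p.2 j : ℝ≥0∞) + 1 := by
          rw [← Nat.cast_one, ← Nat.cast_add, ← ofReal_norm, Complex.norm_natCast,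
            ENNReal.ofReal_natCast]
          push_cast; rfl
        rw [this]
        apply le_of_eq
        ring
    _ = ∑' j, ∑' q, ∑ p ∈ adiag q, (‖X j p.1‖ₑ * mono y p.1) *
          (((p.2 j : ℝ≥0∞) + 1) * ‖f (p.2 + Finsupp.single j 1)‖ₑ * mono y p.2) :=
        ENNReal.tsum_comm
    _ = _ := by
        refine tsum_congr fun j => ?_
        rw [← tsum_mul_tsum_antidiagonal (fun p => ‖X j p‖ₑ * mono y p)
          (fun p => ((p j : ℝ≥0∞) + 1) * ‖f (p + Finsupp.single j 1)‖ₑ * mono y p)]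
        rfl

theorem dmono_const_mul {R : Type*} [CommSemiring R] (x h : Idx → R) (t : R) (q : MIdx) :
    dmono x (fun k => t * h k) q = t * dmono x h q := by
  unfold dmono
  rw [Finset.mul_sum]
  refine Finset.sum_congr rfl fun j _ => by ring

theorem mul_tsum_dmono_le (f : MIdx → ℂ) (y h : Idx → ℝ≥0∞) (t : ℝ≥0∞) :
    t * ∑' q, ‖f q‖ₑ * dmono y h q ≤ ser f (y + fun k => t * h k) := by
  unfold ser
  rw [← ENNReal.tsum_mul_left]
  refine ENNReal.tsum_le_tsum fun q => ?_
  rw [mul_left_comm, ← dmono_const_mul]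
  gcongr
  exact le_add_self.trans (mono_add_dmono_le _ _ _)

theorem mul_ser_act_le (X : FVF) (f : MIdx → ℂ) (y : Idx → ℝ≥0∞) (t : ℝ≥0∞) :
    t * ser (act X f) y ≤ ser f (y + fun k => t * serV X y k) :=
  (mul_le_mul_right (ser_act_le X f y) t).trans (mul_tsum_dmono_le _ _ _ _)

theorem wNorm_add_const_mul_lt {s r δ A : ℝ} {y h : Idx → ℝ≥0∞} (hA : 0 < A) (hδ : 0 < δ)
    (hy : wNorm s y < ENNReal.ofReal (r - δ)) (hh : wNorm s h ≤ ENNReal.ofReal A) :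
    wNorm s (y + fun k => ENNReal.ofReal (δ / A) * h k) < ENNReal.ofReal r := by
  have hr : 0 < r - δ := by
    by_contra hr
    rw [ENNReal.ofReal_of_nonpos (not_lt.1 hr)] at hy
    exact not_lt_zero hy
  calc _ ≤ wNorm s y + ENNReal.ofReal (δ / A) * wNorm s h := by
        rw [← wNorm_const_mul]; exact wNorm_add_le _ _ _
    _ ≤ wNorm s y + ENNReal.ofReal (δ / A) * ENNReal.ofReal A := by gcongr
    _ = wNorm s y + ENNReal.ofReal δ := by
        rw [← ENNReal.ofReal_mul (by positivity), div_mul_cancel₀ _ hA.ne']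
    _ < ENNReal.ofReal (r - δ) + ENNReal.ofReal δ :=
        ENNReal.add_lt_add_right ENNReal.ofReal_ne_top hy
    _ = ENNReal.ofReal r := by rw [← ENNReal.ofReal_add hr.le hδ.le]; ring_nf

/-- The Cauchy estimates shift y by δ/A times the field, which needs A > 0; passing to the limit
from larger A' covers A = 0. -/
theorem le_of_forall_le_ofReal_mul {a : ℝ≥0∞} {A c : ℝ}
    (h : ∀ A', A < A' → a ≤ ENNReal.ofReal (A' * c)) : a ≤ ENNReal.ofReal (A * c) := by
  have ht : Filter.Tendsto (fun A' => ENNReal.ofReal (A' * c)) (nhdsWithin A (Set.Ioi A))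
      (nhds (ENNReal.ofReal (A * c))) := by
    refine Filter.Tendsto.mono_left ?_ nhdsWithin_le_nhds
    exact ENNReal.tendsto_ofReal (Filter.Tendsto.mul_const c Filter.tendsto_id)
  exact ge_of_tendsto ht (Filter.eventually_of_mem self_mem_nhdsWithin h)

theorem le_ofReal_of_mul_le {a : ℝ≥0∞} {δ A B : ℝ} (hA : 0 < A) (hδ : 0 < δ)
    (h : ENNReal.ofReal (δ / A) * a ≤ ENNReal.ofReal B) : a ≤ ENNReal.ofReal (A * (B / δ)) := by
  calc a = ENNReal.ofReal (A / δ) * (ENNReal.ofReal (δ / A) * a) := by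
        rw [← mul_assoc, ← ENNReal.ofReal_mul (by positivity)]
        have : A / δ * (δ / A) = 1 := by field_simp
        simp [this]
    _ ≤ ENNReal.ofReal (A / δ) * ENNReal.ofReal B := by gcongr
    _ = _ := by rw [← ENNReal.ofReal_mul (by positivity)]; ring_nf

/-- Cauchy estimate for `X[f]`. -/
theorem SBd.act {s r δ A M : ℝ} {X : FVF} {f : MIdx → ℂ} (hf : SBd s r f M)
    (hX : Bd s r X A) (hA : 0 ≤ A) (hδ : 0 < δ) : SBd s (r - δ) (act X f) (A * M / δ) := by
  intro y hy
  rw [mul_div_assoc]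
  refine le_of_forall_le_ofReal_mul fun A' hA' => ?_
  have hA0 : 0 < A' := hA.trans_lt hA'
  refine le_ofReal_of_mul_le hA0 hδ ((mul_ser_act_le X f y _).trans (hf _ ?_))
  exact wNorm_add_const_mul_lt hA0 hδ hy
    ((hX.of_le hA'.le) y (hy.trans_le (ENNReal.ofReal_le_ofReal (by linarith))))

/-- One shift of y by δ/A' times the majorant of X serves all components at once, so a single use of
the bound on Y suffices. -/
theorem Bd.lie {s r δ A B : ℝ} {X Y : FVF} (hX : Bd s r X A) (hY : Bd s r Y B)
    (hA : 0 ≤ A) (hδ : 0 < δ) : Bd s (r - δ) (lie X Y) (A * B / δ) := by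
  intro y hy
  rw [mul_div_assoc]
  refine le_of_forall_le_ofReal_mul fun A' hA' => ?_
  have hA0 : 0 < A' := hA.trans_lt hA'
  refine le_ofReal_of_mul_le hA0 hδ ?_
  rw [← wNorm_const_mul]
  refine (wNorm_mono fun k => mul_ser_act_le X (Y k) y _).trans (hY _ ?_)
  exact wNorm_add_const_mul_lt hA0 hδ hy
    ((hX.of_le hA'.le) y (hy.trans_le (ENNReal.ofReal_le_ofReal (by linarith))))

/-! ### Momentum -/

theorem momZ_add (p q : Idx →₀ ℤ) : momZ (p + q) = momZ p + momZ q := by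
  classical
  exact Finsupp.sum_add_index' (by simp) (by intros; ring)

theorem momZ_sub (p q : Idx →₀ ℤ) : momZ (p - q) = momZ p - momZ q := by
  have := momZ_add (p - q) q
  rw [sub_add_cancel] at this
  linarith

theorem momZ_single (k : Idx) : momZ (Finsupp.single k 1) = mom k := by
  simp [momZ]

theorem freqZ_add (lam : Idx → ℂ) (p q : Idx →₀ ℤ) :
    freqZ lam (p + q) = freqZ lam p + freqZ lam q := by
  classical
  exact Finsupp.sum_add_index' (by simp) (by intros; push_cast; ring)

theorem freqZ_sub (lam : Idx → ℂ) (p q : Idx →₀ ℤ) :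
    freqZ lam (p - q) = freqZ lam p - freqZ lam q := by
  have := freqZ_add lam (p - q) q
  rw [sub_add_cancel] at this
  linear_combination -this

theorem freqZ_single (lam : Idx → ℂ) (k : Idx) : freqZ lam (Finsupp.single k 1) = lam k := by
  simp [freqZ]

theorem natToInt_add (p q : MIdx) : natToInt (p + q) = natToInt p + natToInt q :=
  Finsupp.mapRange_add (by intros; push_cast; ring) p q

theorem natToInt_single (k : Idx) : natToInt (Finsupp.single k 1) = Finsupp.single k 1 := by
  simp [natToInt]

theorem natToInt_injective : Function.Injective natToInt := by
  intro p q h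
  ext i
  have := DFunLike.congr_fun h i
  simpa [natToInt] using this

@[simp] theorem natToInt_zero : natToInt 0 = 0 := by
  simp [natToInt]

@[simp] theorem natToInt_apply (q : MIdx) (i : Idx) : natToInt q i = q i := rfl

/-- The momentum `𝔪 · q`. -/
def momN (q : MIdx) : ℤ := momZ (natToInt q)

theorem momN_add (p q : MIdx) : momN (p + q) = momN p + momN q := by
  rw [momN, natToInt_add, momZ_add]; rfl

@[simp] theorem momN_single (k : Idx) : momN (Finsupp.single k 1) = mom k := by
  rw [momN, natToInt_single, momZ_single]

theorem momZ_shift (q : MIdx) (k : Idx) : momZ (shift q k) = momN q - mom k := by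
  rw [shift, momZ_sub, momZ_single]; rfl

theorem freqZ_shift (lam : Idx → ℂ) (q : MIdx) (k : Idx) :
    freqZ lam (shift q k) = freqZ lam (natToInt q) - lam k := by
  rw [shift, freqZ_sub, freqZ_single]

/-- All monomials of `f` have momentum `m`. -/
def MomF (m : ℤ) (f : MIdx → ℂ) : Prop := ∀ q, f q ≠ 0 → momN q = m

/-- `V` preserves momentum. -/
def MomV (V : FVF) : Prop := ∀ k, MomF (mom k) (V k)

theorem MemV.momV {s r : ℝ} {V : FVF} (h : MemV s r V) : MomV V := by
  intro k q hq
  by_contra hne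
  exact hq (h.2.1 k q (by rw [momZ_shift]; exact sub_ne_zero.2 hne))

theorem MomV.coeff_eq_zero {V : FVF} (h : MomV V) (k : Idx) (q : MIdx)
    (hq : momZ (shift q k) ≠ 0) : V k q = 0 := by
  by_contra hne
  exact hq (by rw [momZ_shift, h k q hne, sub_self])

theorem MomV.memV {s r : ℝ} {V : FVF} {B : ℝ} (h : MomV V) (h0 : ∀ k, V k 0 = 0) (hr : 0 < r)
    (hb : Bd s r V B) : MemV s r V :=
  ⟨h0, h.coeff_eq_zero, (majNorm_le_of_bd hr hb).trans_lt ENNReal.ofReal_lt_top⟩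

/-- Only (m,1) and (-m,-1) carry momentum m. This makes the sum over j in every coefficient of a
derivative finite, and lets identities in infinitely many variables be checked on finitely many. -/
theorem finite_mom_eq (m : ℤ) : {j : Idx | mom j = m}.Finite := by
  refine Set.Finite.subset (Set.toFinite {((m : ℤ), (1 : ℤˣ)), (-m, -1)}) ?_
  rintro ⟨j, ε⟩ h
  rcases Int.units_eq_one_or ε with rfl | rfl
  · left; simp [mom] at h; simp [h]
  · right; simp [mom] at h; simp [← h]

theorem finite_mom_mem {T : Set ℤ} (hT : T.Finite) : {j : Idx | mom j ∈ T}.Finite := by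
  have : {j : Idx | mom j ∈ T} = ⋃ m ∈ T, {j : Idx | mom j = m} := by ext j; simp
  rw [this]
  exact hT.biUnion fun m _ => finite_mom_eq m

/-- The indices `j` for which `∂/∂x_j` contributes to the coefficient of `x^q` in the derivative
of a series of momentum `m`. -/
def indexSet (m : ℤ) (q : MIdx) : Set Idx := {j | mom j ∈ (fun p => m - momN p) '' Set.Iic q}

theorem finite_indexSet (m : ℤ) (q : MIdx) : (indexSet m q).Finite :=
  finite_mom_mem ((Set.finite_Iic q).image _)

theorem mem_indexSet {m : ℤ} {f : MIdx → ℂ} (hf : MomF m f) {q p₁ p₂ : MIdx} {j : Idx}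
    (h : p₁ + p₂ = q) (hne : f (p₂ + Finsupp.single j 1) ≠ 0) : j ∈ indexSet m q := by
  refine ⟨p₂, ?_, ?_⟩
  · rw [Set.mem_Iic, ← h]; exact le_add_self
  · have := hf _ hne
    rw [momN_add, momN_single] at this
    simp only
    linarith

theorem hasFiniteSupport_act {m : ℤ} (X : FVF) {f : MIdx → ℂ} (hf : MomF m f) (q : MIdx) :
    (Function.support fun j : Idx => ∑ p ∈ adiag q,
        X j p.1 * (((p.2 j : ℂ) + 1) * f (p.2 + Finsupp.single j 1))).Finite := by
  refine (finite_indexSet m q).subset fun j hj => ?_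
  obtain ⟨p, hp, hne⟩ := Finset.exists_ne_zero_of_sum_ne_zero hj
  exact mem_indexSet hf (mem_adiag.1 hp) (right_ne_zero_of_mul (right_ne_zero_of_mul hne))

theorem summable_act {m : ℤ} (X : FVF) {f : MIdx → ℂ} (hf : MomF m f) (q : MIdx) :
    Summable fun j : Idx => ∑ p ∈ adiag q,
        X j p.1 * (((p.2 j : ℂ) + 1) * f (p.2 + Finsupp.single j 1)) :=
  summable_of_hasFiniteSupport (hasFiniteSupport_act X hf q)

theorem summable_act' {m : ℤ} (X : FVF) {f : MIdx → ℂ} (hf : MomF m f) (q : MIdx) :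
    Summable fun j : Idx => ∑ p ∈ adiag (q + Finsupp.single j 1),
        (p.2 j : ℂ) * (X j p.1 * f p.2) := by
  simp_rw [sum_antidiagonal_add_single]
  exact summable_act X hf q

/-- An infinite sum of differences splits only if both parts are summable; momentum conservation
gives each finite support. -/
theorem bracket_eq {X Y : FVF} (hX : MomV X) (hY : MomV Y) :
    bracket X Y = lie X Y - lie Y X := by
  funext k q
  change bracket X Y k q = act X (Y k) q - act Y (X k) q
  unfold act
  rw [← (summable_act' X (hY k) q).tsum_sub (summable_act' Y (hX k) q)]
  refine tsum_congr fun j => ?_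
  rw [← Finset.sum_sub_distrib]
  refine Finset.sum_congr rfl fun p _ => by ring

theorem act_add_left {m : ℤ} (X Y : FVF) {f : MIdx → ℂ} (hf : MomF m f) :
    act (X + Y) f = act X f + act Y f := by
  funext q
  change act (X + Y) f q = act X f q + act Y f q
  unfold act
  rw [← (summable_act' X hf q).tsum_add (summable_act' Y hf q)]
  refine tsum_congr fun j => ?_
  rw [← Finset.sum_add_distrib]
  refine Finset.sum_congr rfl fun p _ => ?_
  simp only [Pi.add_apply]
  ring

theorem act_add_right {m : ℤ} (X : FVF) {f g : MIdx → ℂ} (hf : MomF m f) (hg : MomF m g) :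
    act X (f + g) = act X f + act X g := by
  funext q
  change act X (f + g) q = act X f q + act X g q
  unfold act
  rw [← (summable_act' X hf q).tsum_add (summable_act' X hg q)]
  refine tsum_congr fun j => ?_
  rw [← Finset.sum_add_distrib]
  refine Finset.sum_congr rfl fun p _ => ?_
  simp only [Pi.add_apply]
  ring

theorem act_const_mul (X : FVF) (c : ℂ) (f : MIdx → ℂ) :
    act X (fun q => c * f q) = fun q => c * act X f q := by
  funext q
  simp only [act, ← tsum_mul_left, Finset.mul_sum]
  refine tsum_congr fun j => Finset.sum_congr rfl fun p _ => by ring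

theorem exists_of_act_ne_zero {X : FVF} {f : MIdx → ℂ} {q : MIdx} (h : act X f q ≠ 0) :
    ∃ j p₁ p₂, p₁ + p₂ = q ∧ X j p₁ ≠ 0 ∧ f (p₂ + Finsupp.single j 1) ≠ 0 := by
  rw [act_apply] at h
  obtain ⟨j, hj⟩ : ∃ j, ∑ p ∈ adiag q,
      X j p.1 * (((p.2 j : ℂ) + 1) * f (p.2 + Finsupp.single j 1)) ≠ 0 := by
    by_contra hall
    push Not at hall
    exact h (by simp [hall])
  obtain ⟨p, hp, hne⟩ := Finset.exists_ne_zero_of_sum_ne_zero hj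
  exact ⟨j, p.1, p.2, mem_adiag.1 hp, left_ne_zero_of_mul hne,
    right_ne_zero_of_mul (right_ne_zero_of_mul hne)⟩

theorem MomF.act {m : ℤ} {X : FVF} {f : MIdx → ℂ} (hf : MomF m f) (hX : MomV X) :
    MomF m (act X f) := by
  intro q hq
  obtain ⟨j, p₁, p₂, h, h1, h2⟩ := exists_of_act_ne_zero hq
  have e1 := hX j p₁ h1
  have e2 := hf _ h2
  rw [momN_add, momN_single] at e2
  rw [← h, momN_add]
  linarith

theorem MomF.add {m : ℤ} {f g : MIdx → ℂ} (hf : MomF m f) (hg : MomF m g) : MomF m (f + g) := by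
  intro q hq
  by_cases h : f q = 0
  · exact hg q fun hh => hq (by simp [h, hh])
  · exact hf q h

theorem MomF.neg {m : ℤ} {f : MIdx → ℂ} (hf : MomF m f) : MomF m (-f) :=
  fun q hq => hf q fun h => hq (by simp [h])

theorem MomV.add {X Y : FVF} (hX : MomV X) (hY : MomV Y) : MomV (X + Y) :=
  fun k => (hX k).add (hY k)

theorem MomV.neg {X : FVF} (hX : MomV X) : MomV (-X) := fun k => (hX k).neg

theorem MomV.sub {X Y : FVF} (hX : MomV X) (hY : MomV Y) : MomV (X - Y) := by
  rw [sub_eq_add_neg]; exact hX.add hY.neg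

theorem MomV.lie {X Y : FVF} (hX : MomV X) (hY : MomV Y) : MomV (lie X Y) :=
  fun k => (hY k).act hX

theorem MomV.bracket {X Y : FVF} (hX : MomV X) (hY : MomV Y) : MomV (bracket X Y) := by
  rw [bracket_eq hX hY]
  exact (hX.lie hY).sub (hY.lie hX)

theorem MomV.of_ne_zero {X Y : FVF} (hX : MomV X) (h : ∀ k q, Y k q ≠ 0 → X k q ≠ 0) : MomV Y :=
  fun k q hq => hX k q (h k q hq)

theorem proj_ne_zero {J : Set MIdx} {V : FVF} {k : Idx} {q : MIdx} (h : proj J V k q ≠ 0) :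
    q ∈ J ∧ V k q ≠ 0 := by
  unfold proj at h
  exact ⟨Set.mem_of_indicator_ne_zero h, fun hV => h (by simp [hV])⟩

theorem MomV.proj {X : FVF} (hX : MomV X) (J : Set MIdx) : MomV (proj J X) :=
  hX.of_ne_zero fun _ _ h => (proj_ne_zero h).2

theorem bracket_add_right {F X Y : FVF} (hF : MomV F) (hX : MomV X) (hY : MomV Y) :
    bracket F (X + Y) = bracket F X + bracket F Y := by
  rw [bracket_eq hF (hX.add hY), bracket_eq hF hX, bracket_eq hF hY]
  funext k
  change act F (X k + Y k) - act (X + Y) (F k)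
    = (act F (X k) - act X (F k)) + (act F (Y k) - act Y (F k))
  rw [act_add_right F (hX k) (hY k), act_add_left X Y (hF k)]
  abel

theorem bracket_add_left {F X Y : FVF} (hF : MomV F) (hX : MomV X) (hY : MomV Y) :
    bracket (X + Y) F = bracket X F + bracket Y F := by
  rw [bracket_eq (hX.add hY) hF, bracket_eq hX hF, bracket_eq hY hF]
  funext k
  change act (X + Y) (F k) - act F (X k + Y k)
    = (act X (F k) - act F (X k)) + (act Y (F k) - act F (Y k))
  rw [act_add_right F (hX k) (hY k), act_add_left X Y (hF k)]
  abel

theorem exists_of_bracket_ne_zero {X Y : FVF} (hX : MomV X) (hY : MomV Y) {k : Idx} {q : MIdx}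
    (h : bracket X Y k q ≠ 0) : act X (Y k) q ≠ 0 ∨ act Y (X k) q ≠ 0 := by
  rw [bracket_eq hX hY] at h
  by_contra hc
  push Not at hc
  exact h (by change act X (Y k) q - act Y (X k) q = 0; rw [hc.1, hc.2, sub_zero])

theorem Bd.bracket {s r δ A B : ℝ} {X Y : FVF} (hX : Bd s r X A) (hY : Bd s r Y B)
    (hmX : MomV X) (hmY : MomV Y) (hA : 0 ≤ A) (hB : 0 ≤ B) (hδ : 0 < δ) :
    Bd s (r - δ) (bracket X Y) (2 * A * B / δ) := by
  rw [bracket_eq hmX hmY]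
  refine ((hX.lie hY hA hδ).sub (hY.lie hX hB hδ) (by positivity) (by positivity)).of_le ?_
  apply le_of_eq
  ring

/-! ### Small divisors -/

/-- As log u ≤ 2√u, the left side is at most B√u/4 with B = 4(b+2d). If √u ≥ B/σ this is at most
σu/4. Otherwise B/σ ≥ 1, and it is at most B²/(4σ) ≤ B⁷/(4σ⁶). The sixth power is the one needed in
`logSum_le`. -/
theorem absorb_log {b d : ℝ} (hb : 0 ≤ b) (hd : 0 ≤ d) :
    ∃ c : ℝ, 0 ≤ c ∧ ∀ σ u : ℝ, 0 < σ → 1 ≤ u → b + d * Real.log u ≤ σ * u / 4 + c / σ ^ 6 := by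
  set B := 4 * (b + 2 * d) with hB
  refine ⟨B ^ 7 / 4, by positivity, fun σ u hσ hu => ?_⟩
  have hB0 : 0 ≤ B := by positivity
  have hv1 : 1 ≤ √u := Real.one_le_sqrt.2 hu
  have hsq : √u * √u = u := Real.mul_self_sqrt (by linarith)
  have hlog : Real.log u ≤ 2 * √u := by
    rw [← hsq, Real.log_mul (by positivity) (by positivity)]
    have := Real.log_le_sub_one_of_pos (show 0 < √u by positivity)
    rw [hsq]
    linarith
  have h1 : b + d * Real.log u ≤ B / 4 * √u := by
    have : d * Real.log u ≤ d * (2 * √u) := by gcongr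
    have : b ≤ b * √u := le_mul_of_one_le_right hb hv1
    rw [hB]; linarith
  refine h1.trans ?_
  rcases le_total (B / σ) (√u) with h | h
  · have : B ≤ σ * √u := by rw [div_le_iff₀ hσ] at h; linarith
    have h2 : B / 4 * √u ≤ σ * u / 4 := by
      have h3 : B * √u ≤ σ * √u * √u := by gcongr
      have h5 : σ * √u * √u = σ * u := by rw [mul_assoc, hsq]
      linarith
    have : 0 ≤ B ^ 7 / 4 / σ ^ 6 := by positivity
    linarith
  · have h3 : 1 ≤ B / σ := hv1.trans h
    have h4 : B / 4 * √u ≤ B / 4 * (B / σ) ^ 6 := by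
      gcongr
      exact h.trans (le_self_pow₀ h3 (by norm_num))
    have h5 : B / 4 * (B / σ) ^ 6 = B ^ 7 / 4 / σ ^ 6 := by rw [div_pow]; ring
    have : 0 ≤ σ * u / 4 := by positivity
    linarith

/-- `∑ q_i √⟨i⟩`. -/
def sqrtSum (q : MIdx) : ℝ := q.sum fun i n => (n : ℝ) * √(bra i)

theorem sqrtSum_add (p q : MIdx) : sqrtSum (p + q) = sqrtSum p + sqrtSum q := by
  classical
  exact Finsupp.sum_add_index' (by simp) (by intros; push_cast; ring)

@[simp] theorem sqrtSum_single (i : Idx) : sqrtSum (Finsupp.single i 1) = √(bra i) := by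
  simp [sqrtSum]

theorem one_le_sqrt_bra (i : Idx) : 1 ≤ √(bra i) := Real.one_le_sqrt.2 (one_le_bra i)

theorem term_le_sqrtSum (q : MIdx) {i : Idx} (hi : i ∈ q.support) :
    (q i : ℝ) * √(bra i) ≤ sqrtSum q :=
  Finset.single_le_sum (f := fun i => (q i : ℝ) * √(bra i)) (fun j _ => by positivity) hi

theorem sqrt_bra_le_sqrtSum (q : MIdx) {i : Idx} (hi : i ∈ q.support) : √(bra i) ≤ sqrtSum q := by
  refine le_trans ?_ (term_le_sqrtSum q hi)
  refine le_mul_of_one_le_left (by positivity) ?_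
  exact_mod_cast Nat.one_le_iff_ne_zero.2 (Finsupp.mem_support_iff.1 hi)

theorem one_le_sqrtSum {q : MIdx} (hq : q ≠ 0) : 1 ≤ sqrtSum q := by
  obtain ⟨i, hi⟩ := Finsupp.support_nonempty_iff.2 hq
  exact (one_le_sqrt_bra i).trans (sqrt_bra_le_sqrtSum q hi)

theorem sqrtSum_nonneg (q : MIdx) : 0 ≤ sqrtSum q :=
  Finset.sum_nonneg fun _ _ => by positivity

/-- `∑ log (1 + p_i² ⟨i⟩²)`. -/
def logSum (p : Idx →₀ ℤ) : ℝ := p.sum fun i n => Real.log (1 + (n : ℝ) ^ 2 * bra i ^ 2)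

theorem logSum_nonneg (p : Idx →₀ ℤ) : 0 ≤ logSum p :=
  Finset.sum_nonneg fun i _ => Real.log_nonneg (by nlinarith [sq_nonneg ((p i : ℝ) * bra i)])

theorem prod_eq_exp_logSum (τ : ℝ) (p : Idx →₀ ℤ) :
    (p.prod fun i n => 1 / (1 + (n : ℝ) ^ 2 * bra i ^ 2) ^ τ) = Real.exp (-(τ * logSum p)) := by
  unfold logSum Finsupp.sum Finsupp.prod
  rw [Finset.mul_sum, ← Finset.sum_neg_distrib, Real.exp_sum]
  refine Finset.prod_congr rfl fun i _ => ?_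
  have : 0 < 1 + (p i : ℝ) ^ 2 * bra i ^ 2 := by positivity
  beta_reduce
  rw [Real.rpow_def_of_pos this, Real.exp_neg, one_div, mul_comm]

theorem logSum_add_single_le (p : Idx →₀ ℤ) (i : Idx) {ε : ℤ} (hε : ε ^ 2 = 1) :
    logSum (p + Finsupp.single i ε) ≤ logSum p + Real.log (2 * (1 + bra i ^ 2)) := by
  classical
  set g : Idx → ℤ → ℝ := fun i n => Real.log (1 + (n : ℝ) ^ 2 * bra i ^ 2) with hg
  have hext : ∀ p' : Idx →₀ ℤ, p'.support ⊆ insert i p.support →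
      logSum p' = ∑ j ∈ insert i p.support, g j (p' j) := by
    intro p' hp'
    refine Finset.sum_subset hp' fun j _ hj => ?_
    simp [Finsupp.notMem_support_iff.1 hj]
  rw [hext p (Finset.subset_insert _ _), hext (p + Finsupp.single i ε), ← Finset.add_sum_erase _ _
    (Finset.mem_insert_self i _), ← Finset.add_sum_erase _ (fun j => g j (p j))
    (Finset.mem_insert_self i _)]
  · have h1 : ∑ j ∈ (insert i p.support).erase i, g j ((p + Finsupp.single i ε) j)
        = ∑ j ∈ (insert i p.support).erase i, g j (p j) := by
      refine Finset.sum_congr rfl fun j hj => ?_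
      have hji : i ≠ j := (Finset.ne_of_mem_erase hj).symm
      simp [hji]
    have h2 : g i ((p + Finsupp.single i ε) i) ≤ g i (p i) + Real.log (2 * (1 + bra i ^ 2)) := by
      have hb := bra_pos i
      simp only [hg, Finsupp.coe_add, Pi.add_apply, Finsupp.single_eq_same]
      rw [← Real.log_mul (by positivity) (by positivity)]
      refine Real.log_le_log (by positivity) ?_
      have hε' : (ε : ℝ) ^ 2 = 1 := by exact_mod_cast hε
      push_cast
      have : ((p i : ℝ) + ε) ^ 2 ≤ 2 * (p i : ℝ) ^ 2 + 2 * (ε : ℝ) ^ 2 := by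
        nlinarith [sq_nonneg ((p i : ℝ) - ε)]
      rw [hε'] at this
      have h3 : ((p i : ℝ) + ε) ^ 2 * bra i ^ 2 ≤ (2 * (p i : ℝ) ^ 2 + 2 * 1) * bra i ^ 2 := by
        gcongr
      nlinarith [sq_nonneg ((p i : ℝ) * bra i ^ 2), sq_nonneg ((p i : ℝ) * bra i)]
    linarith
  · intro j hj
    by_contra hn
    simp only [Finset.mem_insert, Finsupp.mem_support_iff, not_or, not_not] at hn
    rw [Finsupp.mem_support_iff] at hj
    exact hj (by simp [hn.2, Ne.symm hn.1])

/-- With u = n√⟨i⟩ one has n²⟨i⟩² ≤ u⁴ and 1 + u⁴ ≤ (1+√u)^8. A bound by √u rather than u leaves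
room to absorb it in σu for arbitrarily small σ. -/
theorem log_one_add_le {n : ℕ} (hn : n ≠ 0) (i : Idx) :
    Real.log (1 + (n : ℝ) ^ 2 * bra i ^ 2) ≤ 8 * √((n : ℝ) * √(bra i)) := by
  set u := (n : ℝ) * √(bra i) with hu
  have hn1 : (1 : ℝ) ≤ n := by exact_mod_cast Nat.one_le_iff_ne_zero.2 hn
  have hb := one_le_bra i
  have hu0 : 0 ≤ u := by positivity
  have h4 : (n : ℝ) ^ 2 * bra i ^ 2 ≤ u ^ 4 := by
    have h : u ^ 4 = (n : ℝ) ^ 4 * bra i ^ 2 := by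
      have : √(bra i) ^ 4 = bra i ^ 2 := by
        rw [show (4 : ℕ) = 2 * 2 from rfl, pow_mul, Real.sq_sqrt (by linarith)]
      rw [hu, mul_pow, this]
    rw [h]
    gcongr
    norm_num
  have hv : √u * √u = u := Real.mul_self_sqrt hu0
  have h5 : 1 + (n : ℝ) ^ 2 * bra i ^ 2 ≤ (1 + √u) ^ 8 := by
    have h6 : 1 + u ≤ (1 + √u) ^ 2 := by nlinarith [Real.sqrt_nonneg u]
    have h7 : 1 + u ^ 4 ≤ (1 + u) ^ 4 := by
      nlinarith [pow_nonneg hu0 2, pow_nonneg hu0 3]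
    calc _ ≤ 1 + u ^ 4 := by linarith
      _ ≤ (1 + u) ^ 4 := h7
      _ ≤ ((1 + √u) ^ 2) ^ 4 := by gcongr
      _ = _ := by ring
  calc _ ≤ Real.log ((1 + √u) ^ 8) := Real.log_le_log (by positivity) h5
    _ = 8 * Real.log (1 + √u) := by rw [Real.log_pow]; norm_num
    _ ≤ 8 * √u := by
      have := Real.log_le_sub_one_of_pos (show 0 < 1 + √u by positivity)
      linarith

theorem card_filter_bra_le (T : Finset Idx) {R : ℝ} (hR : 1 ≤ R) :
    ((T.filter fun i => bra i ≤ R).card : ℝ) ≤ 6 * R := by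
  classical
  set M := ⌊R⌋₊
  have hsub : (T.filter fun i => bra i ≤ R) ⊆ Finset.Icc (-(M : ℤ)) M ×ˢ Finset.univ := by
    intro i hi
    have h1 : |(i.1 : ℝ)| ≤ R := (le_max_left _ _).trans (Finset.mem_filter.1 hi).2
    have h2 : i.1.natAbs ≤ M := by
      refine Nat.le_floor ?_
      rw [Nat.cast_natAbs]; push_cast; exact h1
    simp only [Finset.mem_product, Finset.mem_Icc, Finset.mem_univ, and_true]
    omega
  have h3 := Finset.card_le_card hsub
  rw [Finset.card_product, Int.card_Icc, Finset.card_univ, Fintype.card_units_int] at h3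
  have h4 : ((M : ℤ) + 1 - (-(M : ℤ))).toNat = 2 * M + 1 := by omega
  rw [h4] at h3
  have h5 : (M : ℝ) ≤ R := Nat.floor_le (by linarith)
  have h6 : ((T.filter fun i => bra i ≤ R).card : ℝ) ≤ (2 * M + 1) * 2 := by exact_mod_cast h3
  linarith

/-- Each term is at most 8τ√u with u = q_i√⟨i⟩. If √u ≥ B/σ with B = 32τ, it is absorbed in σu/4.
The remaining indices satisfy ⟨i⟩ ≤ (B/σ)⁴, so there are at most 6(B/σ)⁴ of them, each contributing
at most 8τB/σ. The total is of order (B/σ)⁵, and (B/σ)⁵ ≤ (B/σ)⁶ because such indices exist only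
when B/σ ≥ 1. -/
theorem logSum_le {τ : ℝ} (hτ : 0 ≤ τ) : ∃ c : ℝ, 0 ≤ c ∧ ∀ (σ : ℝ) (q : MIdx), 0 < σ →
    τ * logSum (natToInt q) ≤ σ * sqrtSum q / 4 + c / σ ^ 6 := by
  classical
  set B := 32 * τ with hB
  have hB0 : 0 ≤ B := by positivity
  refine ⟨48 * τ * B ^ 6, by positivity, fun σ q hσ => ?_⟩
  have hsupp : (natToInt q).support = q.support := by
    ext i; simp [natToInt]
  have hterm : ∀ i ∈ q.support, τ * Real.log (1 + (natToInt q i : ℝ) ^ 2 * bra i ^ 2)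
      ≤ σ * ((q i : ℝ) * √(bra i)) / 4
        + if bra i ≤ (B / σ) ^ 4 then 8 * τ * (B / σ) else 0 := by
    intro i hi
    have hq0 : q i ≠ 0 := Finsupp.mem_support_iff.1 hi
    have hq1 : (1 : ℝ) ≤ q i := by exact_mod_cast Nat.one_le_iff_ne_zero.2 hq0
    have h1 := log_one_add_le hq0 i
    set u := (q i : ℝ) * √(bra i) with hu
    have hu0 : 0 ≤ u := by positivity
    have hv : √u * √u = u := Real.mul_self_sqrt hu0
    have h2 : τ * Real.log (1 + (natToInt q i : ℝ) ^ 2 * bra i ^ 2) ≤ 8 * τ * √u := by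
      have : τ * Real.log (1 + (natToInt q i : ℝ) ^ 2 * bra i ^ 2) ≤ τ * (8 * √u) := by
        gcongr
        simpa using h1
      linarith
    refine h2.trans ?_
    rcases le_total (B / σ) (√u) with h | h
    · rw [div_le_iff₀ hσ] at h
      have h3 : 8 * τ * √u ≤ σ * u / 4 := by
        have h4 : B * √u ≤ √u * σ * √u := by gcongr
        have h5 : √u * σ * √u = σ * u := by rw [mul_right_comm, hv, mul_comm]
        linarith
      have : (0 : ℝ) ≤ if bra i ≤ (B / σ) ^ 4 then 8 * τ * (B / σ) else 0 := by
        split_ifs <;> positivity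
      linarith
    · have h3 : bra i ≤ (B / σ) ^ 4 := by
        have : √(bra i) ≤ u := le_mul_of_one_le_left (Real.sqrt_nonneg _) hq1
        calc bra i = √(bra i) ^ 2 := (Real.sq_sqrt (bra_pos i).le).symm
          _ ≤ u ^ 2 := by gcongr
          _ = √u ^ 4 := by nth_rw 1 [← hv]; ring
          _ ≤ _ := by gcongr
      rw [if_pos h3]
      have : 8 * τ * √u ≤ 8 * τ * (B / σ) := by gcongr
      have : 0 ≤ σ * u / 4 := by positivity
      linarith
  have hsum : τ * logSum (natToInt q) ≤ σ * sqrtSum q / 4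
      + ∑ i ∈ q.support, if bra i ≤ (B / σ) ^ 4 then 8 * τ * (B / σ) else 0 := by
    have h1 : σ * sqrtSum q / 4 = ∑ i ∈ q.support, σ * ((q i : ℝ) * √(bra i)) / 4 := by
      rw [sqrtSum, Finsupp.sum, Finset.mul_sum, Finset.sum_div]
    rw [h1, ← Finset.sum_add_distrib, logSum, Finsupp.sum, hsupp, Finset.mul_sum]
    exact Finset.sum_le_sum hterm
  refine hsum.trans (add_le_add le_rfl ?_)
  rw [← Finset.sum_filter, Finset.sum_const, nsmul_eq_mul]
  rcases lt_or_ge ((B / σ) ^ 4) 1 with h | h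
  · have : (q.support.filter fun i => bra i ≤ (B / σ) ^ 4) = ∅ := by
      rw [Finset.filter_eq_empty_iff]
      intro i _ hle
      linarith [one_le_bra i]
    rw [this]
    simp only [Finset.card_empty, Nat.cast_zero, zero_mul]
    positivity
  · have h1 : 1 ≤ B / σ := by
      by_contra hc
      exact absurd h (not_le.2 (pow_lt_one₀ (by positivity) (not_le.1 hc) (by norm_num)))
    calc _ ≤ 6 * (B / σ) ^ 4 * (8 * τ * (B / σ)) := by
          gcongr
          exact card_filter_bra_le _ h
      _ = 48 * τ * (B / σ) ^ 5 := by ring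
      _ ≤ 48 * τ * (B / σ) ^ 6 := by
          gcongr
          norm_num
      _ = _ := by rw [div_pow]; ring

/-! ### Momentum, growth of the frequencies and the largest indices. -/

theorem abs_mom (i : Idx) : |(mom i : ℝ)| = |(i.1 : ℝ)| := by
  obtain ⟨j, ε⟩ := i
  rcases Int.units_eq_one_or ε with rfl | rfl <;> simp [mom]

theorem bra_eq (i : Idx) : bra i = max |(mom i : ℝ)| 1 := by rw [abs_mom]; rfl

theorem momN_eq_sum (q : MIdx) : momN q = ∑ i ∈ q.support, mom i * (q i : ℤ) := by
  have hsupp : (natToInt q).support = q.support := by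
    ext i; simp [natToInt]
  rw [momN, momZ, Finsupp.sum, hsupp]
  rfl

theorem freqZ_natToInt_eq_sum (lam : Idx → ℂ) (q : MIdx) :
    freqZ lam (natToInt q) = ∑ i ∈ q.support, lam i * (q i : ℂ) := by
  have hsupp : (natToInt q).support = q.support := by
    ext i; simp [natToInt]
  rw [freqZ, Finsupp.sum, hsupp]
  simp

theorem abs_momN_le (q : MIdx) : |(momN q : ℝ)| ≤ ∑ i ∈ q.support, (q i : ℝ) * bra i := by
  rw [momN_eq_sum]
  push_cast
  refine (Finset.abs_sum_le_sum_abs _ _).trans (Finset.sum_le_sum fun i _ => ?_)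
  rw [abs_mul, mul_comm, Nat.abs_cast, bra_eq]
  gcongr
  exact le_max_left _ _

theorem sum_mul_bra_le {q : MIdx} {H : ℝ} (hH : ∀ i ∈ q.support, √(bra i) ≤ H) :
    ∑ i ∈ q.support, (q i : ℝ) * bra i ≤ H * sqrtSum q := by
  rw [sqrtSum, Finsupp.sum, Finset.mul_sum]
  refine Finset.sum_le_sum fun i hi => ?_
  nth_rw 1 [← Real.mul_self_sqrt (bra_pos i).le]
  have := hH i hi
  have h2 : √(bra i) * ((q i : ℝ) * √(bra i)) ≤ H * ((q i : ℝ) * √(bra i)) := by gcongr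
  linarith

/-- Here ⟨k⟩ is at most max(∑ q_i⟨i⟩, 1) ≤ (∑ q_i√⟨i⟩)². This is why raising s does not increase the
norm of a momentum preserving field without constant term. -/
theorem sqrt_bra_le_of_momN_eq {q : MIdx} {k : Idx} (hq : q ≠ 0) (hm : momN q = mom k) :
    √(bra k) ≤ sqrtSum q := by
  have h0 := one_le_sqrtSum hq
  rw [Real.sqrt_le_left (by linarith), bra_eq, ← hm, max_le_iff]
  have h1 := sum_mul_bra_le (q := q) (H := sqrtSum q) fun i hi => sqrt_bra_le_sqrtSum q hi
  exact ⟨(abs_momN_le q).trans (by nlinarith), by nlinarith⟩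

/-- Splitting off a largest index of a multi-index of given momentum. -/
theorem exists_sqrtSum_split {q : MIdx} {k : Idx} (hq : 2 ≤ q.degree) (hm : momN q = mom k) :
    ∃ (i : Idx) (q' : MIdx), q = q' + Finsupp.single i 1 ∧ q' ≠ 0 ∧
      sqrtSum q' / 2 ≤ sqrtSum q - √(bra k) := by
  have hq0 : q ≠ 0 := by rintro rfl; simp at hq
  obtain ⟨i, hi, hmax⟩ := Finset.exists_max_image q.support bra (Finsupp.support_nonempty_iff.2 hq0)
  have hle : Finsupp.single i 1 ≤ q := by
    simpa [Finsupp.single_le_iff] using Nat.one_le_iff_ne_zero.2 (Finsupp.mem_support_iff.1 hi)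
  have hqq := (tsub_add_cancel_of_le hle).symm
  set q' := q - Finsupp.single i 1 with hq'
  have hd := congrArg Finsupp.degree hqq
  rw [map_add, Finsupp.degree_single] at hd
  have hq'0 : q' ≠ 0 := by
    intro h; rw [h] at hd; simp at hd; omega
  refine ⟨i, q', hqq, hq'0, ?_⟩
  have hS := one_le_sqrtSum hq'0
  have hSq : sqrtSum q = sqrtSum q' + √(bra i) := by
    conv_lhs => rw [hqq]
    rw [sqrtSum_add, sqrtSum_single]
  have hh := one_le_sqrt_bra i
  have h1 : ∑ j ∈ q'.support, (q' j : ℝ) * bra j ≤ √(bra i) * sqrtSum q' := by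
    refine sum_mul_bra_le fun j hj => Real.sqrt_le_sqrt (hmax j ?_)
    rw [Finsupp.mem_support_iff] at hj ⊢
    rw [hqq]; simp; omega
  have h2 : bra k ≤ bra i + √(bra i) * sqrtSum q' := by
    rw [bra_eq k, max_le_iff]
    constructor
    · rw [← hm, hqq, momN_add, momN_single]
      push_cast
      have h3 : |(mom i : ℝ)| ≤ bra i := by rw [bra_eq]; exact le_max_left _ _
      linarith [abs_add_le (momN q' : ℝ) (mom i), abs_momN_le q']
    · have := one_le_bra i
      have : 0 ≤ √(bra i) * sqrtSum q' := by positivity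
      linarith
  -- With h = √⟨i⟩ and S = `sqrtSum q'`, the preceding bound is ⟨k⟩ ≤ h² + hS ≤ (h + S/2)².
  -- Maximality of i entered through √⟨j⟩ ≤ h for all other indices.
  have h3 : √(bra k) ≤ √(bra i) + sqrtSum q' / 2 := by
    rw [Real.sqrt_le_left (by positivity)]
    nlinarith [Real.sq_sqrt (bra_pos i).le]
  linarith

theorem norm_freqZ_le {C : ℝ} {lam : Idx → ℂ} (h : Superlinear C lam) (q : MIdx) :
    ‖freqZ lam (natToInt q)‖ ≤ 3 / 2 * sqrtSum q ^ 4 := by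
  obtain ⟨θ, h1, -⟩ := h
  have hlam : ∀ i, ‖lam i‖ ≤ 3 / 2 * bra i ^ 2 := by
    intro i
    have h2 : ‖(bra i : ℂ) ^ 2 * Complex.exp (θ i * Complex.I)‖ = bra i ^ 2 := by
      rw [norm_mul, Complex.norm_exp_ofReal_mul_I, norm_pow, Complex.norm_real,
        Real.norm_of_nonneg (bra_pos i).le, mul_one]
    have h3 := norm_le_norm_add_norm_sub' (lam i)
      ((bra i : ℂ) ^ 2 * Complex.exp (θ i * Complex.I))
    have h4 := h1 i
    nlinarith [one_le_bra i]
  rw [freqZ_natToInt_eq_sum]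
  have hS := sqrtSum_nonneg q
  have h4 : ∀ i ∈ q.support, ‖lam i * (q i : ℂ)‖
      ≤ 3 / 2 * sqrtSum q ^ 3 * ((q i : ℝ) * √(bra i)) := by
    intro i hi
    have h5 := sqrt_bra_le_sqrtSum q hi
    rw [norm_mul, Complex.norm_natCast]
    calc ‖lam i‖ * (q i : ℝ) ≤ 3 / 2 * bra i ^ 2 * q i := by gcongr; exact hlam i
      _ = 3 / 2 * √(bra i) ^ 3 * ((q i : ℝ) * √(bra i)) := by
        nth_rw 1 [← Real.mul_self_sqrt (bra_pos i).le]; ring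
      _ ≤ _ := by gcongr
  calc _ ≤ ∑ i ∈ q.support, 3 / 2 * sqrtSum q ^ 3 * ((q i : ℝ) * √(bra i)) :=
        (norm_sum_le _ _).trans (Finset.sum_le_sum h4)
    _ = 3 / 2 * sqrtSum q ^ 3 * sqrtSum q := by
        rw [← Finset.mul_sum]; rfl
    _ = _ := by ring

theorem exists_nat_bra (i : Idx) : ∃ n : ℕ, bra i = n := by
  refine ⟨max i.1.natAbs 1, ?_⟩
  rw [bra, Nat.cast_max, Nat.cast_natAbs]
  simp

/-- If `λ · p` is small, then the two largest indices are controlled by the others, unless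
they cancel. -/
theorem bra_sq_le_or {C : ℝ} (hC : 0 < C) {lam : Idx → ℂ} (h : Superlinear C lam) {q : MIdx}
    (hq : q ≠ 0) {i k : Idx} (hm : momN q + mom i = mom k)
    (hf : ‖freqZ lam (natToInt q) + lam i - lam k‖ < 1) :
    (lam i = lam k ∧ mom i = mom k) ∨
      (bra i ^ 2 ≤ (16 + 4 / C) * sqrtSum q ^ 8 ∧ bra k ^ 2 ≤ (16 + 4 / C) * sqrtSum q ^ 8) := by
  by_cases hcase : lam i = lam k ∧ mom i = mom k
  · exact Or.inl hcase
  right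
  have hS := one_le_sqrtSum hq
  set S := sqrtSum q with hSdef
  have hS4 : 1 ≤ S ^ 4 := one_le_pow₀ hS
  have hC4 : 0 < 4 / C := by positivity
  have hdiff : ‖lam i - lam k‖ ≤ 5 / 2 * S ^ 4 := by
    have h1 := norm_freqZ_le h q
    have h2 : lam i - lam k = (freqZ lam (natToInt q) + lam i - lam k) - freqZ lam (natToInt q) := by
      ring
    rw [h2]
    have := norm_sub_le (freqZ lam (natToInt q) + lam i - lam k) (freqZ lam (natToInt q))
    linarith
  have hfin : ∀ n : ℝ, 0 ≤ n → n ≤ 7 / 2 * S ^ 4 → n ^ 2 ≤ (16 + 4 / C) * S ^ 8 := by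
    intro n hn0 hn
    have h1 : n ^ 2 ≤ (7 / 2 * S ^ 4) ^ 2 := by gcongr
    have h2 : (7 / 2 * S ^ 4) ^ 2 = 49 / 4 * S ^ 8 := by ring
    have h3 : 49 / 4 * S ^ 8 ≤ (16 + 4 / C) * S ^ 8 := by gcongr; linarith
    linarith
  have hb1 := one_le_bra i
  have hb2 := one_le_bra k
  obtain ⟨θ, h1, h2⟩ := h
  have hn : ∀ i, ‖(bra i : ℂ) ^ 2 * Complex.exp (θ i * Complex.I)‖ = bra i ^ 2 := by
    intro i
    rw [norm_mul, Complex.norm_exp_ofReal_mul_I, norm_pow, Complex.norm_real,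
      Real.norm_of_nonneg (bra_pos i).le, mul_one]
  -- The additional S⁴ ≥ 1 pays for the two errors 1/2 in the asymptotics of λ_i and λ_k.
  have hd2 : ‖(bra i : ℂ) ^ 2 * Complex.exp (θ i * Complex.I)
      - (bra k : ℂ) ^ 2 * Complex.exp (θ k * Complex.I)‖ ≤ 7 / 2 * S ^ 4 := by
    have e : (bra i : ℂ) ^ 2 * Complex.exp (θ i * Complex.I)
      - (bra k : ℂ) ^ 2 * Complex.exp (θ k * Complex.I) = (lam i - lam k)
        - (lam i - (bra i : ℂ) ^ 2 * Complex.exp (θ i * Complex.I))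
        + (lam k - (bra k : ℂ) ^ 2 * Complex.exp (θ k * Complex.I)) := by ring
    rw [e]
    have e1 := norm_add_le ((lam i - lam k)
        - (lam i - (bra i : ℂ) ^ 2 * Complex.exp (θ i * Complex.I)))
        (lam k - (bra k : ℂ) ^ 2 * Complex.exp (θ k * Complex.I))
    have e2 := norm_sub_le (lam i - lam k)
        (lam i - (bra i : ℂ) ^ 2 * Complex.exp (θ i * Complex.I))
    linarith [h1 i, h1 k]
  by_cases hbra : bra i = bra k
  · by_cases hmom : mom i = mom k
    · -- opposite indices with different frequencies
      have hlam : lam i ≠ lam k := fun hh => hcase ⟨hh, hmom⟩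
      obtain ⟨j, ε⟩ := i
      obtain ⟨j', ε'⟩ := k
      have hk : (j', ε') = (-j, -ε) := by
        rcases Int.units_eq_one_or ε with rfl | rfl <;>
        rcases Int.units_eq_one_or ε' with rfl | rfl <;> simp [mom] at hmom ⊢
        · exact hlam (by rw [hmom])
        · omega
        · omega
        · exact hlam (by rw [hmom])
      rw [hk] at hlam hd2 hbra ⊢
      have h3 := h2 j ε hlam
      rw [← hbra, ← mul_sub, norm_mul, norm_pow, Complex.norm_real,
        Real.norm_of_nonneg (bra_pos _).le] at hd2
      rw [← hbra, and_self]
      have h4 : bra (j, ε) ^ 2 * C ≤ 7 / 2 * S ^ 4 := le_trans (by gcongr) hd2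
      have h5 : S ^ 4 ≤ S ^ 8 := pow_le_pow_right₀ hS (by norm_num)
      calc bra (j, ε) ^ 2 = bra (j, ε) ^ 2 * C / C := by field_simp
        _ ≤ 7 / 2 * S ^ 4 / C := by gcongr
        _ ≤ 4 * S ^ 8 / C := by gcongr; norm_num
        _ = 4 / C * S ^ 8 := by ring
        _ ≤ _ := by gcongr; linarith
    -- Equal weights above 1 and different momenta force opposite momenta; then 2⟨i⟩ is the momentum
    -- of q, which is at most S².
    · have hmq : |(mom k : ℝ) - mom i| ≤ S ^ 2 := by
        have e : (mom k : ℝ) - mom i = momN q := by rw [← hm]; push_cast; ring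
        rw [e]
        refine (abs_momN_le q).trans ?_
        have := sum_mul_bra_le (q := q) (H := S) fun i hi => sqrt_bra_le_sqrtSum q hi
        rw [sq]; exact this
      have hS2 : S ^ 2 ≤ S ^ 4 := pow_le_pow_right₀ hS (by norm_num)
      have hle : bra i ≤ 7 / 2 * S ^ 4 := by
        rcases le_or_gt (bra i) 1 with hle | hgt
        · linarith
        · have e1 : bra i = |(mom i : ℝ)| := by
            rw [bra_eq] at hgt ⊢
            rcases max_choice |(mom i : ℝ)| 1 with hx | hx
            · exact hx
            · rw [hx] at hgt; exact absurd hgt (lt_irrefl _)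
          have e2 : bra i = |(mom k : ℝ)| := by
            rw [hbra, bra_eq] at hgt ⊢
            rcases max_choice |(mom k : ℝ)| 1 with hx | hx
            · exact hx
            · rw [hx] at hgt; exact absurd hgt (lt_irrefl _)
          rcases abs_eq_abs.1 (e1.symm.trans e2) with hx | hx
          · exact absurd (by exact_mod_cast hx) hmom
          · rw [hx] at hmq
            have : (mom k : ℝ) - -mom k = 2 * mom k := by ring
            rw [this, abs_mul, ← e2, abs_two] at hmq
            linarith
      exact ⟨hfin _ (by linarith) hle, hfin _ (by linarith) (hbra ▸ hle)⟩
  -- The weights are distinct integers a and b, so |a² - b²| ≥ a + b: here the quadratic growth of λ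
  -- is used.
  · have hsum : bra i + bra k ≤ 7 / 2 * S ^ 4 := by
      have e := (abs_norm_sub_norm_le _ _).trans hd2
      rw [hn, hn] at e
      refine le_trans ?_ e
      obtain ⟨a, ha⟩ := exists_nat_bra i
      obtain ⟨b, hb⟩ := exists_nat_bra k
      rw [ha, hb] at hbra ⊢
      have hab : (1 : ℝ) ≤ |(a : ℝ) - b| := by
        have hne : (a : ℤ) - b ≠ 0 := by
          intro hh; apply hbra; exact_mod_cast sub_eq_zero.1 hh
        exact_mod_cast Int.one_le_abs hne
      rw [sq_sub_sq, abs_mul, abs_of_nonneg (by positivity : (0 : ℝ) ≤ (a : ℝ) + b)]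
      exact le_mul_of_one_le_right (by positivity) hab
    exact ⟨hfin _ (by linarith) (by linarith), hfin _ (by linarith) (by linarith)⟩

/-- Since `logSum` is nonnegative, τ may be replaced by max(τ,0), which makes all later estimates
monotone. -/
theorem DiophantineMod.inv_norm_le {γ τ : ℝ} {lam : Idx → ℂ} (hγ : 0 < γ)
    (h : DiophantineMod γ τ lam) {p : Idx →₀ ℤ} (hf : freqZ lam p ≠ 0) (hm : momZ p = 0)
    {k : Idx} {q : MIdx} (hk : p + Finsupp.single k 1 = natToInt q) :
    ‖freqZ lam p‖⁻¹ ≤ γ⁻¹ * Real.exp (max τ 0 * logSum p) := by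
  have hD : p ∉ resD lam := by
    intro hp
    obtain ⟨j, hj⟩ := Set.mem_iUnion.1 hp
    exact hf hj.1
  have h1 := h p hD hm ⟨k, q, hk⟩
  rw [prod_eq_exp_logSum] at h1
  have h2 : γ * Real.exp (-(max τ 0 * logSum p)) ≤ ‖freqZ lam p‖ := by
    refine le_trans ?_ h1
    gcongr
    · exact logSum_nonneg p
    · exact le_max_left _ _
  calc ‖freqZ lam p‖⁻¹ ≤ (γ * Real.exp (-(max τ 0 * logSum p)))⁻¹ := by gcongr
    _ = _ := by rw [mul_inv, Real.exp_neg, inv_inv]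

/-- The small divisor estimate. -/
theorem small_divisor (τ C : ℝ) (hC : 0 < C) : ∃ c : ℝ, 0 < c ∧
    ∀ (lam : Idx → ℂ) (γ : ℝ), 0 < γ → (∀ k, lam k ≠ 0) → Superlinear C lam →
      DiophantineMod γ τ lam → ∀ σ : ℝ, 0 < σ → ∀ (k : Idx) (q : MIdx), 2 ≤ q.degree →
      momN q = mom k → freqZ lam (shift q k) ≠ 0 →
      ‖freqZ lam (shift q k)‖⁻¹
        ≤ γ⁻¹ * Real.exp (c / σ ^ 6) * Real.exp (σ * (sqrtSum q - √(bra k))) := by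
  set T := max τ 0 with hT
  have hT0 : 0 ≤ T := le_max_right _ _
  set A := 16 + 4 / C with hA
  have hA1 : 1 ≤ A := by
    have : 0 < 4 / C := by positivity
    linarith
  obtain ⟨c₀, hc₀, H₀⟩ := absorb_log (b := T + 1) (d := 0) (by linarith) le_rfl
  obtain ⟨c₁, hc₁, H₁⟩ := logSum_le hT0
  obtain ⟨c₂, hc₂, H₂⟩ := absorb_log (b := 2 * T * Real.log (4 * A)) (d := 16 * T)
    (mul_nonneg (by linarith) (Real.log_nonneg (by linarith))) (by linarith)
  -- The constants account for large divisors, for the Diophantine product over q', and for the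
  -- factors at the two large indices; the 1 ensures positivity.
  refine ⟨c₀ + c₁ + c₂ + 1, by linarith, ?_⟩
  intro lam γ hγ hlam hsup hdio σ hσ k q hq hm hf
  obtain ⟨i, q', hqq, hq'0, hgeo⟩ := exists_sqrtSum_split hq hm
  have hS := one_le_sqrtSum hq'0
  have hm' : momN q' + mom i = mom k := by
    rw [← hm, hqq, momN_add, momN_single]
  have hfr : freqZ lam (shift q k) = freqZ lam (natToInt q') + lam i - lam k := by
    rw [freqZ_shift, hqq, natToInt_add, freqZ_add, natToInt_single, freqZ_single]
  have hσ6 : ∀ c : ℝ, 0 ≤ c → 0 ≤ c / σ ^ 6 := fun c hc => by positivity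
  have hd0 := hσ6 c₀ hc₀
  have hd1 := hσ6 c₁ hc₁
  have hd2 := hσ6 c₂ hc₂
  have hd3 := hσ6 1 zero_le_one
  have hsplit : (c₀ + c₁ + c₂ + 1) / σ ^ 6
      = c₀ / σ ^ 6 + c₁ / σ ^ 6 + c₂ / σ ^ 6 + 1 / σ ^ 6 := by ring
  have hσS : 0 ≤ σ * sqrtSum q' := by positivity
  have hgeo' : σ * (sqrtSum q' / 2) ≤ σ * (sqrtSum q - √(bra k)) := by gcongr
  -- it suffices to bound the exponent
  suffices hsuff : ∃ E, ‖freqZ lam (shift q k)‖⁻¹ ≤ γ⁻¹ * Real.exp E ∧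
      E ≤ σ * sqrtSum q' / 2 + (c₀ / σ ^ 6 + c₁ / σ ^ 6 + c₂ / σ ^ 6) by
    obtain ⟨E, hE1, hE2⟩ := hsuff
    refine hE1.trans ?_
    rw [mul_assoc, ← Real.exp_add, hsplit]
    gcongr
    linarith
  by_cases hbig : 1 ≤ ‖freqZ lam (shift q k)‖
  · refine ⟨T + 1, ?_, ?_⟩
    -- A divisor of modulus at least 1 still has to be compared with γ⁻¹, so γ needs an upper bound.
    -- It comes from the Diophantine condition at the zero mode (0,1): its momentum is 0 and its
    -- frequency is nonzero of modulus at most 3/2, whence 2/3 ≤ γ⁻¹e^T.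
    · have hp0 : freqZ lam (Finsupp.single ((0 : ℤ), (1 : ℤˣ)) 1) ≠ 0 := by
        rw [freqZ_single]; exact hlam _
      have h1 := hdio.inv_norm_le hγ hp0 (by rw [momZ_single]; simp [mom])
        (k := ((0 : ℤ), (1 : ℤˣ))) (q := Finsupp.single ((0 : ℤ), (1 : ℤˣ)) 1
          + Finsupp.single ((0 : ℤ), (1 : ℤˣ)) 1) (by rw [natToInt_add, natToInt_single])
      have hbra : bra ((0 : ℤ), (1 : ℤˣ)) = 1 := by simp [bra]
      have h2 : logSum (Finsupp.single ((0 : ℤ), (1 : ℤˣ)) 1) ≤ 1 := by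
        rw [logSum, Finsupp.sum_single_index (by simp), hbra]
        have := Real.log_le_sub_one_of_pos (show (0 : ℝ) < 2 by norm_num)
        norm_num at this ⊢
        linarith
      have h3 : ‖freqZ lam (Finsupp.single ((0 : ℤ), (1 : ℤˣ)) 1)‖ ≤ 3 / 2 := by
        have := norm_freqZ_le hsup (Finsupp.single ((0 : ℤ), (1 : ℤˣ)) 1)
        rw [natToInt_single, sqrtSum_single, hbra] at this
        simpa using this
      have h4 : (3 / 2 : ℝ)⁻¹ ≤ γ⁻¹ * Real.exp T := by
        calc (3 / 2 : ℝ)⁻¹ ≤ ‖freqZ lam (Finsupp.single ((0 : ℤ), (1 : ℤˣ)) 1)‖⁻¹ := by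
              gcongr
          _ ≤ _ := h1
          _ ≤ γ⁻¹ * Real.exp (T * 1) := by gcongr
          _ = _ := by rw [mul_one]
      have h5 : (3 / 2 : ℝ) ≤ Real.exp 1 := by linarith [Real.add_one_le_exp (1 : ℝ)]
      calc ‖freqZ lam (shift q k)‖⁻¹ ≤ 1 := inv_le_one_of_one_le₀ hbig
        _ = (3 / 2 : ℝ)⁻¹ * (3 / 2) := by norm_num
        _ ≤ γ⁻¹ * Real.exp T * Real.exp 1 := by gcongr
        _ = _ := by rw [mul_assoc, ← Real.exp_add]
    · have := H₀ σ _ hσ hS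
      linarith
  · push Not at hbig
    rw [hfr] at hbig
    rcases bra_sq_le_or hC hsup hq'0 hm' hbig with ⟨h1, h2⟩ | ⟨h1, h2⟩
    · -- the two largest indices cancel
      have hfr' : freqZ lam (shift q k) = freqZ lam (natToInt q') := by rw [hfr, h1]; ring
      refine ⟨T * logSum (natToInt q'), ?_, ?_⟩
      · rw [hfr'] at hf ⊢
        refine hdio.inv_norm_le hγ hf ?_ (k := k) (q := q' + Finsupp.single k 1)
          (by rw [natToInt_add, natToInt_single])
        change momN q' = 0
        linarith
      · have := H₁ σ q' hσ
        linarith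
    · refine ⟨T * logSum (shift q k), ?_, ?_⟩
      · refine hdio.inv_norm_le hγ hf (by rw [momZ_shift, hm, sub_self]) (k := k) (q := q) ?_
        rw [shift, sub_add_cancel]
      · have hsh : shift q k = natToInt q' + Finsupp.single i 1 + Finsupp.single k (-1) := by
          rw [shift, hqq, natToInt_add, natToInt_single, Finsupp.single_neg, sub_eq_add_neg]
        have h3 := logSum_add_single_le (natToInt q') i (ε := 1) (by norm_num)
        have h4 := logSum_add_single_le (natToInt q' + Finsupp.single i 1) k (ε := -1)
          (by norm_num)
        rw [← hsh] at h4
        have hlog : ∀ b : ℝ, b ^ 2 ≤ A * sqrtSum q' ^ 8 →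
            Real.log (2 * (1 + b ^ 2)) ≤ Real.log (4 * A) + 8 * Real.log (sqrtSum q') := by
          intro b hb
          have h8 : 1 ≤ sqrtSum q' ^ 8 := one_le_pow₀ hS
          have h9 : 2 * (1 + b ^ 2) ≤ 4 * A * sqrtSum q' ^ 8 := by nlinarith
          refine (Real.log_le_log (by positivity) h9).trans (le_of_eq ?_)
          rw [Real.log_mul (by positivity) (by positivity), Real.log_pow]
          norm_num
        have h5 := hlog _ h1
        have h6 := hlog _ h2
        have h7 : logSum (shift q k) ≤ logSum (natToInt q') + 2 * Real.log (4 * A)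
            + 16 * Real.log (sqrtSum q') := by linarith
        have h8 := H₁ σ q' hσ
        have h9 := H₂ σ _ hσ hS
        have h10 : T * logSum (shift q k) ≤ T * (logSum (natToInt q') + 2 * Real.log (4 * A)
            + 16 * Real.log (sqrtSum q')) := by gcongr
        linarith

/-! ### Multipliers -/

theorem mono_exp (σ : ℝ) (q : MIdx) :
    mono (fun i => ENNReal.ofReal (Real.exp (σ * √(bra i)))) q
      = ENNReal.ofReal (Real.exp (σ * sqrtSum q)) := by
  induction q using midx_induction with
  | h0 => simp [sqrtSum]
  | h1 q i ih =>
    rw [mono_add, ih, mono_single, pow_one, sqrtSum_add, sqrtSum_single, mul_add, Real.exp_add,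
      ENNReal.ofReal_mul (Real.exp_pos _).le]

/-- The weight at s + σ is the weight at s times e^{σ√⟨k⟩}. Substituting e^{σ√⟨i⟩}y_i for y_i
multiplies y^q by e^{σ·`sqrtSum q`}, so the admitted growth of the coefficients is exactly what the
change of space compensates. -/
theorem Bd.multiplier {s r B κ σ : ℝ} {V V' : FVF} (h : Bd s r V B) (hκ : 0 ≤ κ)
    (hV : ∀ k q, ‖V' k q‖ ≤ κ * Real.exp (σ * (sqrtSum q - √(bra k))) * ‖V k q‖) :
    Bd (s + σ) r V' (κ * B) := by
  intro y hy
  rw [wNorm_add_eq] at hy ⊢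
  rw [ENNReal.ofReal_mul hκ]
  refine le_trans ?_ (mul_le_mul_right (h _ hy) _)
  rw [← wNorm_const_mul]
  refine wNorm_mono fun k => ?_
  unfold serV ser
  rw [← ENNReal.tsum_mul_left, ← ENNReal.tsum_mul_left]
  refine ENNReal.tsum_le_tsum fun q => ?_
  rw [mono_mul, mono_exp, ← mul_assoc, ← mul_assoc, ← mul_assoc]
  refine mul_le_mul_left ?_ _
  rw [← ofReal_norm, ← ofReal_norm, ← ENNReal.ofReal_mul (Real.exp_pos _).le,
    ← ENNReal.ofReal_mul hκ, ← ENNReal.ofReal_mul (by positivity)]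
  refine ENNReal.ofReal_le_ofReal ?_
  calc Real.exp (σ * √(bra k)) * ‖V' k q‖
      ≤ Real.exp (σ * √(bra k)) * (κ * Real.exp (σ * (sqrtSum q - √(bra k))) * ‖V k q‖) := by
        gcongr
        exact hV k q
    _ = κ * ‖V k q‖ * (Real.exp (σ * √(bra k)) * Real.exp (σ * (sqrtSum q - √(bra k)))) := by ring
    _ = _ := by rw [← Real.exp_add]; congr 2; ring

/-- Momentum preserving vector fields that vanish at the origin: monotonicity in `s`. -/
theorem Bd.of_le_exponent {s s' r B : ℝ} {V : FVF} (h : Bd s r V B) (hs : s ≤ s') (hm : MomV V)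
    (h0 : ∀ k, V k 0 = 0) : Bd s' r V B := by
  obtain ⟨σ, rfl⟩ : ∃ σ, s' = s + σ := ⟨s' - s, by ring⟩
  have hσ : 0 ≤ σ := by linarith
  refine (h.multiplier (V' := V) (σ := σ) zero_le_one fun k q => ?_).of_le (by rw [one_mul])
  rw [one_mul]
  by_cases hV : V k q = 0
  · simp [hV]
  · have hq : q ≠ 0 := by rintro rfl; exact hV (h0 k)
    refine le_mul_of_one_le_left (norm_nonneg _) (Real.one_le_exp (mul_nonneg hσ ?_))
    exact sub_nonneg.2 (sqrt_bra_le_of_momN_eq hq (hm k q hV))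

/-- The inverse of `[D(λ), ·]` on nonresonant fields. -/
def homInv (lam : Idx → ℂ) (V : FVF) : FVF := fun k q => (freqZ lam (shift q k))⁻¹ * V k q

theorem homInv_ne_zero {lam : Idx → ℂ} {V : FVF} {k : Idx} {q : MIdx} (h : homInv lam V k q ≠ 0) :
    V k q ≠ 0 := right_ne_zero_of_mul h

theorem homInv_add (lam : Idx → ℂ) (V V' : FVF) :
    homInv lam (V + V') = homInv lam V + homInv lam V' := by
  funext k q
  simp [homInv, mul_add]

/-- The bound for the inverse of `[D(λ), ·]` on fields of order at least one, given the small
divisor estimate. -/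
theorem Bd.homInv {s r B κ σ : ℝ} {lam : Idx → ℂ} {V : FVF} (h : Bd s r V B) (hκ : 0 ≤ κ)
    (hsmall : ∀ (k : Idx) (q : MIdx), 2 ≤ q.degree → momN q = mom k →
      freqZ lam (shift q k) ≠ 0 →
      ‖freqZ lam (shift q k)‖⁻¹ ≤ κ * Real.exp (σ * (sqrtSum q - √(bra k))))
    (hm : MomV V) (h1 : OrderGE 1 V) : Bd (s + σ) r (homInv lam V) (κ * B) := by
  refine h.multiplier hκ fun k q => ?_
  unfold ResonantNF.homInv
  by_cases hV : V k q = 0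
  · simp [hV]
  by_cases hf : freqZ lam (shift q k) = 0
  · simp only [hf, inv_zero, zero_mul, norm_zero]
    positivity
  rw [norm_mul, norm_inv]
  gcongr
  exact hsmall k q (h1 k q hV) (hm k q hV) hf

/-! ### Orders -/

theorem OrderGE.apply_zero {d : ℕ} {V : FVF} (h : OrderGE d V) (k : Idx) : V k 0 = 0 := by
  by_contra hV
  have := h k 0 hV
  simp at this

theorem OrderGE.of_le {d d' : ℕ} {V : FVF} (h : OrderGE d V) (hd : d' ≤ d) : OrderGE d' V :=
  fun k q hq => le_trans (by omega) (h k q hq)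

theorem OrderGE.of_ne_zero {d : ℕ} {V V' : FVF} (h : OrderGE d V)
    (hV : ∀ k q, V' k q ≠ 0 → V k q ≠ 0) : OrderGE d V' :=
  fun k q hq => h k q (hV k q hq)

theorem OrderGE.add {d : ℕ} {V V' : FVF} (h : OrderGE d V) (h' : OrderGE d V') :
    OrderGE d (V + V') := by
  intro k q hq
  by_cases hV : V k q = 0
  · exact h' k q fun hV' => hq (by simp [hV, hV'])
  · exact h k q hV

theorem OrderGE.neg {d : ℕ} {V : FVF} (h : OrderGE d V) : OrderGE d (-V) :=
  h.of_ne_zero fun k q hq => by simpa using hq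

theorem OrderGE.proj {d : ℕ} {V : FVF} (h : OrderGE d V) (J : Set MIdx) : OrderGE d (proj J V) :=
  h.of_ne_zero fun _ _ hq => (proj_ne_zero hq).2

theorem OrderGE.lie {d d' : ℕ} {V V' : FVF} (h : OrderGE d V) (h' : OrderGE d' V') :
    OrderGE (d + d') (lie V V') := by
  intro k q hq
  obtain ⟨j, p₁, p₂, hp, h1, h2⟩ := exists_of_act_ne_zero hq
  have e1 := h _ _ h1
  have e2 := h' _ _ h2
  rw [map_add, Finsupp.degree_single] at e2
  rw [← hp, map_add]
  omega

theorem OrderGE.bracket {d d' : ℕ} {V V' : FVF} (hmV : MomV V) (hmV' : MomV V')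
    (h : OrderGE d V) (h' : OrderGE d' V') : OrderGE (d + d') (bracket V V') := by
  intro k q hq
  rcases exists_of_bracket_ne_zero hmV hmV' hq with h1 | h1
  · exact (h.lie h') k q h1
  · rw [add_comm d d']; exact (h'.lie h) k q h1

/-! ### Brackets with `D(λ)` -/

theorem diagField_ne_zero {lam : Idx → ℂ} {k : Idx} {q : MIdx} (h : diagField lam k q ≠ 0) :
    q = Finsupp.single k 1 := by
  by_contra hq
  exact h (if_neg hq)

theorem momV_diagField (lam : Idx → ℂ) : MomV (diagField lam) := by
  intro k q hq
  rw [diagField_ne_zero hq, momN_single]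

theorem act_diagField (lam : Idx → ℂ) (f : MIdx → ℂ) (q : MIdx) :
    act (diagField lam) f q = freqZ lam (natToInt q) * f q := by
  classical
  have h1 : ∀ j, ∑ p ∈ adiag (q + Finsupp.single j 1),
      (p.2 j : ℂ) * (diagField lam j p.1 * f p.2) = lam j * (q j : ℂ) * f q := by
    intro j
    rw [Finset.sum_eq_single (Finsupp.single j 1, q)]
    · simp [diagField]; ring
    · rintro ⟨a, b⟩ hp hne
      rw [mem_adiag] at hp
      have : diagField lam j a = 0 := by
        by_contra hd
        have ha := diagField_ne_zero hd
        subst ha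
        apply hne
        have : b = q := by
          simp only at hp
          rw [add_comm] at hp
          exact add_right_cancel hp
        rw [this]
      simp [this]
    · intro h
      exact (h (mem_adiag.2 (show Finsupp.single j 1 + q = _ from add_comm _ _))).elim
  unfold act
  simp_rw [h1]
  rw [tsum_mul_right, freqZ_natToInt_eq_sum, tsum_eq_sum]
  intro j hj
  simp [Finsupp.notMem_support_iff.1 hj]

theorem act_diagField_right (lam : Idx → ℂ) (V : FVF) (k : Idx) (q : MIdx) :
    act V (diagField lam k) q = lam k * V k q := by
  classical
  have hne : ∀ (j : Idx) (b : MIdx), (j, b) ≠ (k, 0) →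
      diagField lam k (b + Finsupp.single j 1) = 0 := by
    intro j b h
    by_contra hd
    have hb := diagField_ne_zero hd
    have hdeg := congrArg Finsupp.degree hb
    rw [map_add, Finsupp.degree_single, Finsupp.degree_single] at hdeg
    have hb0 : b = 0 := (Finsupp.degree_eq_zero_iff b).1 (by omega)
    rw [hb0, zero_add] at hb
    have hjk : j = k := Finsupp.single_left_injective one_ne_zero hb
    exact h (by rw [hjk, hb0])
  rw [act_apply, tsum_eq_single k]
  · rw [Finset.sum_eq_single (q, 0)]
    · simp [diagField, mul_comm]
    · rintro ⟨a, b⟩ hp hn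
      rw [mem_adiag] at hp
      have : b ≠ 0 := by rintro rfl; exact hn (by simpa using hp)
      rw [hne k b (by simpa using this)]
      simp
    · intro h
      exact (h (mem_adiag.2 (show q + 0 = q from add_zero _))).elim
  · intro j hj
    refine Finset.sum_eq_zero fun p _ => ?_
    rw [hne j p.2 (by simp [hj])]
    simp

/-- D(λ) stands in the second slot, hence the sign: [F, D(λ)] = -X reads (λ·(q-e_k)) F = X on
coefficients, which fixes the sign of `homInv`. -/
theorem bracket_diagField (lam : Idx → ℂ) {V : FVF} (hV : MomV V) (k : Idx) (q : MIdx) :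
    bracket V (diagField lam) k q = -(freqZ lam (shift q k) * V k q) := by
  rw [bracket_eq hV (momV_diagField lam)]
  change act V (diagField lam k) q - act (diagField lam) (V k) q = _
  rw [act_diagField, act_diagField_right, freqZ_shift]
  ring

/-! ### The resonance ideals -/

theorem exists_genM_le {lam : Idx → ℂ} {Q : MIdx} (hQ : Q ∈ resM lam) (h0 : Q ≠ 0) :
    ∃ P ∈ genM lam, P ≤ Q := by
  obtain ⟨n, hn⟩ : ∃ n, Q.degree = n := ⟨_, rfl⟩
  induction n using Nat.strong_induction_on generalizing Q with
  | _ n ih =>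
    by_cases hg : Q ∈ genM lam
    · exact ⟨Q, hg, le_rfl⟩
    · have : ∃ A ∈ resM lam, ∃ B ∈ resM lam, A + B = Q ∧ A ≠ 0 ∧ B ≠ 0 := by
        by_contra hc
        push Not at hc
        refine hg ⟨hQ, h0, fun A hA B hB hAB => ?_⟩
        by_contra hne
        push Not at hne
        exact hne.2 (hc A hA B hB hAB hne.1)
      obtain ⟨A, hA, B, hB, hAB, hA0, hB0⟩ := this
      have hd := congrArg Finsupp.degree hAB
      rw [map_add] at hd
      have hBd : B.degree ≠ 0 := fun h => hB0 ((Finsupp.degree_eq_zero_iff B).1 h)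
      obtain ⟨P, hP, hle⟩ := ih A.degree (by omega) hA hA0 rfl
      exact ⟨P, hP, hle.trans (by rw [← hAB]; exact le_self_add)⟩

theorem J1_of_le {lam : Idx → ℂ} {p q : MIdx} (hp : p ∈ J1 lam) (h : p ≤ q) : q ∈ J1 lam := by
  obtain ⟨Q, hQ, hle⟩ := hp
  exact ⟨Q, hQ, hle.trans h⟩

theorem J2_of_le {lam : Idx → ℂ} {p q : MIdx} (hp : p ∈ J2 lam) (h : p ≤ q) : q ∈ J2 lam := by
  obtain ⟨Q, hQ, Q', hQ', hle⟩ := hp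
  exact ⟨Q, hQ, Q', hQ', hle.trans h⟩

theorem J2_subset_J1 (lam : Idx → ℂ) : J2 lam ⊆ J1 lam := by
  rintro q ⟨Q, hQ, Q', -, hle⟩
  exact ⟨Q, hQ, le_self_add.trans hle⟩

theorem add_mem_J1 {lam : Idx → ℂ} (a : MIdx) {Q : MIdx} (hQ : Q ∈ resM lam) (h0 : Q ≠ 0) :
    a + Q ∈ J1 lam := by
  obtain ⟨P, hP, hle⟩ := exists_genM_le hQ h0
  exact ⟨P, hP, hle.trans le_add_self⟩

theorem add_mem_J2 {lam : Idx → ℂ} {a : MIdx} (ha : a ∈ J1 lam) {Q : MIdx} (hQ : Q ∈ resM lam)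
    (h0 : Q ≠ 0) : a + Q ∈ J2 lam := by
  obtain ⟨P, hP, hle⟩ := exists_genM_le hQ h0
  obtain ⟨P', hP', hle'⟩ := ha
  exact ⟨P', hP', P, hP, add_le_add hle' hle⟩

/-- Removing one power of x_j spoils at most one of the two generators: if Q_j = 0 then Q still
divides, and if Q_j ≥ 1 the removed power can be charged to Q and Q' still divides. -/
theorem mem_J1_of_add_single_mem_J2 {lam : Idx → ℂ} {p : MIdx} {j : Idx}
    (h : p + Finsupp.single j 1 ∈ J2 lam) : p ∈ J1 lam := by
  classical
  obtain ⟨Q, hQ, Q', hQ', hle⟩ := h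
  have hall := fun i => hle i
  simp only [Finsupp.coe_add, Pi.add_apply] at hall
  by_cases hj : Q j = 0
  · refine ⟨Q, hQ, fun i => ?_⟩
    have := hall i
    by_cases hij : j = i
    · subst hij; omega
    · rw [Finsupp.single_apply, if_neg hij] at this; omega
  · refine ⟨Q', hQ', fun i => ?_⟩
    have := hall i
    by_cases hij : j = i
    · subst hij; rw [Finsupp.single_eq_same] at this; omega
    · rw [Finsupp.single_apply, if_neg hij] at this; omega

/-- `U ⊇ U'` are ideals of exponents such that `M_λ \ 0` maps `U` into `U'`. -/
structure IdealStep (lam : Idx → ℂ) (U U' : Set MIdx) : Prop where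
  up : ∀ {p q}, p ∈ U → p ≤ q → q ∈ U
  up' : ∀ {p q}, p ∈ U' → p ≤ q → q ∈ U'
  step : ∀ {a}, a ∈ U → ∀ {Q}, Q ∈ resM lam → Q ≠ 0 → a + Q ∈ U'
  sub : J2 lam ⊆ U'

theorem idealStep_univ (lam : Idx → ℂ) : IdealStep lam Set.univ (J1 lam) :=
  ⟨fun _ _ => trivial, J1_of_le, fun _ _ hQ h0 => add_mem_J1 _ hQ h0, J2_subset_J1 lam⟩

theorem idealStep_J1 (lam : Idx → ℂ) : IdealStep lam (J1 lam) (J2 lam) :=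
  ⟨J1_of_le, J2_of_le, fun ha _ hQ h0 => add_mem_J2 ha hQ h0, subset_rfl⟩

theorem ResonantDiag.exists_of_ne_zero {lam : Idx → ℂ} {Z : FVF} (hZ : ResonantDiag lam Z)
    (h1 : OrderGE 1 Z) {k : Idx} {q : MIdx} (h : Z k q ≠ 0) :
    ∃ Q ∈ resM lam, Q ≠ 0 ∧ q = Q + Finsupp.single k 1 := by
  obtain ⟨Q, hQ, rfl⟩ := hZ k q h
  refine ⟨Q, hQ, ?_, rfl⟩
  rintro rfl
  have := h1 _ _ h
  simp at this

section IdealStep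

variable {lam : Idx → ℂ} {U U' : Set MIdx} {V Z N : FVF}

theorem IdealStep.act_diag_left (hU : IdealStep lam U U') (hV : SuppIn U V)
    (hZ : ResonantDiag lam Z) (hZ1 : OrderGE 1 Z) {k : Idx} {q : MIdx}
    (h : act Z (V k) q ≠ 0) : q ∈ U' := by
  obtain ⟨j, p₁, p₂, hp, h1, h2⟩ := exists_of_act_ne_zero h
  obtain ⟨Q, hQ, hQ0, rfl⟩ := hZ.exists_of_ne_zero hZ1 h1
  have : q = (p₂ + Finsupp.single j 1) + Q := by rw [← hp]; abel
  rw [this]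
  exact hU.step (hV _ _ h2) hQ hQ0

/-- In V_j ∂_j(x^Q x_k) the case j = k leaves the full factor x^Q and hence falls into U'; for j ≠ k
the factor x_k survives. In Z_j ∂_j V_k the factor x_j of Z_j restores what the derivative removed,
and x^Q again leads into U'. -/
theorem IdealStep.bracket_diag (hU : IdealStep lam U U') (hV : SuppIn U V) (hmV : MomV V)
    (hmZ : MomV Z) (hZ : ResonantDiag lam Z) (hZ1 : OrderGE 1 Z) {k : Idx} {q : MIdx}
    (h : bracket V Z k q ≠ 0) (hq : q ∉ U') : ∃ a ∈ U, q = a + Finsupp.single k 1 := by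
  classical
  rcases exists_of_bracket_ne_zero hmV hmZ h with h | h
  · obtain ⟨j, p₁, p₂, hp, h1, h2⟩ := exists_of_act_ne_zero h
    obtain ⟨Q, hQ, hQ0, he⟩ := hZ.exists_of_ne_zero hZ1 h2
    by_cases hjk : j = k
    · subst hjk
      have : p₂ = Q := add_right_cancel he
      subst this
      exact absurd (hp ▸ hU.step (hV _ _ h1) hQ hQ0) hq
    · have hk : p₂ k ≠ 0 := by
        have := DFunLike.congr_fun he k
        simp [hjk] at this
        omega
      have hle : Finsupp.single k 1 ≤ p₂ := by
        simpa [Finsupp.single_le_iff] using Nat.one_le_iff_ne_zero.2 hk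
      refine ⟨p₁ + (p₂ - Finsupp.single k 1), hU.up (hV _ _ h1) le_self_add, ?_⟩
      rw [add_assoc, tsub_add_cancel_of_le hle, hp]
  · exact absurd (hU.act_diag_left hV hZ hZ1 h) hq

/-- If V_j carries a factor x^a x_j with a in U, then V_j ∂_j(x^Q x_k) regains the x_j lost by the
derivative and its exponent is a + Q + e_k. With `IdealStep.bracket_diag` this says that the bracket
with Z, applied twice, vanishes from U to U modulo U'. -/
theorem IdealStep.bracket_bracket_diag (hU : IdealStep lam U U')
    (hV : ∀ k q, V k q ≠ 0 → ∃ a ∈ U, q = a + Finsupp.single k 1) (hmV : MomV V)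
    (hmZ : MomV Z) (hZ : ResonantDiag lam Z) (hZ1 : OrderGE 1 Z) :
    SuppIn U' (bracket V Z) := by
  intro k q h
  rcases exists_of_bracket_ne_zero hmV hmZ h with h | h
  · obtain ⟨j, p₁, p₂, hp, h1, h2⟩ := exists_of_act_ne_zero h
    obtain ⟨Q, hQ, hQ0, he⟩ := hZ.exists_of_ne_zero hZ1 h2
    obtain ⟨a, ha, rfl⟩ := hV _ _ h1
    have : q = (a + Q) + Finsupp.single k 1 := by
      rw [← hp, add_assoc, add_comm _ p₂, he]; abel
    rw [this]
    exact hU.up' (hU.step ha hQ hQ0) le_self_add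
  · refine hU.act_diag_left (fun k q hq => ?_) hZ hZ1 h
    obtain ⟨a, ha, rfl⟩ := hV _ _ hq
    exact hU.up ha le_self_add

/-- A derivative of V could leave U, but Z_j returns the factor x_j that was removed. -/
theorem IdealStep.bracket_supp (hU : IdealStep lam U U') (hV : SuppIn U V) (hmV : MomV V)
    (hmZ : MomV Z) (hZ : ResonantDiag lam Z) (hZ1 : OrderGE 1 Z) : SuppIn U (bracket V Z) := by
  intro k q h
  by_cases hq : q ∈ U'
  · rcases exists_of_bracket_ne_zero hmV hmZ h with h | h
    · obtain ⟨j, p₁, p₂, hp, h1, h2⟩ := exists_of_act_ne_zero h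
      exact hU.up (hV _ _ h1) (hp ▸ le_self_add)
    · obtain ⟨j, p₁, p₂, hp, h1, h2⟩ := exists_of_act_ne_zero h
      obtain ⟨Q, hQ, hQ0, rfl⟩ := hZ.exists_of_ne_zero hZ1 h1
      refine hU.up (hV _ _ h2) ?_
      rw [← hp, add_assoc, add_comm p₂]
      exact le_add_self
  · obtain ⟨a, ha, rfl⟩ := hU.bracket_diag hV hmV hmZ hZ hZ1 h hq
    exact hU.up ha le_self_add

/-- Differentiating N leaves one generator intact, which carries the exponent of V from U into U';
in the other term the exponent of N itself remains, and it already lies in `J2`. -/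
theorem IdealStep.bracket_J2 (hU : IdealStep lam U U') (hV : SuppIn U V) (hmV : MomV V)
    (hmN : MomV N) (hN : SuppIn (J2 lam) N) : SuppIn U' (bracket V N) := by
  intro k q h
  rcases exists_of_bracket_ne_zero hmV hmN h with h | h
  · obtain ⟨j, p₁, p₂, hp, h1, h2⟩ := exists_of_act_ne_zero h
    obtain ⟨Q, hQ, hle⟩ := mem_J1_of_add_single_mem_J2 (hN _ _ h2)
    refine hU.up' (hU.step (hV _ _ h1) hQ.1 hQ.2.1) (hp ▸ ?_)
    gcongr
  · obtain ⟨j, p₁, p₂, hp, h1, h2⟩ := exists_of_act_ne_zero h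
    exact hU.sub (J2_of_le (hN _ _ h1) (hp ▸ le_self_add))

end IdealStep

theorem MomV.homInv {lam : Idx → ℂ} {V : FVF} (h : MomV V) : MomV (homInv lam V) :=
  h.of_ne_zero fun _ _ => homInv_ne_zero

theorem OrderGE.homInv {lam : Idx → ℂ} {d : ℕ} {V : FVF} (h : OrderGE d V) :
    OrderGE d (homInv lam V) :=
  h.of_ne_zero fun _ _ => homInv_ne_zero

theorem SuppIn.of_ne_zero {J : Set MIdx} {V V' : FVF} (h : SuppIn J V)
    (hV : ∀ k q, V' k q ≠ 0 → V k q ≠ 0) : SuppIn J V' :=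
  fun k q hq => h k q (hV k q hq)

theorem suppIn_proj (J : Set MIdx) (V : FVF) : SuppIn J (proj J V) :=
  fun _ _ hq => (proj_ne_zero hq).1

theorem SuppIn.add {J : Set MIdx} {V V' : FVF} (h : SuppIn J V) (h' : SuppIn J V') :
    SuppIn J (V + V') := by
  intro k q hq
  by_cases hV : V k q = 0
  · exact h' k q fun hV' => hq (by simp [hV, hV'])
  · exact h k q hV

theorem SuppIn.mono {J J' : Set MIdx} {V : FVF} (h : SuppIn J V) (hJ : J ⊆ J') : SuppIn J' V :=
  fun k q hq => hJ (h k q hq)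

theorem SuppIn.apply_eq_zero {J : Set MIdx} {V : FVF} (h : SuppIn J V) {k : Idx} {q : MIdx}
    (hq : q ∉ J) : V k q = 0 := by
  by_contra hV
  exact hq (h k q hV)

theorem proj_apply_of_mem {J : Set MIdx} {V : FVF} {k : Idx} {q : MIdx} (h : q ∈ J) :
    proj J V k q = V k q := Set.indicator_of_mem h _

theorem proj_apply_of_notMem {J : Set MIdx} {V : FVF} {k : Idx} {q : MIdx} (h : q ∉ J) :
    proj J V k q = 0 := Set.indicator_of_notMem h _

/-- The solution of the homological equation on one step of the filtration: one correction of
the naive solution suffices. -/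
def homSol (lam : Idx → ℂ) (J : Set MIdx) (Z Y : FVF) : FVF :=
  homInv lam (Y + proj J (bracket (homInv lam Y) Z))

section homSol

variable {lam : Idx → ℂ} {U U' : Set MIdx} {Z Y : FVF}

theorem momV_homSol {J : Set MIdx} (hmY : MomV Y) (hmZ : MomV Z) : MomV (homSol lam J Z Y) :=
  (hmY.add ((hmY.homInv.bracket hmZ).proj _)).homInv

theorem orderGE_homSol {J : Set MIdx} {d : ℕ} (hmY : MomV Y) (hmZ : MomV Z) (hY : OrderGE d Y)
    (hZ : OrderGE 1 Z) : OrderGE d (homSol lam J Z Y) :=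
  (hY.add (((hY.homInv.bracket hmY.homInv hmZ hZ).of_le (by omega)).proj _)).homInv

theorem suppIn_homSol {J : Set MIdx} (hY : SuppIn J Y) : SuppIn J (homSol lam J Z Y) :=
  (hY.add (suppIn_proj _ _)).of_ne_zero fun _ _ => homInv_ne_zero

theorem IdealStep.homSol_eq (hU : IdealStep lam U U') (hmY : MomV Y) (hmZ : MomV Z)
    (hY : SuppIn (U \ U') Y) (hZ : ResonantDiag lam Z) (hZ1 : OrderGE 1 Z)
    {k : Idx} {q : MIdx} (hq : q ∈ U \ U') (hf : freqZ lam (shift q k) ≠ 0) :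
    freqZ lam (shift q k) * homSol lam (U \ U') Z Y k q
      = Y k q + bracket (homSol lam (U \ U') Z Y) Z k q := by
  set V := homInv lam Y
  have hmV : MomV V := hmY.homInv
  have hsV : SuppIn U V := (hY.of_ne_zero fun _ _ => homInv_ne_zero).mono Set.sdiff_subset
  set B := homInv lam (proj (U \ U') (bracket V Z)) with hB
  have hmB : MomV B := ((hmV.bracket hmZ).proj _).homInv
  have hdec : homSol lam (U \ U') Z Y = V + B := homInv_add _ _ _
  -- B comes from the part of [V,Z] outside U', so its monomials have the factor x_k needed by
  -- `IdealStep.bracket_bracket_diag`. Hence the correction produces no new error in U \ U'.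
  have hB0 : bracket B Z k q = 0 := by
    refine SuppIn.apply_eq_zero (hU.bracket_bracket_diag (fun k q h => ?_) hmB hmZ hZ hZ1) hq.2
    have h' := proj_ne_zero (homInv_ne_zero h)
    exact hU.bracket_diag hsV hmV hmZ hZ hZ1 h'.2 h'.1.2
  have hbr : bracket (homSol lam (U \ U') Z Y) Z k q = bracket V Z k q := by
    rw [hdec, bracket_add_left hmZ hmV hmB]
    change bracket V Z k q + bracket B Z k q = _
    rw [hB0, add_zero]
  rw [hbr]
  change freqZ lam (shift q k) * ((freqZ lam (shift q k))⁻¹ *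
    (Y k q + proj (U \ U') (bracket V Z) k q)) = _
  rw [mul_inv_cancel_left₀ hf, proj_apply_of_mem hq]

/-- Bound for the solution on one step of the filtration. -/
theorem Bd.homSol {J : Set MIdx} {s r ρ σ κ A B : ℝ} (hY : Bd s r Y A) (hZ : Bd s r Z B)
    (hA : 0 ≤ A) (hB : 0 ≤ B) (hκ : 0 ≤ κ) (hσ : 0 ≤ σ) (hρ : 0 < ρ)
    (hsmall : ∀ (k : Idx) (q : MIdx), 2 ≤ q.degree → momN q = mom k →
      freqZ lam (shift q k) ≠ 0 →
      ‖freqZ lam (shift q k)‖⁻¹ ≤ κ * Real.exp (σ * (sqrtSum q - √(bra k))))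
    (hmY : MomV Y) (hmZ : MomV Z) (hY1 : OrderGE 1 Y) (hZ1 : OrderGE 1 Z) :
    Bd (s + 2 * σ) (r - ρ) (homSol lam J Z Y) (κ * (A + 2 * (κ * A) * B / ρ)) := by
  have h1 : Bd (s + σ) r (ResonantNF.homInv lam Y) (κ * A) := hY.homInv hκ hsmall hmY hY1
  have h2 : Bd (s + σ) r Z B :=
    hZ.of_le_exponent (by linarith) hmZ hZ1.apply_zero
  have h3 := (h1.bracket h2 hmY.homInv hmZ (by positivity) hB hρ).proj J
  have h4 : Bd (s + σ) (r - ρ) Y A :=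
    (hY.of_le_exponent (by linarith) hmY hY1.apply_zero).of_radius_le (by linarith)
  have hmP : MomV (ResonantNF.proj J (ResonantNF.bracket (ResonantNF.homInv lam Y) Z)) :=
    (hmY.homInv.bracket hmZ).proj J
  have hP1 : OrderGE 1 (ResonantNF.proj J (ResonantNF.bracket (ResonantNF.homInv lam Y) Z)) :=
    ((hY1.homInv.bracket hmY.homInv hmZ hZ1).of_le (by omega)).proj _
  have h5 := (h4.add h3 hA (by positivity)).homInv hκ hsmall (hmY.add hmP) (hY1.add hP1)
  have e : s + 2 * σ = s + σ + σ := by ring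
  rw [e]
  exact h5

end homSol

/-! ### Resonant monomials of high degree -/

theorem resM_add {lam : Idx → ℂ} {P Q : MIdx} (hP : P ∈ resM lam) (hQ : Q ∈ resM lam) :
    P + Q ∈ resM lam := by
  refine ⟨?_, ?_⟩
  · rw [natToInt_add, freqZ_add, hP.1, hQ.1, add_zero]
  · rw [natToInt_add, momZ_add, hP.2, hQ.2, add_zero]

theorem resM_zero (lam : Idx → ℂ) : (0 : MIdx) ∈ resM lam := by
  simp [resM, freqZ, momZ]

/-- An element too large to be a generator splits into two nonzero elements, each divisible by a
generator. -/
theorem mem_J2_of_degree_gt {lam : Idx → ℂ} {M : ℕ} (hM : ∀ Q ∈ genM lam, Q.degree ≤ M)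
    {Q : MIdx} (hQ : Q ∈ resM lam) (hd : M < Q.degree) : Q ∈ J2 lam := by
  have h0 : Q ≠ 0 := by rintro rfl; simp at hd
  have hg : Q ∉ genM lam := fun h => absurd (hM Q h) (by omega)
  have : ∃ A ∈ resM lam, ∃ B ∈ resM lam, A + B = Q ∧ A ≠ 0 ∧ B ≠ 0 := by
    by_contra hc
    push Not at hc
    refine hg ⟨hQ, h0, fun A hA B hB hAB => ?_⟩
    by_contra hne
    push Not at hne
    exact hne.2 (hc A hA B hB hAB hne.1)
  obtain ⟨A, hA, B, hB, hAB, hA0, hB0⟩ := this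
  obtain ⟨P, hP, hle⟩ := exists_genM_le hA hA0
  obtain ⟨P', hP', hle'⟩ := exists_genM_le hB hB0
  exact ⟨P, hP, P', hP', hAB ▸ add_le_add hle hle'⟩

theorem shift_mem_resDk_iff {lam : Idx → ℂ} {q : MIdx} {k : Idx} :
    shift q k ∈ resDk lam k ↔ freqZ lam (shift q k) = 0 ∧ momZ (shift q k) = 0 :=
  ⟨fun h => ⟨h.1, h.2.1⟩, fun h => ⟨h.1, h.2, q, by rw [shift, sub_add_cancel]⟩⟩

/-- Elements of `Δ_λ^{(k)}` outside `M_λ` are sums of a generator and an element of `M_λ`. -/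
theorem exists_genOut_add {lam : Idx → ℂ} {q : MIdx} {k : Idx} (h : shift q k ∈ resDk lam k)
    (hout : shift q k ∉ natToInt '' resM lam) :
    ∃ p Q, q = p + Q ∧ Q ∈ resM lam ∧ shift p k ∈ genOut lam ∩ resDk lam k := by
  obtain ⟨n, hn⟩ : ∃ n, q.degree = n := ⟨_, rfl⟩
  induction n using Nat.strong_induction_on generalizing q with
  | _ n ih =>
    have hres : shift q k ∈ resOut lam := ⟨Set.mem_iUnion.2 ⟨k, h⟩, hout⟩
    by_cases hg : shift q k ∈ genOut lam
    · exact ⟨q, 0, (add_zero q).symm, resM_zero lam, hg, h⟩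
    · have : ∃ P' ∈ resOut lam, ∃ Q ∈ resM lam, shift q k = P' + natToInt Q ∧ Q ≠ 0 := by
        by_contra hc
        push Not at hc
        exact hg ⟨hres, fun P' hP' Q hQ he => hc P' hP' Q hQ he⟩
      obtain ⟨P', hP', Q, hQ, he, hQ0⟩ := this
      obtain ⟨k', hk'⟩ := Set.mem_iUnion.1 hP'.1
      obtain ⟨hf', hm', p', hp'⟩ := hk'
      have hP'k : P' = shift p' k' := by rw [shift, ← hp', add_sub_cancel_right]
      -- If p' contained e_{k'}, then P' would have no negative entry and would lie in M_λ.
      have hp'0 : p' k' = 0 := by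
        by_contra hne
        have hle : Finsupp.single k' 1 ≤ p' := by
          simpa [Finsupp.single_le_iff] using Nat.one_le_iff_ne_zero.2 hne
        refine hP'.2 ⟨p' - Finsupp.single k' 1, ?_, ?_⟩
        · have e : natToInt (p' - Finsupp.single k' 1) = P' := by
            rw [hP'k, shift]
            nth_rw 2 [← tsub_add_cancel_of_le hle]
            rw [natToInt_add, natToInt_single, add_sub_cancel_right]
          exact ⟨by rw [e]; exact hf', by rw [e]; exact hm'⟩
        · rw [hP'k, shift]
          nth_rw 2 [← tsub_add_cancel_of_le hle]
          rw [natToInt_add, natToInt_single, add_sub_cancel_right]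
      have hsum : natToInt q + Finsupp.single k' 1 = natToInt (p' + Q) + Finsupp.single k 1 := by
        have := he
        rw [hP'k, shift, shift] at this
        rw [natToInt_add]
        rw [sub_eq_iff_eq_add] at this
        rw [this]; abel
      -- P' has the entry -1 at k'. If k' ≠ k, the sum is nonnegative there, so Q compensates this
      -- entry; the whole sum is then nonnegative and lies in M_λ, a contradiction.
      have hkk : k' = k := by
        by_contra hne
        have hcoef := DFunLike.congr_fun hsum k'
        simp [Ne.symm hne, hp'0] at hcoef
        have hQk : Q k' ≠ 0 := by omega
        have hle : Finsupp.single k' 1 ≤ Q := by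
          simpa [Finsupp.single_le_iff] using Nat.one_le_iff_ne_zero.2 hQk
        have e : shift q k = natToInt (p' + (Q - Finsupp.single k' 1)) := by
          rw [he, hP'k, shift]
          nth_rw 1 [← tsub_add_cancel_of_le hle]
          rw [natToInt_add, natToInt_add, natToInt_single]
          abel
        exact hout ⟨_, ⟨by rw [← e]; exact h.1, by rw [← e]; exact h.2.1⟩, e.symm⟩
      subst hkk
      have hq : q = p' + Q := natToInt_injective (add_right_cancel hsum)
      have hd := congrArg Finsupp.degree hq
      rw [map_add] at hd
      have hQd : Q.degree ≠ 0 := fun h => hQ0 ((Finsupp.degree_eq_zero_iff Q).1 h)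
      have hmem : shift p' k' ∈ resDk lam k' :=
        ⟨hP'k ▸ hf', hP'k ▸ hm', p', by rw [shift, sub_add_cancel]⟩
      obtain ⟨p, Q', hpQ, hQ', hgen⟩ := ih p'.degree (by omega) hmem (hP'k ▸ hP'.2) rfl
      exact ⟨p, Q' + Q, by rw [hq, hpQ, add_assoc], resM_add hQ' hQ, hgen⟩

/-- A large resonant exponent is a bounded piece plus an element of M_λ of degree above the
generator bound, and the latter already lies in `J2`. Nonemptiness is essential: the infimum of the
empty set in ℕ is 0, and only a nonempty set contains its infimum. -/
theorem resonanceDegrees_nonempty {lam : Idx → ℂ} (h : BoundedGenerators lam) :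
    (resonanceDegrees lam).Nonempty := by
  obtain ⟨-, ⟨M, hM⟩, ⟨M₁, hM₁⟩⟩ := h
  refine ⟨M₁ + M + 1, fun k q hq hd => ?_⟩
  by_cases hout : shift q k ∈ natToInt '' resM lam
  · obtain ⟨Q, hQ, he⟩ := hout
    have hqQ : q = Q + Finsupp.single k 1 := by
      apply natToInt_injective
      rw [natToInt_add, natToInt_single, he, shift, sub_add_cancel]
    have hdeg := congrArg Finsupp.degree hqQ
    rw [map_add, Finsupp.degree_single] at hdeg
    exact J2_of_le (mem_J2_of_degree_gt hM hQ (by omega)) (hqQ ▸ le_self_add)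
  · obtain ⟨p, Q, hpQ, hQ, hgen⟩ := exists_genOut_add hq hout
    have hp := hM₁ k p hgen
    have hdeg := congrArg Finsupp.degree hpQ
    rw [map_add] at hdeg
    exact J2_of_le (mem_J2_of_degree_gt hM hQ (by omega)) (hpQ ▸ le_add_self)

theorem nonresonant_of_degree {lam : Idx → ℂ} (h : BoundedGenerators lam) {m : ℕ}
    (hm : sInf (resonanceDegrees lam) ≤ m) {k : Idx} {q : MIdx} (hq : m + 1 ≤ q.degree)
    (hmom : momN q = mom k) (hJ : q ∉ J2 lam) : freqZ lam (shift q k) ≠ 0 := by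
  intro hf
  refine hJ (Nat.sInf_mem (resonanceDegrees_nonempty h) k q ?_ (by omega))
  exact shift_mem_resDk_iff.2 ⟨hf, by rw [momZ_shift, hmom, sub_self]⟩

/-- Degree 0 is never admissible: x_k ∂/∂x_k is resonant, while an element of `J2` has degree at
least 2. Hence X and N have order at least one, as the small divisor estimate requires. -/
theorem one_le_of_sInf_le {lam : Idx → ℂ} (h : BoundedGenerators lam) {m : ℕ}
    (hm : sInf (resonanceDegrees lam) ≤ m) : 1 ≤ m := by
  by_contra hc
  have h0 : sInf (resonanceDegrees lam) = 0 := by omega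
  have hmem := Nat.sInf_mem (resonanceDegrees_nonempty h)
  rw [h0] at hmem
  set k : Idx := (0, 1)
  have hsh : shift (Finsupp.single k 1) k = 0 := by rw [shift, natToInt_single, sub_self]
  obtain ⟨Q, hQ, Q', hQ', hle⟩ := hmem k (Finsupp.single k 1)
    (shift_mem_resDk_iff.2 (by rw [hsh]; simp [freqZ, momZ])) (by simp)
  have hdeg := Finsupp.degree_mono hle
  rw [map_add, Finsupp.degree_single] at hdeg
  have h1 : Q.degree ≠ 0 := fun h => hQ.2.1 ((Finsupp.degree_eq_zero_iff Q).1 h)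
  have h2 : Q'.degree ≠ 0 := fun h => hQ'.2.1 ((Finsupp.degree_eq_zero_iff Q').1 h)
  omega

/-! ### The homological equation -/

/-- The data of the KAM step. -/
structure StepData (lam : Idx → ℂ) (m : ℕ) (Z X N : FVF) : Prop where
  gens : BoundedGenerators lam
  deg : sInf (resonanceDegrees lam) ≤ m
  pmZ : MomV Z
  diagZ : ResonantDiag lam Z
  ordZ : OrderGE 1 Z
  pmX : MomV X
  ordX : OrderGE m X
  suppX : SuppIn (J2 lam)ᶜ X
  pmN : MomV N
  ordN : OrderGE m N
  suppN : SuppIn (J2 lam) N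

theorem StepData.ordN1 {lam : Idx → ℂ} {m : ℕ} {Z X N : FVF} (h : StepData lam m Z X N) :
    OrderGE 1 N := h.ordN.of_le (one_le_of_sInf_le h.gens h.deg)

/-- The solution of the homological equation
`[F, D(λ) + Z + N] = -X` modulo `J^{(2)}`. -/
theorem StepData.exists_homological {lam : Idx → ℂ} {m : ℕ} {Z X N : FVF}
    (h : StepData lam m Z X N) {s r ρ σ κ A B B' : ℝ}
    (hX : Bd s r X A) (hZ : Bd s r Z B) (hN : Bd s r N B')
    (hA : 0 ≤ A) (hB : 0 ≤ B) (hB' : 0 ≤ B') (hκ : 0 ≤ κ) (hσ : 0 ≤ σ) (hρ : 0 < ρ)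
    (hsmall : ∀ (k : Idx) (q : MIdx), 2 ≤ q.degree → momN q = mom k →
      freqZ lam (shift q k) ≠ 0 →
      ‖freqZ lam (shift q k)‖⁻¹ ≤ κ * Real.exp (σ * (sqrtSum q - √(bra k)))) :
    ∃ F : FVF, MomV F ∧ OrderGE m F ∧ SuppIn (J2 lam)ᶜ F ∧
      Bd (s + 4 * σ) (r - 3 * ρ) F (κ * (A + 2 * (κ * A) * B / ρ) +
        κ * ((A + 2 * (κ * (A + 2 * (κ * A) * B / ρ)) * (B + B') / ρ) + 2 * (κ *
          (A + 2 * (κ * (A + 2 * (κ * A) * B / ρ)) * (B + B') / ρ)) * B / ρ)) ∧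
      ∀ k, ∀ q ∉ J2 lam, X k q + bracket F (Z + N) k q = freqZ lam (shift q k) * F k q := by
  have hm1 : 1 ≤ m := one_le_of_sInf_le h.gens h.deg
  set Y₀ := proj (Set.univ \ J1 lam) X with hY₀
  set F₀ := homSol lam (Set.univ \ J1 lam) Z Y₀ with hF₀
  have hmY₀ : MomV Y₀ := h.pmX.proj _
  have hmF₀ : MomV F₀ := momV_homSol hmY₀ h.pmZ
  have hoY₀ : OrderGE m Y₀ := h.ordX.proj _
  have hoF₀ : OrderGE m F₀ := orderGE_homSol hmY₀ h.pmZ hoY₀ h.ordZ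
  have hsF₀ : SuppIn (Set.univ \ J1 lam) F₀ := suppIn_homSol (suppIn_proj _ _)
  have hmZN : MomV (Z + N) := h.pmZ.add h.pmN
  have hoZN : OrderGE 1 (Z + N) := h.ordZ.add h.ordN1
  -- On the second level the source contains, besides X, what the first solution produces there by
  -- brackets with Z and N.
  set Y₁ := proj (J1 lam \ J2 lam) (X + bracket F₀ (Z + N)) with hY₁
  set F₁ := homSol lam (J1 lam \ J2 lam) Z Y₁ with hF₁
  have hmY₁ : MomV Y₁ := (h.pmX.add (hmF₀.bracket hmZN)).proj _
  have hmF₁ : MomV F₁ := momV_homSol hmY₁ h.pmZ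
  have hoB₀ : OrderGE m (bracket F₀ (Z + N)) :=
    (hoF₀.bracket hmF₀ hmZN hoZN).of_le (by omega)
  have hoY₁ : OrderGE m Y₁ := (h.ordX.add hoB₀).proj _
  have hoF₁ : OrderGE m F₁ := orderGE_homSol hmY₁ h.pmZ hoY₁ h.ordZ
  have hsF₁ : SuppIn (J1 lam \ J2 lam) F₁ := suppIn_homSol (suppIn_proj _ _)
  have hmF : MomV (F₀ + F₁) := hmF₀.add hmF₁
  have hoF : OrderGE m (F₀ + F₁) := hoF₀.add hoF₁
  have hsF : SuppIn (J2 lam)ᶜ (F₀ + F₁) := by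
    refine (hsF₀.mono fun q hq hq2 => hq.2 (J2_subset_J1 lam hq2)).add (hsF₁.mono fun q hq => hq.2)
  refine ⟨F₀ + F₁, hmF, hoF, hsF, ?_, ?_⟩
  · have b0 : Bd (s + 2 * σ) (r - ρ) F₀ (κ * (A + 2 * (κ * A) * B / ρ)) :=
      (hX.proj _).homSol hZ hA hB hκ hσ hρ hsmall hmY₀ h.pmZ (hoY₀.of_le hm1) h.ordZ
    set f₀ := κ * (A + 2 * (κ * A) * B / ρ) with hf₀
    have hf₀0 : 0 ≤ f₀ := by positivity
    have bZN : Bd (s + 2 * σ) (r - ρ) (Z + N) (B + B') :=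
      ((hZ.add hN hB hB').of_le_exponent (by linarith) hmZN hoZN.apply_zero).of_radius_le
        (by linarith)
    have bX : Bd (s + 2 * σ) (r - ρ - ρ) X A :=
      (hX.of_le_exponent (by linarith) h.pmX h.ordX.apply_zero).of_radius_le (by linarith)
    have bY : Bd (s + 2 * σ) (r - ρ - ρ) Y₁ (A + 2 * f₀ * (B + B') / ρ) :=
      (bX.add (b0.bracket bZN hmF₀ hmZN hf₀0 (by positivity) hρ) hA (by positivity)).proj _
    have bZ : Bd (s + 2 * σ) (r - ρ - ρ) Z B :=
      (hZ.of_le_exponent (by linarith) h.pmZ h.ordZ.apply_zero).of_radius_le (by linarith)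
    have b1 := bY.homSol (J := J1 lam \ J2 lam) bZ (by positivity) hB hκ hσ hρ hsmall hmY₁ h.pmZ
      (hoY₁.of_le hm1) h.ordZ
    have e1 : s + 2 * σ + 2 * σ = s + 4 * σ := by ring
    have e2 : r - ρ - ρ - ρ = r - 3 * ρ := by ring
    rw [e1, e2] at b1
    have b0' : Bd (s + 4 * σ) (r - 3 * ρ) F₀ f₀ :=
      (b0.of_le_exponent (by linarith) hmF₀ hoF₀.apply_zero).of_radius_le (by linarith)
    exact b0'.add b1 (by positivity) (by positivity)
  · intro k q hq
    have hadd : bracket (F₀ + F₁) (Z + N) k q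
        = bracket F₀ Z k q + bracket F₀ N k q + (bracket F₁ Z k q + bracket F₁ N k q) := by
      rw [bracket_add_left hmZN hmF₀ hmF₁, bracket_add_right hmF₀ h.pmZ h.pmN,
        bracket_add_right hmF₁ h.pmZ h.pmN]
      rfl
    have hsU : SuppIn (J1 lam) F₁ := hsF₁.mono Set.sdiff_subset
    -- Nonresonance is known only from degree m on; below it every term of the equation vanishes by
    -- order.
    by_cases hdeg : q.degree < m + 1
    · have hz : ∀ V : FVF, OrderGE m V → V k q = 0 := by
        intro V hV
        by_contra hne
        exact absurd (hV k q hne) (by omega)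
      rw [hz _ h.ordX, hz _ hoF,
        hz _ ((hoF.bracket hmF hmZN hoZN).of_le (by omega))]
      simp
    push Not at hdeg
    by_cases hmom : momN q = mom k
    · have hf := nonresonant_of_degree h.gens h.deg hdeg hmom hq
      by_cases hq1 : q ∈ J1 lam
      · have e0 : F₀ k q = 0 := hsF₀.apply_eq_zero fun hh => hh.2 hq1
        have e1 : bracket F₁ N k q = 0 :=
          ((idealStep_J1 lam).bracket_J2 hsU hmF₁ h.pmN h.suppN).apply_eq_zero hq
        have key := (idealStep_J1 lam).homSol_eq hmY₁ h.pmZ (suppIn_proj _ _) h.diagZ h.ordZ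
          (k := k) ⟨hq1, hq⟩ hf
        rw [← hF₁, hY₁, proj_apply_of_mem (show q ∈ J1 lam \ J2 lam from ⟨hq1, hq⟩)] at key
        rw [hadd]
        change _ = _ * (F₀ k q + F₁ k q)
        rw [e0, zero_add, key, e1]
        change X k q + _ = X k q + bracket F₀ (Z + N) k q + _
        rw [bracket_add_right hmF₀ h.pmZ h.pmN]
        change _ = X k q + (bracket F₀ Z k q + bracket F₀ N k q) + _
        ring
      -- Outside `J1` the field F₁ is invisible: `J1` is stable under brackets with Z, and a bracket
      -- with N leads F₁ into `J2`. Likewise [F₀,N] lies in `J1`.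
      · have e1 : F₁ k q = 0 := hsF₁.apply_eq_zero fun hh => hq1 hh.1
        have e2 : bracket F₁ N k q = 0 :=
          ((idealStep_J1 lam).bracket_J2 hsU hmF₁ h.pmN h.suppN).apply_eq_zero hq
        have e3 : bracket F₁ Z k q = 0 :=
          ((idealStep_J1 lam).bracket_supp hsU hmF₁ h.pmZ h.diagZ h.ordZ).apply_eq_zero hq1
        have e4 : bracket F₀ N k q = 0 :=
          ((idealStep_univ lam).bracket_J2 (fun _ _ _ => trivial) hmF₀ h.pmN
            h.suppN).apply_eq_zero hq1
        have key := (idealStep_univ lam).homSol_eq hmY₀ h.pmZ (suppIn_proj _ _) h.diagZ h.ordZ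
          (k := k) ⟨trivial, hq1⟩ hf
        rw [← hF₀, hY₀, proj_apply_of_mem (show q ∈ Set.univ \ J1 lam from ⟨trivial, hq1⟩)] at key
        rw [hadd, e2, e3, e4]
        change _ = _ * (F₀ k q + F₁ k q)
        rw [e1]
        linear_combination -key
    · have hz : ∀ V : FVF, MomV V → V k q = 0 := by
        intro V hV
        by_contra hne
        exact hmom (hV k q hne)
      rw [hz _ h.pmX, hz _ hmF, hz _ (hmF.bracket hmZN)]
      simp

/-- Outside `J2` the homological equation turns the D(λ) bracket into -X; on `J2` both F and X
vanish, so that bracket is zero and only the projection of [F,Z+N] is left. D(λ) has disappeared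
from the result. -/
theorem bracket_total {lam : Idx → ℂ} {m : ℕ} {Z X N F : FVF} (h : StepData lam m Z X N)
    (hmF : MomV F) (hsF : SuppIn (J2 lam)ᶜ F)
    (hF : ∀ k, ∀ q ∉ J2 lam, X k q + bracket F (Z + N) k q = freqZ lam (shift q k) * F k q) :
    bracket F (diagField lam + Z + X + N)
      = -X + proj (J2 lam) (bracket F (Z + N)) + bracket F X := by
  have e : diagField lam + Z + X + N = diagField lam + (Z + N) + X := by abel
  rw [e, bracket_add_right hmF ((momV_diagField lam).add (h.pmZ.add h.pmN)) h.pmX,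
    bracket_add_right hmF (momV_diagField lam) (h.pmZ.add h.pmN)]
  congr 1
  funext k q
  change bracket F (diagField lam) k q + bracket F (Z + N) k q
    = -X k q + proj (J2 lam) (bracket F (Z + N)) k q
  rw [bracket_diagField lam hmF]
  by_cases hq : q ∈ J2 lam
  · rw [proj_apply_of_mem hq, hsF.apply_eq_zero (not_not_intro hq),
      h.suppX.apply_eq_zero (not_not_intro hq)]
    ring
  · rw [proj_apply_of_notMem hq, ← hF k q hq]
    ring

/-! ### Iterated brackets -/

/-- Divide the loss δ into n equal parts: n steps cost (an/δ)^n, and n^n ≤ n! e^n. The factor n! is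
cancelled by the 1/n! of the Lie series. -/
theorem iterate_bound {Q : ℕ → ℝ → ℝ → Prop} {R a B δ : ℝ} (ha : 0 ≤ a) (hB : 0 ≤ B) (hδ : 0 < δ)
    (hstep : ∀ j ρ ε B, ρ ≤ R → 0 ≤ B → 0 < ε → Q j ρ B → Q (j + 1) (ρ - ε) (a * B / ε))
    (hradius : ∀ ρ ≤ R, Q 0 R B → Q 0 ρ B)
    (hmono : ∀ n ρ B B', B ≤ B' → Q n ρ B → Q n ρ B') (h0 : Q 0 R B) (n : ℕ) :
    Q n (R - δ) (n ! * (Real.exp 1 * a / δ) ^ n * B) := by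
  rcases Nat.eq_zero_or_pos n with rfl | hn
  · simpa using hradius (R - δ) (by linarith) h0
  have hn' : (0 : ℝ) < n := by exact_mod_cast hn
  have hε : 0 < δ / n := by positivity
  have hind : ∀ j : ℕ, Q j (R - j * (δ / n)) ((a / (δ / n)) ^ j * B) := by
    intro j
    induction j with
    | zero => simpa using h0
    | succ j ih =>
      have hj : 0 ≤ j * (δ / n) := by positivity
      have := hstep j _ _ _ (by linarith) (by positivity) hε ih
      have e1 : R - j * (δ / n) - δ / n = R - (j + 1 : ℕ) * (δ / n) := by push_cast; ring
      have e2 : a * ((a / (δ / n)) ^ j * B) / (δ / n) = (a / (δ / n)) ^ (j + 1) * B := by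
        rw [pow_succ]; ring
      rwa [e1, e2] at this
  have h1 := hind n
  have e1 : R - n * (δ / n) = R - δ := by field_simp
  rw [e1] at h1
  refine hmono _ _ _ _ ?_ h1
  gcongr
  have h2 : (n : ℝ) ^ n ≤ n ! * Real.exp 1 ^ n := by
    have := Real.pow_div_factorial_le_exp (n : ℝ) hn'.le n
    rw [div_le_iff₀ (by positivity)] at this
    rw [← Real.exp_nat_mul, mul_one, mul_comm]
    exact this
  calc (a / (δ / n)) ^ n = (a / δ) ^ n * (n : ℝ) ^ n := by
        rw [← mul_pow]; congr 1; field_simp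
    _ ≤ (a / δ) ^ n * (n ! * Real.exp 1 ^ n) := by gcongr
    _ = n ! * (Real.exp 1 * a / δ) ^ n := by
        rw [mul_div_assoc, mul_pow]; ring

theorem momV_iterate_bracket {F G : FVF} (hF : MomV F) (hG : MomV G) (n : ℕ) :
    MomV ((bracket F)^[n] G) := by
  induction n with
  | zero => exact hG
  | succ n ih => rw [Function.iterate_succ_apply']; exact hF.bracket ih

theorem Bd.iterate_bracket {s R δ A B : ℝ} {F G : FVF} (hF : Bd s R F A) (hG : Bd s R G B)
    (hmF : MomV F) (hmG : MomV G) (hA : 0 ≤ A) (hB : 0 ≤ B) (hδ : 0 < δ) (n : ℕ) :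
    Bd s (R - δ) ((ResonantNF.bracket F)^[n] G) (n ! * (Real.exp 1 * (2 * A) / δ) ^ n * B) := by
  refine iterate_bound (Q := fun n ρ B => Bd s ρ ((ResonantNF.bracket F)^[n] G) B) (R := R)
    (by positivity) hB hδ ?_ (fun ρ hρ h => h.of_radius_le hρ) (fun n ρ B B' hBB h => h.of_le hBB)
    hG n
  intro j ρ ε B hρ hB hε h
  rw [Function.iterate_succ_apply']
  exact (hF.of_radius_le hρ).bracket h hmF (momV_iterate_bracket hmF hmG j) hA hB hε

theorem Bd.iterate_lie {s R δ A B : ℝ} {F G : FVF} (hF : Bd s R F A) (hG : Bd s R G B)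
    (hA : 0 ≤ A) (hB : 0 ≤ B) (hδ : 0 < δ) (n : ℕ) :
    Bd s (R - δ) ((ResonantNF.lie F)^[n] G) (n ! * (Real.exp 1 * A / δ) ^ n * B) := by
  refine iterate_bound (Q := fun n ρ B => Bd s ρ ((ResonantNF.lie F)^[n] G) B) (R := R)
    hA hB hδ ?_ (fun ρ hρ h => h.of_radius_le hρ) (fun n ρ B B' hBB h => h.of_le hBB) hG n
  intro j ρ ε B hρ hB hε h
  rw [Function.iterate_succ_apply']
  exact (hF.of_radius_le hρ).lie h hA hε

theorem SBd.iterate_act {s R δ A M : ℝ} {F : FVF} {f : MIdx → ℂ} (hf : SBd s R f M)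
    (hF : Bd s R F A) (hA : 0 ≤ A) (hM : 0 ≤ M) (hδ : 0 < δ) (n : ℕ) :
    SBd s (R - δ) ((ResonantNF.act F)^[n] f) (n ! * (Real.exp 1 * A / δ) ^ n * M) := by
  refine iterate_bound (Q := fun n ρ B => SBd s ρ ((ResonantNF.act F)^[n] f) B) (R := R)
    hA hM hδ ?_ (fun ρ hρ h y hy => h y (hy.trans_le (ENNReal.ofReal_le_ofReal hρ)))
    (fun n ρ B B' hBB h y hy => (h y hy).trans (ENNReal.ofReal_le_ofReal hBB)) hf n
  intro j ρ ε B hρ hB hε h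
  rw [Function.iterate_succ_apply']
  exact h.act (hF.of_radius_le hρ) hA hε

theorem wNorm_ne_top_of_finite_support (s : ℝ) (T : Finset Idx) :
    wNorm s (Set.indicator (T : Set Idx) fun _ => 1) ≠ ⊤ := by
  unfold wNorm
  rw [tsum_eq_sum (s := T)]
  · refine ENNReal.rpow_ne_top_of_nonneg (by norm_num) ?_
    refine (ENNReal.sum_lt_top.2 fun k _ => ?_).ne
    refine ENNReal.pow_lt_top (ENNReal.mul_lt_top ENNReal.ofReal_lt_top ?_)
    by_cases hk : k ∈ (T : Set Idx)
    · simp [Set.indicator_of_mem hk]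
    · simp [Set.indicator_of_notMem hk]
  · intro k hk
    simp [hk]

/-- Coefficients are controlled by the norm. -/
theorem exists_coeff_bound (s : ℝ) {r : ℝ} (hr : 0 < r) (k : Idx) (q : MIdx) :
    ∃ c : ℝ, 0 ≤ c ∧ ∀ (V : FVF) (B : ℝ), Bd s r V B → 0 ≤ B → ‖V k q‖ ≤ c * B := by
  set y₁ : Idx → ℝ≥0∞ := Set.indicator (q.support : Set Idx) fun _ => 1 with hy₁
  have hK := wNorm_ne_top_of_finite_support s q.support
  set K := (wNorm s y₁).toReal with hKdef
  have hK0 : 0 ≤ K := ENNReal.toReal_nonneg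
  -- A small multiple of the indicator of the support of q lies in the ball and gives x^q a positive
  -- value, so it detects this single coefficient.
  set ε := r / (2 * (K + 1)) with hε
  have hε0 : 0 < ε := by positivity
  have hlt : wNorm s (fun i => ENNReal.ofReal ε * y₁ i) < ENNReal.ofReal r := by
    rw [wNorm_const_mul, ← ENNReal.ofReal_toReal hK, ← ENNReal.ofReal_mul hε0.le,
      ENNReal.ofReal_lt_ofReal_iff hr]
    change ε * K < r
    rw [hε, div_mul_eq_mul_div, div_lt_iff₀ (by positivity)]
    nlinarith
  have hmono : mono (fun i => ENNReal.ofReal ε * y₁ i) q = ENNReal.ofReal (ε ^ q.degree) := by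
    rw [mono_mul, mono_const, ENNReal.ofReal_pow hε0.le]
    have : mono y₁ q = 1 := by
      refine Finset.prod_eq_one fun i hi => ?_
      have : i ∈ (q.support : Set Idx) := by exact_mod_cast hi
      simp only [hy₁, Set.indicator_of_mem this, one_pow]
    rw [this, mul_one]
  have hw := weight_pos s k
  refine ⟨(weight s k * ε ^ q.degree)⁻¹, by positivity, fun V B hV hB => ?_⟩
  have h1 := (weight_mul_le_wNorm s _ k).trans (hV _ hlt)
  have h2 : ‖V k q‖ₑ * mono (fun i => ENNReal.ofReal ε * y₁ i) q
      ≤ serV V (fun i => ENNReal.ofReal ε * y₁ i) k :=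
    ENNReal.le_tsum (f := fun q => ‖V k q‖ₑ * mono (fun i => ENNReal.ofReal ε * y₁ i) q) q
  have h3 := (mul_le_mul_right h2 (ENNReal.ofReal (weight s k))).trans h1
  rw [hmono, ← ofReal_norm, ← ENNReal.ofReal_mul (norm_nonneg _), ← ENNReal.ofReal_mul hw.le,
    ENNReal.ofReal_le_ofReal_iff hB] at h3
  rw [inv_mul_eq_div, le_div_iff₀ (by positivity)]
  linarith

/-- `∑_{n ≥ 2} ad_F^{n-1}(G)/n!`. -/
def lieTail (F G : FVF) : FVF := fun k q =>
  ∑' n : ℕ, (((n + 2) ! : ℕ) : ℂ)⁻¹ * ((bracket F)^[n + 1] G) k q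

section lieTail

variable {s R δ A B : ℝ} {F G : FVF}

theorem Bd.lieTail_term (hF : Bd s R F A) (hG : Bd s R G B)
    (hmF : MomV F) (hmG : MomV G) (hA : 0 ≤ A) (hB : 0 ≤ B) (hδ : 0 < δ) (n : ℕ) :
    Bd s (R - δ) (fun k q => (((n + 2) ! : ℕ) : ℂ)⁻¹ * ((ResonantNF.bracket F)^[n + 1] G) k q)
      ((Real.exp 1 * (2 * A) / δ) ^ (n + 1) * B) := by
  refine ((hF.iterate_bracket hG hmF hmG hA hB hδ (n + 1)).const_mul _).of_le ?_
  rw [norm_inv, Complex.norm_natCast, ← mul_assoc, ← mul_assoc]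
  gcongr
  refine mul_le_of_le_one_left (by positivity) ?_
  rw [inv_mul_le_one₀ (by positivity)]
  exact_mod_cast Nat.factorial_le (by omega)

theorem hasSum_lieTail (hF : Bd s R F A) (hG : Bd s R G B)
    (hmF : MomV F) (hmG : MomV G) (hA : 0 ≤ A) (hB : 0 ≤ B) (hδ : 0 < δ) (hδR : δ < R)
    (hθ : Real.exp 1 * (2 * A) / δ ≤ 1 / 2) (k : Idx) (q : MIdx) :
    HasSum (fun n : ℕ => (((n + 2) ! : ℕ) : ℂ)⁻¹ * ((bracket F)^[n + 1] G) k q)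
      (lieTail F G k q) := by
  refine Summable.hasSum ?_
  obtain ⟨c, hc, H⟩ := exists_coeff_bound s (sub_pos.2 hδR) k q
  have h0 : 0 ≤ Real.exp 1 * (2 * A) / δ := by positivity
  refine Summable.of_norm_bounded
    (g := fun n : ℕ => c * ((Real.exp 1 * (2 * A) / δ) ^ (n + 1) * B)) ?_ fun n => ?_
  · refine Summable.mul_left _ (Summable.mul_right _ ?_)
    exact (summable_nat_add_iff 1).2 (summable_geometric_of_lt_one h0 (by linarith))
  · exact H _ _ (hF.lieTail_term hG hmF hmG hA hB hδ n) (by positivity)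

theorem Bd.lieTail (hF : Bd s R F A) (hG : Bd s R G B)
    (hmF : MomV F) (hmG : MomV G) (hA : 0 ≤ A) (hB : 0 ≤ B) (hδ : 0 < δ) (hδR : δ < R)
    (hθ : Real.exp 1 * (2 * A) / δ ≤ 1 / 2) :
    Bd s (R - δ) (lieTail F G) (2 * (Real.exp 1 * (2 * A) / δ) * B) := by
  set θ := Real.exp 1 * (2 * A) / δ with hθdef
  have h0 : 0 ≤ θ := by positivity
  have hsum : HasSum (fun n : ℕ => θ ^ (n + 1) * B) (θ * (1 - θ)⁻¹ * B) := by
    have := ((hasSum_geometric_of_lt_one h0 (by linarith)).mul_left θ).mul_right B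
    refine this.congr_fun ?_
    intro n
    rw [pow_succ]; ring
  refine (Bd.of_hasSum (fun n => hF.lieTail_term hG hmF hmG hA hB hδ n)
    (fun n => by positivity) hsum
    (hasSum_lieTail hF hG hmF hmG hA hB hδ hδR hθ)).of_le ?_
  have h2 : (1 - θ)⁻¹ ≤ 2 := by
    rw [inv_le_comm₀ (by linarith) (by norm_num)]
    linarith
  rw [mul_comm 2 θ]
  gcongr

theorem lieTail_ne_zero {k : Idx} {q : MIdx} (h : lieTail F G k q ≠ 0) :
    ∃ n, ((bracket F)^[n + 1] G) k q ≠ 0 := by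
  by_contra hc
  push Not at hc
  exact h (by simp [lieTail, hc])

theorem MomV.lieTail (hmF : MomV F) (hmG : MomV G) : MomV (lieTail F G) := by
  intro k q hq
  obtain ⟨n, hn⟩ := lieTail_ne_zero hq
  exact momV_iterate_bracket hmF hmG (n + 1) k q hn

theorem OrderGE.lieTail {m : ℕ} (hmF : MomV F) (hmG : MomV G) (hF : OrderGE 0 F)
    (hG : OrderGE m G) : OrderGE m (lieTail F G) := by
  intro k q hq
  obtain ⟨n, hn⟩ := lieTail_ne_zero hq
  have : ∀ n, OrderGE m ((ResonantNF.bracket F)^[n] G) := by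
    intro n
    induction n with
    | zero => exact hG
    | succ n ih =>
      rw [Function.iterate_succ_apply']
      exact (hF.bracket hmF (momV_iterate_bracket hmF hmG n) ih).of_le (by omega)
  exact this _ k q hn

/-- The Lie exponential from the first bracket and the tail. -/
theorem isLieExp_of_tail {W : FVF}
    (h : ∀ k q, HasSum (fun n : ℕ => (((n + 2) ! : ℕ) : ℂ)⁻¹
      * ((bracket F)^[n + 1] (bracket F W)) k q) (lieTail F (bracket F W) k q)) :
    IsLieExp F W (W + bracket F W + lieTail F (bracket F W)) := by
  intro k q
  rw [← hasSum_nat_add_iff' 2]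
  have e : (W + bracket F W + lieTail F (bracket F W)) k q
      - ∑ i ∈ Finset.range 2, ((i ! : ℕ) : ℂ)⁻¹ * ((bracket F)^[i] W) k q
      = lieTail F (bracket F W) k q := by
    simp [Finset.sum_range_succ]
  rw [e]
  refine (h k q).congr_fun fun n => ?_
  rw [Function.iterate_succ_apply]

end lieTail

/-! ### Estimates of one KAM step -/

/-- Here u = r/ρ, Θ = 1 + a + b and κγ = E. One level of the equation costs κ·7uEΘ, since 1 + 6uEa ≤
7uEΘ. The source of the second level is at most 129 rγu²E²Θ²y, with 129 = 3 + 6·21, and the two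
levels add up to 924 = 21 + 7·129. -/
theorem homological_bound_le {r ρ γ E a b y : ℝ} (hρ : 0 < ρ) (hr : 5 * ρ < r) (hγ : 0 < γ)
    (hE : 1 ≤ E) (ha : 0 ≤ a) (hb : 0 ≤ b) (hy : 0 ≤ y) {κ A B B' : ℝ}
    (hκ : κ = γ⁻¹ * E) (hA : A = 3 * r * (γ * y)) (hB : B = 3 * r * (γ * a))
    (hB' : B' = 3 * r * (γ * b)) :
    κ * (A + 2 * (κ * A) * B / ρ) +
        κ * ((A + 2 * (κ * (A + 2 * (κ * A) * B / ρ)) * (B + B') / ρ) + 2 * (κ *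
          (A + 2 * (κ * (A + 2 * (κ * A) * B / ρ)) * (B + B') / ρ)) * B / ρ)
      ≤ 924 * r * ((r / ρ) ^ 3 * E ^ 4 * (1 + a + b) ^ 3 * y) := by
  have hr0 : 0 < r := by linarith
  set u := r / ρ with hu
  have hu1 : 1 ≤ u := by rw [hu, one_le_div hρ]; linarith
  set Θ := 1 + a + b with hΘ
  have hΘ1 : 1 ≤ Θ := by linarith
  have haΘ : a ≤ Θ := by linarith
  have hκγ : κ * γ = E := by rw [hκ]; field_simp
  have hfac : ∀ w : ℝ, 0 ≤ w → κ * (w + 2 * (κ * w) * B / ρ) ≤ κ * w * (7 * (u * E * Θ)) := by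
    intro w hw
    have hκ0 : 0 ≤ κ := by rw [hκ]; positivity
    have e : κ * (w + 2 * (κ * w) * B / ρ) = κ * w * (1 + 6 * (u * (κ * γ) * a)) := by
      rw [hB, hu]; field_simp; ring
    rw [e, hκγ]
    gcongr
    have h1 : u * E * a ≤ u * E * Θ := by gcongr
    have h2 : 1 ≤ u * E * Θ := one_le_mul_of_one_le_of_one_le
        (one_le_mul_of_one_le_of_one_le hu1 hE) hΘ1
    linarith
  have hA0 : 0 ≤ A := by rw [hA]; positivity
  have hB0 : 0 ≤ B := by rw [hB]; positivity
  have hB'0 : 0 ≤ B' := by rw [hB']; positivity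
  have hκ0 : 0 ≤ κ := by rw [hκ]; positivity
  have h0 := hfac A hA0
  set f₀ := κ * (A + 2 * (κ * A) * B / ρ) with hf₀
  have hf₀0 : 0 ≤ f₀ := by positivity
  have hκA : κ * A = 3 * r * E * y := by rw [hA, ← hκγ]; ring
  have hf0' : f₀ ≤ 21 * r * (u * E ^ 2 * Θ * y) := by
    refine h0.trans (le_of_eq ?_)
    rw [hκA]; ring
  have hw : A + 2 * f₀ * (B + B') / ρ ≤ 129 * r * γ * (u ^ 2 * E ^ 2 * Θ ^ 2 * y) := by
    have e : 2 * f₀ * (B + B') / ρ = 6 * f₀ * u * γ * (a + b) := by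
      rw [hB, hB', hu]; field_simp; ring
    have h1 : 6 * f₀ * u * γ * (a + b) ≤ 6 * (21 * r * (u * E ^ 2 * Θ * y)) * u * γ * Θ := by
      gcongr
      linarith
    have h2 : (1 : ℝ) ≤ u ^ 2 * E ^ 2 * Θ ^ 2 :=
      one_le_mul_of_one_le_of_one_le (one_le_mul_of_one_le_of_one_le (one_le_pow₀ hu1)
        (one_le_pow₀ hE)) (one_le_pow₀ hΘ1)
    have h3 : A ≤ 3 * r * γ * y * (u ^ 2 * E ^ 2 * Θ ^ 2) := by
      rw [hA]
      calc 3 * r * (γ * y) = 3 * r * γ * y * 1 := by ring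
        _ ≤ _ := by gcongr
    rw [e]
    linarith
  have h1 := hfac (A + 2 * f₀ * (B + B') / ρ) (by positivity)
  have h2 : κ * (A + 2 * f₀ * (B + B') / ρ) * (7 * (u * E * Θ))
      ≤ κ * (129 * r * γ * (u ^ 2 * E ^ 2 * Θ ^ 2 * y)) * (7 * (u * E * Θ)) := by gcongr
  have h3 : κ * (129 * r * γ * (u ^ 2 * E ^ 2 * Θ ^ 2 * y)) * (7 * (u * E * Θ))
      = 903 * r * (u ^ 3 * E ^ 4 * Θ ^ 3 * y) := by
    calc _ = (κ * γ) * (129 * r * (u ^ 2 * E ^ 2 * Θ ^ 2 * y)) * (7 * (u * E * Θ)) := by ring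
      _ = _ := by rw [hκγ]; ring
  have h4 : u * E ^ 2 * Θ * y ≤ u ^ 3 * E ^ 4 * Θ ^ 3 * y := by
    gcongr
    · exact le_self_pow₀ hu1 (by norm_num)
    · norm_num
    · exact le_self_pow₀ hΘ1 (by norm_num)
  have h5 : 21 * r * (u * E ^ 2 * Θ * y) ≤ 21 * r * (u ^ 3 * E ^ 4 * Θ ^ 3 * y) := by gcongr
  linarith

/-- With w = (r/ρ)w₀, the tail is at most a multiple of w times g, and g is of size rγ(y + w(a+b)).
As w is itself proportional to y in the application, both terms of the first bound are quadratic in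
y. -/
theorem lieTail_bound_le {r ρ γ a b y f w₀ : ℝ} (hρ : 0 < ρ) (hr : 5 * ρ < r) (hγ : 0 < γ)
    (ha : 0 ≤ a) (hb : 0 ≤ b) (hy : 0 ≤ y) (hf0 : 0 ≤ f) (hf : f ≤ 924 * r * w₀)
    (hw₀ : r / ρ * w₀ ≤ 1 / 100000) {A B B' g : ℝ}
    (hA : A = 3 * r * (γ * y)) (hB : B = 3 * r * (γ * a)) (hB' : B' = 3 * r * (γ * b))
    (hg : g = A + 2 * f * (B + B') / ρ + 2 * f * A / ρ) :
    2 * f * A / ρ + 2 * (Real.exp 1 * (2 * f) / (ρ / 2)) * g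
      ≤ 130000000 * r * γ * (r / ρ * w₀ * y + (r / ρ * w₀) ^ 2 * (a + b)) ∧
    2 * f * (B + B') / ρ ≤ 5544 * r * γ * (r / ρ * w₀) * (a + b) := by
  have hr0 : 0 < r := by linarith
  have hw₀0 : 0 ≤ w₀ := by
    by_contra hc
    push Not at hc
    have : 924 * r * w₀ < 0 := by nlinarith
    linarith
  set w := r / ρ * w₀ with hw
  have hw0 : 0 ≤ w := by positivity
  have e1 : 2 * f * A / ρ ≤ 5544 * r * γ * w * y := by
    have : 2 * f * A / ρ = 6 * f * (r / ρ) * γ * y := by rw [hA]; ring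
    rw [this]
    calc _ ≤ 6 * (924 * r * w₀) * (r / ρ) * γ * y := by gcongr
      _ = _ := by rw [hw]; ring
  have e2 : 2 * f * (B + B') / ρ ≤ 5544 * r * γ * w * (a + b) := by
    have : 2 * f * (B + B') / ρ = 6 * f * (r / ρ) * γ * (a + b) := by rw [hB, hB']; ring
    rw [this]
    calc _ ≤ 6 * (924 * r * w₀) * (r / ρ) * γ * (a + b) := by gcongr
      _ = _ := by rw [hw]; ring
  refine ⟨?_, e2⟩
  have hexp : Real.exp 1 ≤ 3 := by linarith [Real.exp_one_lt_d9]
  have e3 : 2 * (Real.exp 1 * (2 * f) / (ρ / 2)) ≤ 22176 * w := by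
    have : 2 * (Real.exp 1 * (2 * f) / (ρ / 2)) = 8 * Real.exp 1 * f / ρ := by field_simp; ring
    rw [this]
    calc _ ≤ 8 * 3 * (924 * r * w₀) / ρ := by gcongr
      _ = _ := by rw [hw]; ring
  have e4 : g ≤ r * γ * (5547 * y + 5544 * (w * (a + b))) := by
    have : 5544 * r * γ * w * y ≤ 5544 * r * γ * 1 * y := by gcongr; linarith
    rw [hg]
    nlinarith [hA]
  have hg0 : 0 ≤ g := by
    have : 0 ≤ A := by rw [hA]; positivity
    have : 0 ≤ B := by rw [hB]; positivity
    have : 0 ≤ B' := by rw [hB']; positivity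
    rw [hg]; positivity
  calc _ ≤ 5544 * r * γ * w * y + 22176 * w * (r * γ * (5547 * y + 5544 * (w * (a + b)))) := by
        gcongr
    _ = r * γ * (123015816 * (w * y) + 122943744 * (w ^ 2 * (a + b))) := by ring
    _ ≤ r * γ * (130000000 * (w * y) + 130000000 * (w ^ 2 * (a + b))) := by
        gcongr <;> norm_num
    _ = _ := by ring

/-! ### Split norms and the formal KAM step. -/

theorem proj_add (J : Set MIdx) (V V' : FVF) : proj J (V + V') = proj J V + proj J V' := by
  funext k q
  by_cases hq : q ∈ J
  · simp [proj, hq]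
  · simp [proj, hq]

theorem proj_compl_add_proj (J : Set MIdx) (V : FVF) : proj Jᶜ V + proj J V = V := by
  funext k q
  by_cases hq : q ∈ J
  · simp [proj, hq]
  · simp [proj, hq]

theorem J0_union (lam : Idx → ℂ) : J0 lam ∪ (J1 lam \ J2 lam) = (J2 lam)ᶜ := by
  ext q
  have := @J2_subset_J1 lam q
  simp only [J0, Set.mem_union, Set.mem_compl_iff, Set.mem_sdiff]
  tauto

theorem MemV.proj {s r : ℝ} {V : FVF} (h : MemV s r V) (hr : 0 < r) (J : Set MIdx) :
    MemV s r (ResonantNF.proj J V) := by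
  refine (h.momV.proj J).memV (fun k => ?_) hr ((h.bd hr).proj J)
  by_contra hne
  exact (proj_ne_zero hne).2 (h.1 k)

/-- The norm of a vector field is at most three times its split norm. -/
theorem MemV.bd_bnorm {s r : ℝ} {V : FVF} (hr : 0 < r) (h : MemV s r V) (lam : Idx → ℂ) :
    Bd s r V (3 * r * bnorm lam s r V) := by
  have e : V = ResonantNF.proj (J0 lam) V + (ResonantNF.proj (J1 lam \ J2 lam) V +
      ResonantNF.proj (J2 lam) V) := by
    funext k q
    have := @J2_subset_J1 lam q
    by_cases h1 : q ∈ J1 lam <;> by_cases h2 : q ∈ J2 lam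
    · simp [ResonantNF.proj, J0, h1, h2]
    · simp [ResonantNF.proj, J0, h1, h2]
    · exact absurd (this h2) h1
    · simp [ResonantNF.proj, J0, h1, h2]
  have key : ∀ J, Bd s r (ResonantNF.proj J V) (r * vnorm s r (ResonantNF.proj J V)) := fun J =>
    (h.proj hr J).bd hr
  have hn : ∀ J, 0 ≤ r * vnorm s r (ResonantNF.proj J V) :=
    fun J => mul_nonneg hr.le (vnorm_nonneg _ _ _)
  have h1 := (key (J0 lam)).add ((key (J1 lam \ J2 lam)).add (key (J2 lam)) (hn _) (hn _)) (hn _)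
    (add_nonneg (hn _) (hn _))
  rw [← e] at h1
  refine h1.of_le ?_
  have b0 : vnorm s r (ResonantNF.proj (J0 lam) V) ≤ bnorm lam s r V :=
    (le_max_left _ _).trans (le_max_left _ _)
  have b1 : vnorm s r (ResonantNF.proj (J1 lam \ J2 lam) V) ≤ bnorm lam s r V :=
    (le_max_right _ _).trans (le_max_left _ _)
  have b2 : vnorm s r (ResonantNF.proj (J2 lam) V) ≤ bnorm lam s r V := le_max_right _ _
  nlinarith

/-- A bound on a larger ball gives a bound for the norm on a smaller one. -/
theorem bnorm_le_of_bd_of_lt {lam : Idx → ℂ} {s R R' r B : ℝ} {V : FVF} (h : Bd s R V B)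
    (h0 : ∀ k, V k 0 = 0) (hR' : 0 < R') (hRR : R' ≤ R) (hr : 0 < r) (hrR : r / 10 ≤ R)
    (hB : 0 ≤ B) : bnorm lam s R' V ≤ 10 * B / r := by
  have hR : 0 < R := hR'.trans_le hRR
  refine (bnorm_le_of_bd hR' (by positivity) (h.scale h0 hR' hRR)).trans ?_
  have : R' / R * B / R' = B / R := by field_simp
  rw [this, div_le_div_iff₀ hR hr]
  nlinarith

set_option maxHeartbeats 1000000 in
/-- The formal part of the KAM step. -/
theorem StepData.formal_step {lam : Idx → ℂ} {m : ℕ} {Z X N : FVF}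
    (h : StepData lam m Z X N) {s r ρ σ γ E c a b y : ℝ} (hρ : 0 < ρ) (hr : 5 * ρ < r)
    (hσ : 0 < σ) (hγ : 0 < γ) (hc : 0 < c) (hE : E = Real.exp (c / (σ / 2) ^ 6))
    (ha : 0 ≤ a) (hb : 0 ≤ b) (hy : 0 ≤ y)
    (hX : Bd s r X (3 * r * (γ * y))) (hZ : Bd s r Z (3 * r * (γ * a)))
    (hN : Bd s r N (3 * r * (γ * b)))
    (hsmall : ∀ σ : ℝ, 0 < σ → ∀ (k : Idx) (q : MIdx), 2 ≤ q.degree →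
      momN q = mom k → freqZ lam (shift q k) ≠ 0 →
      ‖freqZ lam (shift q k)‖⁻¹
        ≤ γ⁻¹ * Real.exp (c / σ ^ 6) * Real.exp (σ * (sqrtSum q - √(bra k))))
    (hle : (r / ρ) ^ 4 * E ^ 4 * (1 + a + b) ^ 3 * y ≤ 1 / 100000) :
    ∃ (F Xp Np : FVF) (f : ℝ), 0 ≤ f ∧
      f ≤ 924 * r * ((r / ρ) ^ 3 * E ^ 4 * (1 + a + b) ^ 3 * y) ∧
      f ≤ ρ / (8 * Real.exp 1) ∧
      Bd (s + 2 * σ) (r - 3 * ρ) F f ∧ MomV F ∧ OrderGE m F ∧ SuppIn (J2 lam)ᶜ F ∧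
      MemV (s + 2 * σ) (r - 5 * ρ) Xp ∧ OrderGE m Xp ∧ SuppIn (J2 lam)ᶜ Xp ∧
      MemV (s + 2 * σ) (r - 5 * ρ) Np ∧ OrderGE m Np ∧ SuppIn (J2 lam) Np ∧
      (∀ G, G = bracket F (diagField lam + Z + X + N) → MomV G ∧ (∀ k, G k 0 = 0) ∧
        ∃ g, 0 ≤ g ∧ Bd (s + 2 * σ) (r - 4 * ρ) G g) ∧
      IsLieExp F (diagField lam + Z + X + N) (diagField lam + Z + Xp + Np) ∧
      bnorm lam (s + 2 * σ) (r - 5 * ρ) Xp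
        ≤ 1300000000 * γ * ((r / ρ) ^ 4 * E ^ 4 * (1 + a + b) ^ 3 * y * y +
            ((r / ρ) ^ 4 * E ^ 4 * (1 + a + b) ^ 3 * y) ^ 2 * (a + b)) ∧
      bnorm lam (s + 2 * σ) (r - 5 * ρ) (N - Np)
        ≤ 1300000000 * γ * ((r / ρ) ^ 4 * E ^ 4 * (1 + a + b) ^ 3 * y * y +
            ((r / ρ) ^ 4 * E ^ 4 * (1 + a + b) ^ 3 * y) ^ 2 * (a + b)) +
          55440 * γ * ((r / ρ) ^ 4 * E ^ 4 * (1 + a + b) ^ 3 * y) * (a + b) := by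
  have hr0 : 0 < r := by linarith
  have hm1 : 1 ≤ m := one_le_of_sInf_le h.gens h.deg
  have hE1 : 1 ≤ E := by rw [hE]; exact Real.one_le_exp (by positivity)
  set A := 3 * r * (γ * y) with hA
  set B := 3 * r * (γ * a) with hB
  set B' := 3 * r * (γ * b) with hB'
  have hA0 : 0 ≤ A := by positivity
  have hB0 : 0 ≤ B := by positivity
  have hB'0 : 0 ≤ B' := by positivity
  have hκ0 : 0 ≤ γ⁻¹ * E := by positivity
  -- The solution divides by small divisors four times, twice on each level. Giving each division
  -- σ/2 makes the total loss 2σ; the three brackets cost 3ρ.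
  obtain ⟨F, hmF, hoF, hsF, hbF, hF⟩ := h.exists_homological hX hZ hN hA0 hB0 hB'0 hκ0
    (half_pos hσ).le hρ (fun k q h2 hm hf =>
      hE ▸ hsmall (σ / 2) (half_pos hσ) k q h2 hm hf)
  have e4 : s + 4 * (σ / 2) = s + 2 * σ := by ring
  rw [e4] at hbF
  have hfle := homological_bound_le hρ hr hγ hE1 ha hb hy rfl hA hB hB'
  set f := γ⁻¹ * E * (A + 2 * (γ⁻¹ * E * A) * B / ρ) +
        γ⁻¹ * E * ((A + 2 * (γ⁻¹ * E * (A + 2 * (γ⁻¹ * E * A) * B / ρ)) * (B + B') / ρ) + 2 *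
            (γ⁻¹ * E *
          (A + 2 * (γ⁻¹ * E * (A + 2 * (γ⁻¹ * E * A) * B / ρ)) * (B + B') / ρ)) * B / ρ) with hf
  have hf0 : 0 ≤ f := by positivity
  clear_value f
  set w₀ := (r / ρ) ^ 3 * E ^ 4 * (1 + a + b) ^ 3 * y with hw₀
  have hw : r / ρ * w₀ = (r / ρ) ^ 4 * E ^ 4 * (1 + a + b) ^ 3 * y := by rw [hw₀]; ring
  rw [← hw] at hle ⊢
  have hexp : Real.exp 1 ≤ 3 := by linarith [Real.exp_one_lt_d9]
  have hfρ : f ≤ ρ / (8 * Real.exp 1) := by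
    rw [le_div_iff₀ (by positivity)]
    have h1 : f ≤ 924 * (ρ * (r / ρ * w₀)) := by
      refine hfle.trans (le_of_eq ?_)
      field_simp
    have h2 : f ≤ 924 * (ρ * (1 / 100000)) := h1.trans (by gcongr)
    nlinarith
  have hmZN : MomV (Z + N) := h.pmZ.add h.pmN
  have hoZN : OrderGE 1 (Z + N) := h.ordZ.add h.ordN1
  -- the first bracket
  have hG := bracket_total h hmF hsF hF
  set W := diagField lam + Z + X + N with hW
  set G := bracket F W with hGdef
  have hbX : Bd (s + 2 * σ) (r - 3 * ρ) X A :=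
    (hX.of_le_exponent (by linarith) h.pmX h.ordX.apply_zero).of_radius_le (by linarith)
  have hbZN : Bd (s + 2 * σ) (r - 3 * ρ) (Z + N) (B + B') :=
    ((hZ.add hN hB0 hB'0).of_le_exponent (by linarith) hmZN hoZN.apply_zero).of_radius_le
      (by linarith)
  have e5 : r - 3 * ρ - ρ = r - 4 * ρ := by ring
  have hbFX := hbF.bracket hbX hmF h.pmX hf0 hA0 hρ
  have hbFZN := hbF.bracket hbZN hmF hmZN hf0 (by positivity) hρ
  rw [e5] at hbFX hbFZN
  have hmFX := hmF.bracket h.pmX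
  have hmFZN := hmF.bracket hmZN
  have hoFX : OrderGE m (bracket F X) := (hoF.bracket hmF h.pmX h.ordX).of_le (by omega)
  have hoFZN : OrderGE m (bracket F (Z + N)) := (hoF.bracket hmF hmZN hoZN).of_le (by omega)
  have hmG : MomV G := by
    rw [hG]; exact (h.pmX.neg.add (hmFZN.proj _)).add hmFX
  have hoG : OrderGE m G := by
    rw [hG]; exact (h.ordX.neg.add (hoFZN.proj _)).add hoFX
  set g := A + 2 * f * (B + B') / ρ + 2 * f * A / ρ with hg
  have hg0 : 0 ≤ g := by positivity
  have hbG : Bd (s + 2 * σ) (r - 4 * ρ) G g := by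
    rw [hG]
    exact (((hbX.of_radius_le (by linarith)).neg.add (hbFZN.proj _) hA0 (by positivity)).add hbFX
      (by positivity) (by positivity))
  -- the tail
  have hθ : Real.exp 1 * (2 * f) / (ρ / 2) ≤ 1 / 2 := by
    rw [div_le_iff₀ (by positivity)]
    rw [le_div_iff₀ (by positivity)] at hfρ
    linarith
  have hbF4 : Bd (s + 2 * σ) (r - 4 * ρ) F f := hbF.of_radius_le (by linarith)
  have hρ2 : ρ / 2 < r - 4 * ρ := by linarith
  -- The tail uses only ρ/2 of the remaining ρ. The radius r - 9ρ/2 is at least r/10, whereas r - 5ρ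
  -- may be arbitrarily small compared with r; the normalised norm is increasing in the radius, so
  -- the bound carries over to r - 5ρ without a bad factor.
  have hbT := hbF4.lieTail hbG hmF hmG hf0 hg0 (half_pos hρ) hρ2 hθ
  have hmT : MomV (lieTail F G) := MomV.lieTail hmF hmG
  have hoT : OrderGE m (lieTail F G) := OrderGE.lieTail hmF hmG (hoF.of_le (by omega)) hoG
  have hsum := hasSum_lieTail hbF4 hbG hmF hmG hf0 hg0 (half_pos hρ) hρ2 hθ
  set R := lieTail F G with hR
  have hbS : Bd (s + 2 * σ) (r - 4 * ρ - ρ / 2) (bracket F X + R)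
      (2 * f * A / ρ + 2 * (Real.exp 1 * (2 * f) / (ρ / 2)) * g) :=
    (hbFX.of_radius_le (by linarith)).add hbT (by positivity) (by positivity)
  obtain ⟨n1, n2⟩ := lieTail_bound_le hρ hr hγ ha hb hy hf0 hfle hle hA hB hB' hg
  set S := 2 * f * A / ρ + 2 * (Real.exp 1 * (2 * f) / (ρ / 2)) * g with hS
  have hS0 : 0 ≤ S := by positivity
  have hr5 : 0 < r - 5 * ρ := by linarith
  have hmS : MomV (bracket F X + R) := hmFX.add hmT
  have hoS : OrderGE m (bracket F X + R) := hoFX.add hoT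
  have hbXp : Bd (s + 2 * σ) (r - 4 * ρ - ρ / 2) (proj (J2 lam)ᶜ (bracket F X + R)) S :=
    hbS.proj _
  set Np' := proj (J2 lam) (bracket F (Z + N) + (bracket F X + R)) with hNp'
  have hbNp' : Bd (s + 2 * σ) (r - 4 * ρ - ρ / 2) Np' (2 * f * (B + B') / ρ + S) :=
    ((hbFZN.of_radius_le (by linarith)).add hbS (by positivity) hS0).proj _
  have hmNp' : MomV Np' := (hmFZN.add hmS).proj _
  have hoNp' : OrderGE m Np' := (hoFZN.add hoS).proj _
  -- After X has cancelled, the remainder [F,X] plus the tail is split by exponents: the part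
  -- outside `J2` is X_+, and the `J2` part, with that of [F,Z+N], is added to N.
  refine ⟨F, proj (J2 lam)ᶜ (bracket F X + R), N + Np', f, hf0, hfle, hfρ, hbF, hmF, hoF, hsF,
    (hmS.proj _).memV (hoS.proj _).apply_zero hr5 (hbXp.of_radius_le (by linarith)),
    hoS.proj _, suppIn_proj _ _, ?_, h.ordN.add hoNp', h.suppN.add (suppIn_proj _ _), ?_, ?_, ?_,
        ?_⟩
  · refine (h.pmN.add hmNp').memV (h.ordN.add hoNp').apply_zero hr5
      (B := B' + (2 * f * (B + B') / ρ + S)) ?_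
    exact ((hN.of_le_exponent (by linarith) h.pmN h.ordN.apply_zero).of_radius_le
      (by linarith)).add (hbNp'.of_radius_le (by linarith)) hB'0 (by positivity)
  · rintro G' rfl
    exact ⟨hmG, hoG.apply_zero, g, hg0, hbG⟩
  · have hexp := isLieExp_of_tail (F := F) (W := W) hsum
    convert! hexp using 1
    rw [← hGdef, ← hR]
    have e6 : W + G + R = diagField lam + Z + N + (proj (J2 lam) (bracket F (Z + N)) +
        (bracket F X + R)) := by
      rw [hG, hW]; abel
    have e7 := proj_compl_add_proj (J2 lam) (bracket F X + R)
    rw [e6, hNp', proj_add (J2 lam) (bracket F (Z + N)) (bracket F X + R)]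
    generalize proj (J2 lam)ᶜ (bracket F X + R) = U at e7 ⊢
    generalize proj (J2 lam) (bracket F X + R) = U' at e7 ⊢
    rw [← e7]
    abel
  · refine (bnorm_le_of_bd_of_lt hbXp (hoS.proj _).apply_zero hr5 (by linarith) hr0 (by linarith)
      hS0).trans ?_
    rw [div_le_iff₀ hr0]
    linarith
  · have e8 : N - (N + Np') = -Np' := by abel
    rw [e8]
    refine (bnorm_le_of_bd_of_lt hbNp'.neg hoNp'.neg.apply_zero hr5 (by linarith) hr0
      (by linarith) (by positivity)).trans ?_
    rw [div_le_iff₀ hr0]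
    linarith

/-! ### Evaluation of power series -/

/-- The value of the power series `f` at `x`. -/
def ev (f : MIdx → ℂ) (x : Idx → ℂ) : ℂ := ∑' q, f q * mono x q

theorem tsum_enorm_mul_mono (f : MIdx → ℂ) (x : Idx → ℂ) :
    ∑' q, ‖f q * mono x q‖ₑ = ser f (fun i => ‖x i‖ₑ) := by
  simp only [enorm_mul, enorm_mono, ser]

theorem summable_norm_of_ser {f : MIdx → ℂ} {x : Idx → ℂ} (h : ser f (fun i => ‖x i‖ₑ) ≠ ⊤) :
    Summable fun q => ‖f q * mono x q‖ :=
  tsum_enorm_ne_top_iff_summable_norm.1 (by rwa [tsum_enorm_mul_mono])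

theorem hasSum_ev {f : MIdx → ℂ} {x : Idx → ℂ} (h : ser f (fun i => ‖x i‖ₑ) ≠ ⊤) :
    HasSum (fun q => f q * mono x q) (ev f x) :=
  (summable_norm_of_ser h).of_norm.hasSum

theorem enorm_ev_le (f : MIdx → ℂ) (x : Idx → ℂ) : ‖ev f x‖ₑ ≤ ser f (fun i => ‖x i‖ₑ) := by
  rw [← tsum_enorm_mul_mono]
  exact enorm_tsum_le_tsum_enorm

theorem ev_const_mul (c : ℂ) (f : MIdx → ℂ) (x : Idx → ℂ) :
    ev (fun q => c * f q) x = c * ev f x := by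
  rw [ev, ev, ← tsum_mul_left]
  exact tsum_congr fun q => by ring

theorem ser_const_mul (c : ℂ) (f : MIdx → ℂ) (y : Idx → ℝ≥0∞) :
    ser (fun q => c * f q) y = ‖c‖ₑ * ser f y := by
  rw [ser, ser, ← ENNReal.tsum_mul_left]
  exact tsum_congr fun q => by rw [enorm_mul, mul_assoc]

/-- Evaluation commutes with absolutely convergent series of power series. -/
theorem hasSum_ev_of_hasSum {ι : Type*} {f : ι → MIdx → ℂ} {g : MIdx → ℂ} {x : Idx → ℂ}
    (h : ∑' n, ser (f n) (fun i => ‖x i‖ₑ) ≠ ⊤) (hg : ∀ q, HasSum (fun n => f n q) (g q)) :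
    HasSum (fun n => ev (f n) x) (ev g x) := by
  have hs : Summable (Function.uncurry fun n q => f n q * mono x q) := by
    refine Summable.of_enorm ?_
    rw [ENNReal.tsum_prod']
    simpa only [Function.uncurry, tsum_enorm_mul_mono] using h
  have h1 : Summable fun n => ev (f n) x := hs.prod
  have h2 : ∑' n, ev (f n) x = ev g x := by
    unfold ev
    rw [← hs.tsum_comm]
    refine tsum_congr fun q => ?_
    rw [tsum_mul_right, (hg q).tsum_eq]
  exact h2 ▸ h1.hasSum

/-! ### Elements of `g_s` -/

theorem memGSub_of_wNorm {s : ℝ} {v : Idx → ℂ} (h : wNorm s (fun k => ‖v k‖ₑ) ≠ ⊤) :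
    v ∈ gSub s := by
  change Memℓp (fun k => (weight s k : ℂ) * v k) 2
  refine memℓp_gen ?_
  have h1 : ∑' k, (ENNReal.ofReal (weight s k) * ‖v k‖ₑ) ^ 2 ≠ ⊤ := by
    intro hc
    rw [wNorm, hc] at h
    exact h (ENNReal.top_rpow_of_pos (by norm_num))
  have h2 : ∀ k, (ENNReal.ofReal (weight s k) * ‖v k‖ₑ) ^ 2
      = ENNReal.ofReal (‖(weight s k : ℂ) * v k‖ ^ 2) := by
    intro k
    rw [ENNReal.ofReal_pow (norm_nonneg _), norm_mul, ENNReal.ofReal_mul (norm_nonneg _),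
      Complex.norm_real, Real.norm_of_nonneg (weight_pos s k).le, ofReal_norm]
  simp only [h2] at h1
  have h3 := ENNReal.summable_toReal h1
  refine h3.congr fun k => ?_
  rw [ENNReal.toReal_ofReal (by positivity)]
  norm_num

open Classical in
/-- The element of `g_s` with given coordinates, if they have finite norm. -/
def toG (s : ℝ) (v : Idx → ℂ) : G s :=
  if h : wNorm s (fun k => ‖v k‖ₑ) ≠ ⊤ then (show G s from ⟨v, memGSub_of_wNorm h⟩) else 0

theorem toG_apply {s : ℝ} {v : Idx → ℂ} (h : wNorm s (fun k => ‖v k‖ₑ) ≠ ⊤) (k : Idx) :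
    toG s v k = v k := by
  rw [toG, dif_pos h]

theorem G.ext {s : ℝ} {x y : G s} (h : ∀ k, x k = y k) : x = y := Subtype.ext (funext h)

theorem norm_le_of_wNorm_le {s B : ℝ} {x : G s} (hB : 0 ≤ B)
    (h : wNorm s (fun k => ‖x k‖ₑ) ≤ ENNReal.ofReal B) : ‖x‖ ≤ B := by
  rwa [wNorm_eq_norm, ENNReal.ofReal_le_ofReal_iff hB] at h

theorem norm_toG_le {s B : ℝ} {v : Idx → ℂ} (hB : 0 ≤ B)
    (h : wNorm s (fun k => ‖v k‖ₑ) ≤ ENNReal.ofReal B) : ‖toG s v‖ ≤ B := by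
  have hne : wNorm s (fun k => ‖v k‖ₑ) ≠ ⊤ := (h.trans_lt ENNReal.ofReal_lt_top).ne
  refine norm_le_of_wNorm_le hB ?_
  simpa only [toG_apply hne] using h

theorem isometry_toEll (s : ℝ) : Isometry (toEll s) :=
  AddMonoidHomClass.isometry_of_norm (toEll s) fun _ => rfl

theorem toEll_surjective (s : ℝ) : Function.Surjective (toEll s) := by
  intro v
  have e : (fun k => (weight s k : ℂ) * ((weight s k : ℂ)⁻¹ * (v : Idx → ℂ) k)) = v := by
    funext k
    have : (weight s k : ℂ) ≠ 0 := by exact_mod_cast (weight_pos s k).ne'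
    field_simp
  refine ⟨⟨fun k => (weight s k : ℂ)⁻¹ * (v : Idx → ℂ) k, ?_⟩, ?_⟩
  · change Memℓp _ 2
    rw [e]
    exact lp.memℓp v
  · ext k
    exact congrFun e k

instance (s : ℝ) : CompleteSpace (G s) :=
  ((isometry_toEll s).isUniformInducing.completeSpace_congr (toEll_surjective s)).2 inferInstance

/-- The coordinate functionals of `g_s`. -/
def coordG (s : ℝ) (k : Idx) : G s →L[ℂ] ℂ :=
  LinearMap.mkContinuous
    { toFun := fun x => x k
      map_add' := fun _ _ => rfl
      map_smul' := fun _ _ => rfl } (weight s k)⁻¹ (by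
    intro x
    have h := weight_mul_le_wNorm s (fun k => ‖x k‖ₑ) k
    rw [wNorm_eq_norm, ← ofReal_norm, ← ENNReal.ofReal_mul (weight_pos s k).le,
      ENNReal.ofReal_le_ofReal_iff (norm_nonneg x)] at h
    change ‖x k‖ ≤ _
    rw [inv_mul_eq_div, le_div_iff₀ (weight_pos s k)]
    linarith)

theorem G.add_apply {s : ℝ} (x y : G s) (k : Idx) : (x + y) k = x k + y k := rfl

theorem G.sub_apply {s : ℝ} (x y : G s) (k : Idx) : (x - y) k = x k - y k := rfl

theorem G.smul_apply {s : ℝ} (c : ℂ) (x : G s) (k : Idx) : (c • x) k = c * x k := rfl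

theorem G.hasSum_of_coord {s : ℝ} {ι : Type*} {f : ι → G s} {a : G s} (hf : Summable f)
    (h : ∀ k, HasSum (fun n => f n k) (a k)) : HasSum f a := by
  obtain ⟨b, hb⟩ := hf
  have : b = a := G.ext fun k => (((coordG s k).hasSum hb).unique (h k))
  exact this ▸ hb

/-- The map of `g_s` defined by a vector field. -/
def EV (s : ℝ) (V : FVF) (x : G s) : G s := toG s (evalVF V x)

theorem wNorm_lt_of_norm_lt {s r : ℝ} {x : G s} (h : ‖x‖ < r) :
    wNorm s (fun k => ‖x k‖ₑ) < ENNReal.ofReal r := by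
  rw [wNorm_eq_norm]
  exact (ENNReal.ofReal_lt_ofReal_iff_of_nonneg (norm_nonneg _)).2 h

theorem norm_lt_of_wNorm_lt {s r : ℝ} {x : G s}
    (h : wNorm s (fun k => ‖x k‖ₑ) < ENNReal.ofReal r) : ‖x‖ < r := by
  rw [wNorm_eq_norm] at h
  exact (ENNReal.ofReal_lt_ofReal_iff_of_nonneg (norm_nonneg _)).1 h

section Bd

variable {s r B : ℝ} {V : FVF}

theorem Bd.wNorm_evalVF_le (h : Bd s r V B) {x : Idx → ℂ}
    (hx : wNorm s (fun k => ‖x k‖ₑ) < ENNReal.ofReal r) :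
    wNorm s (fun k => ‖evalVF V x k‖ₑ) ≤ ENNReal.ofReal B :=
  (wNorm_mono fun k => enorm_ev_le (V k) x).trans (h _ hx)

theorem Bd.EV_apply (h : Bd s r V B) {x : G s} (hx : ‖x‖ < r) (k : Idx) :
    EV s V x k = ev (V k) x :=
  toG_apply ((h.wNorm_evalVF_le (wNorm_lt_of_norm_lt hx)).trans_lt ENNReal.ofReal_lt_top).ne k

theorem Bd.norm_EV_le (h : Bd s r V B) (hB : 0 ≤ B) {x : G s} (hx : ‖x‖ < r) :
    ‖EV s V x‖ ≤ B :=
  norm_toG_le hB (h.wNorm_evalVF_le (wNorm_lt_of_norm_lt hx))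

theorem Bd.ser_ne_top (h : Bd s r V B) {y : Idx → ℝ≥0∞} (hy : wNorm s y < ENNReal.ofReal r)
    (k : Idx) : ser (V k) y ≠ ⊤ :=
  apply_ne_top_of_wNorm_ne_top ((h y hy).trans_lt ENNReal.ofReal_lt_top).ne k

end Bd

theorem SBd.ser_ne_top {s r M : ℝ} {f : MIdx → ℂ} (h : SBd s r f M) {y : Idx → ℝ≥0∞}
    (hy : wNorm s y < ENNReal.ofReal r) : ser f y ≠ ⊤ :=
  ((h y hy).trans_lt ENNReal.ofReal_lt_top).ne

/-! ### Recentering -/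

/-- The Taylor coefficients at `x₀` of the power series `f`. -/
def recentre (f : MIdx → ℂ) (x₀ : Idx → ℂ) (p : MIdx) : ℂ :=
  ∑' q, f q * MvPolynomial.coeff p (mono (fun i => MvPolynomial.C (x₀ i) + MvPolynomial.X i) q)

theorem ser_coeff_mul_le (P Q : MvPolynomial Idx ℂ) (y : Idx → ℝ≥0∞) :
    ser (fun p => MvPolynomial.coeff p (P * Q)) y
      ≤ ser (fun p => MvPolynomial.coeff p P) y * ser (fun p => MvPolynomial.coeff p Q) y := by
  classical
  unfold ser
  rw [tsum_mul_tsum_antidiagonal]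
  refine ENNReal.tsum_le_tsum fun q => ?_
  beta_reduce
  rw [MvPolynomial.coeff_mul]
  refine (mul_le_mul_left (enorm_sum_le _ _) _).trans ?_
  rw [Finset.sum_mul]
  refine Finset.sum_le_sum fun p hp => ?_
  rw [mem_adiag] at hp
  rw [← hp, mono_add, enorm_mul]
  apply le_of_eq
  ring

theorem ser_coeff_mono_le (x₀ : Idx → ℂ) (y : Idx → ℝ≥0∞) (q : MIdx) :
    ser (fun p => MvPolynomial.coeff p
      (mono (fun i => MvPolynomial.C (x₀ i) + MvPolynomial.X i) q)) y
      ≤ mono ((fun i => ‖x₀ i‖ₑ) + y) q := by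
  classical
  induction q using midx_induction with
  | h0 =>
    rw [mono_zero, mono_zero, ser, tsum_eq_single 0]
    · simp
    · intro p hp
      rw [MvPolynomial.coeff_one, if_neg (Ne.symm hp)]
      simp
  | h1 q i ih =>
    rw [mono_add, mono_add, mono_single, mono_single, pow_one, pow_one]
    refine (ser_coeff_mul_le _ _ _).trans (mul_le_mul' ih ?_)
    have e : (fun p => MvPolynomial.coeff p (MvPolynomial.C (x₀ i) + MvPolynomial.X i))
        = (fun p => if 0 = p then x₀ i else 0) + fun p => if Finsupp.single i 1 = p then (1 : ℂ)
            else 0 := by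
      funext p
      simp [MvPolynomial.coeff_C, MvPolynomial.coeff_X]
    rw [e]
    refine (ser_add_le _ _ _).trans (add_le_add ?_ ?_)
    · rw [ser, tsum_eq_single 0]
      · simp
      · intro p hp
        rw [if_neg (Ne.symm hp)]
        simp
    · rw [ser, tsum_eq_single (Finsupp.single i 1)]
      · simp
      · intro p hp
        rw [if_neg (Ne.symm hp)]
        simp

/-- Expanding (x₀ + X)^q and taking absolute values gives the nonnegative binomial expansion of
(|x₀| + y)^q, so recentering needs no convergence beyond that of f at |x₀| + y. -/
theorem ser_recentre_le (f : MIdx → ℂ) (x₀ : Idx → ℂ) (y : Idx → ℝ≥0∞) :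
    ser (recentre f x₀) y ≤ ser f ((fun i => ‖x₀ i‖ₑ) + y) := by
  calc ser (recentre f x₀) y
      ≤ ∑' p, ∑' q, ‖f q‖ₑ * (‖MvPolynomial.coeff p
          (mono (fun i => MvPolynomial.C (x₀ i) + MvPolynomial.X i) q)‖ₑ * mono y p) := by
        refine ENNReal.tsum_le_tsum fun p => ?_
        refine (mul_le_mul_left enorm_tsum_le_tsum_enorm _).trans ?_
        rw [← ENNReal.tsum_mul_right]
        refine ENNReal.tsum_le_tsum fun q => ?_
        rw [enorm_mul, mul_assoc]
    _ = ∑' q, ‖f q‖ₑ * ser (fun p => MvPolynomial.coeff p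
          (mono (fun i => MvPolynomial.C (x₀ i) + MvPolynomial.X i) q)) y := by
        rw [ENNReal.tsum_comm]
        exact tsum_congr fun q => ENNReal.tsum_mul_left
    _ ≤ _ := ENNReal.tsum_le_tsum fun q => mul_le_mul_right (ser_coeff_mono_le x₀ y q) _

theorem ev_recentre {f : MIdx → ℂ} {x₀ h : Idx → ℂ}
    (hf : ser f ((fun i => ‖x₀ i‖ₑ) + fun i => ‖h i‖ₑ) ≠ ⊤) :
    ev (recentre f x₀) h = ev f (x₀ + h) := by
  have hs : Summable (Function.uncurry fun q p => f q * MvPolynomial.coeff p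
      (mono (fun i => MvPolynomial.C (x₀ i) + MvPolynomial.X i) q) * mono h p) := by
    refine Summable.of_enorm (ne_top_of_le_ne_top hf ?_)
    rw [ENNReal.tsum_prod']
    refine ENNReal.tsum_le_tsum fun q => ?_
    refine le_trans (le_of_eq ?_) (mul_le_mul_right (ser_coeff_mono_le x₀ _ q) _)
    rw [ser, ← ENNReal.tsum_mul_left]
    refine tsum_congr fun p => ?_
    simp only [Function.uncurry, enorm_mul, enorm_mono, mul_assoc]
  unfold ev recentre
  simp_rw [← tsum_mul_right]
  rw [hs.tsum_comm]
  refine tsum_congr fun q => ?_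
  simp_rw [mul_assoc]
  rw [tsum_mul_left]
  congr 1
  have e := map_mono (MvPolynomial.eval h : MvPolynomial Idx ℂ →* ℂ)
    (fun i => MvPolynomial.C (x₀ i) + MvPolynomial.X i) q
  have e' : (fun i => (MvPolynomial.eval h : MvPolynomial Idx ℂ →* ℂ)
      (MvPolynomial.C (x₀ i) + MvPolynomial.X i)) = x₀ + h := by
    funext i; simp
  rw [e'] at e
  rw [← e]
  change _ = MvPolynomial.eval h _
  rw [MvPolynomial.eval_eq, tsum_eq_sum]
  · rfl
  · intro p hp
    rw [MvPolynomial.notMem_support_iff.1 hp, zero_mul]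

/-! ### Analyticity -/

/-- The exponent of the monomial `x_{w 0} ⋯ x_{w (n-1)}`. -/
def wordExp {n : ℕ} (w : Fin n → Idx) : MIdx := ∑ i, Finsupp.single (w i) 1

theorem mono_wordExp {M : Type*} [CommMonoid M] (x : Idx → M) {n : ℕ} (w : Fin n → Idx) :
    mono x (wordExp w) = ∏ i, x (w i) := by
  classical
  have : ∀ T : Finset (Fin n), mono x (∑ i ∈ T, Finsupp.single (w i) 1) = ∏ i ∈ T, x (w i) := by
    intro T
    induction T using Finset.induction_on with
    | empty => simp
    | insert a T ha ih =>
      rw [Finset.sum_insert ha, Finset.prod_insert ha, mono_add, ih, mono_single, pow_one]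
  exact this _

theorem wordExp_comp_perm {n : ℕ} (w : Fin n → Idx) (e : Equiv.Perm (Fin n)) :
    wordExp (w ∘ e) = wordExp w :=
  Equiv.sum_comp e fun i => Finsupp.single (w i) 1

theorem degree_wordExp {n : ℕ} (w : Fin n → Idx) : (wordExp w).degree = n := by
  simp [wordExp, map_sum]

theorem le_wordExp {n : ℕ} (w : Fin n → Idx) (i : Fin n) : wordExp w (w i) ≠ 0 := by
  rw [wordExp, Finsupp.finsetSum_apply]
  intro h
  rw [Finset.sum_eq_zero_iff] at h
  simpa using h i (Finset.mem_univ i)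

/-- Words in the indices. -/
abbrev Word := Σ n : ℕ, (Fin n → Idx)

/-- The words with exponent `q`. -/
abbrev WordFiber (q : MIdx) := {w : Word // wordExp w.2 = q}

instance finite_wordFiber (q : MIdx) : Finite (WordFiber q) := by
  have hT : {w : Fin q.degree → Idx | ∀ i, w i ∈ (q.support : Set Idx)}.Finite :=
    Set.Finite.pi' fun _ => q.support.finite_toSet
  have hI := hT.image (Sigma.mk (β := fun n => Fin n → Idx) q.degree)
  refine (hI.subset (t := {w : Word | wordExp w.2 = q}) ?_).to_subtype
  rintro ⟨n, w⟩ hw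
  have hw' : wordExp w = q := hw
  have hn : q.degree = n := by rw [← hw', degree_wordExp]
  subst hn
  refine ⟨w, fun i => ?_, rfl⟩
  have := le_wordExp w i
  rw [hw'] at this
  simpa using this

instance nonempty_wordFiber (q : MIdx) : Nonempty (WordFiber q) := by
  induction q using midx_induction with
  | h0 => exact ⟨⟨⟨0, Fin.elim0⟩, by simp [wordExp]⟩⟩
  | h1 q i ih =>
    obtain ⟨⟨⟨n, w⟩, hw⟩⟩ := ih
    refine ⟨⟨⟨n + 1, Fin.cons i w⟩, ?_⟩⟩
    simp only [wordExp, Fin.sum_univ_succ, Fin.cons_zero, Fin.cons_succ] at hw ⊢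
    rw [hw, add_comm]

/-- The number of words with exponent `q`. -/
def mult (q : MIdx) : ℕ := Nat.card (WordFiber q)

theorem mult_pos (q : MIdx) : 0 < mult q := Nat.card_pos

/-- Each exponent is distributed evenly over the finitely many words representing it. This turns a
power series into a sum of multilinear forms that are symmetric because `mult` depends only on the
exponent. -/
theorem tsum_word (F : MIdx → ℝ≥0∞) :
    ∑' w : Word, F (wordExp w.2) / mult (wordExp w.2) = ∑' q, F q := by
  rw [← (Equiv.sigmaFiberEquiv fun w : Word => wordExp w.2).tsum_eq, ENNReal.tsum_sigma']
  refine tsum_congr fun q => ?_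
  have key : ∀ w : WordFiber q, F (wordExp w.1.2) / mult (wordExp w.1.2) = F q / mult q := by
    rintro ⟨w, rfl⟩
    rfl
  change ∑' w : WordFiber q, F (wordExp w.1.2) / mult (wordExp w.1.2) = _
  have := Fintype.ofFinite (WordFiber q)
  simp_rw [key]
  rw [tsum_fintype, Finset.sum_const, Finset.card_univ, ← Nat.card_eq_fintype_card, nsmul_eq_mul]
  exact ENNReal.mul_div_cancel (by exact_mod_cast (mult_pos q).ne') (ENNReal.natCast_ne_top _)

theorem hasSum_word {F : MIdx → ℂ} (hF : Summable fun q => ‖F q‖) :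
    HasSum (fun w : Word => F (wordExp w.2) / mult (wordExp w.2)) (∑' q, F q) := by
  have hs : Summable fun w : Word => F (wordExp w.2) / mult (wordExp w.2) := by
    refine Summable.of_enorm ?_
    have : ∀ w : Word, ‖F (wordExp w.2) / mult (wordExp w.2)‖ₑ
        = ‖F (wordExp w.2)‖ₑ / mult (wordExp w.2) := by
      intro w
      have hm : (mult (wordExp w.2) : ℂ) ≠ 0 := by exact_mod_cast (mult_pos _).ne'
      rw [div_eq_mul_inv, enorm_mul, enorm_inv hm, div_eq_mul_inv]
      congr 2
      rw [← ofReal_norm, Complex.norm_natCast, ENNReal.ofReal_natCast]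
    simp_rw [this]
    rw [tsum_word fun q => ‖F q‖ₑ]
    exact tsum_enorm_ne_top_iff_summable_norm.2 hF
  have hs' := ((Equiv.sigmaFiberEquiv fun w : Word => wordExp w.2).summable_iff).2 hs
  have h1 : ∑' w : Word, F (wordExp w.2) / mult (wordExp w.2) = ∑' q, F q := by
    rw [← (Equiv.sigmaFiberEquiv fun w : Word => wordExp w.2).tsum_eq]
    refine (hs'.tsum_sigma).trans ?_
    refine tsum_congr fun q => ?_
    have key : ∀ w : WordFiber q, F (wordExp w.1.2) / mult (wordExp w.1.2) = F q / mult q := by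
      rintro ⟨w, rfl⟩
      rfl
    change ∑' w : WordFiber q, F (wordExp w.1.2) / mult (wordExp w.1.2) = _
    have := Fintype.ofFinite (WordFiber q)
    simp_rw [key]
    rw [tsum_fintype, Finset.sum_const, Finset.card_univ, ← Nat.card_eq_fintype_card, nsmul_eq_mul]
    exact mul_div_cancel₀ _ (by exact_mod_cast (mult_pos q).ne')
  exact h1 ▸ hs.hasSum

/-- The coefficients of the symmetric multilinear forms of a power series. -/
def wcoeff (f : MIdx → ℂ) {n : ℕ} (w : Fin n → Idx) : ℂ := f (wordExp w) / mult (wordExp w)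

/-- The majorant of the `n`-th multilinear form of a power series. -/
def mform (f : MIdx → ℂ) {n : ℕ} (y : Fin n → Idx → ℝ≥0∞) : ℝ≥0∞ :=
  ∑' w : Fin n → Idx, ‖wcoeff f w‖ₑ * ∏ i, y i (w i)

theorem enorm_wcoeff (f : MIdx → ℂ) {n : ℕ} (w : Fin n → Idx) :
    ‖wcoeff f w‖ₑ = ‖f (wordExp w)‖ₑ / mult (wordExp w) := by
  have hm : (mult (wordExp w) : ℂ) ≠ 0 := by exact_mod_cast (mult_pos _).ne'
  rw [wcoeff, div_eq_mul_inv, enorm_mul, enorm_inv hm, div_eq_mul_inv]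
  congr 2
  rw [← ofReal_norm, Complex.norm_natCast, ENNReal.ofReal_natCast]

theorem mform_diag_le (f : MIdx → ℂ) (n : ℕ) (y : Idx → ℝ≥0∞) :
    ∑' w : Fin n → Idx, ‖wcoeff f w‖ₑ * ∏ i, y (w i) ≤ ser f y := by
  rw [ser, ← tsum_word fun q => ‖f q‖ₑ * mono y q, ENNReal.tsum_sigma']
  refine le_trans (le_of_eq ?_) (ENNReal.le_tsum n)
  refine tsum_congr fun w => ?_
  rw [enorm_wcoeff, mono_wordExp, div_eq_mul_inv, div_eq_mul_inv]
  ring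

/-- Polarisation by positivity: by symmetry the left side sums over all permutations of the
arguments, and these products occur among the nonnegative terms of the expanded product of ∑ y_i. -/
theorem factorial_mul_mform_le (f : MIdx → ℂ) {n : ℕ} (y : Fin n → Idx → ℝ≥0∞) :
    (n ! : ℝ≥0∞) * mform f y ≤ ser f (∑ i, y i) := by
  classical
  have h1 : ∀ e : Equiv.Perm (Fin n), mform f y
      = ∑' w : Fin n → Idx, ‖wcoeff f w‖ₑ * ∏ j, y (e j) (w j) := by
    intro e
    rw [mform, ← (Equiv.arrowCongr e (Equiv.refl Idx)).tsum_eq]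
    refine tsum_congr fun w => ?_
    have e1 : (Equiv.arrowCongr e (Equiv.refl Idx)) w = w ∘ e.symm := rfl
    rw [e1]
    congr 1
    · rw [wcoeff, wcoeff, wordExp_comp_perm]
    · rw [← Equiv.prod_comp e]
      exact Finset.prod_congr rfl fun j _ => by simp
  have h2 : (n ! : ℝ≥0∞) * mform f y
      = ∑' w : Fin n → Idx, ‖wcoeff f w‖ₑ * ∑ e : Equiv.Perm (Fin n), ∏ j, y (e j) (w j) := by
    have : (n ! : ℝ≥0∞) * mform f y = ∑ e : Equiv.Perm (Fin n), mform f y := by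
      rw [Finset.sum_const, Finset.card_univ, Fintype.card_perm, Fintype.card_fin, nsmul_eq_mul]
    rw [this, Finset.sum_congr rfl fun e _ => h1 e, ← Summable.tsum_finsetSum
      (fun _ _ => ENNReal.summable)]
    exact tsum_congr fun w => (Finset.mul_sum _ _ _).symm
  rw [h2]
  refine le_trans (ENNReal.tsum_le_tsum fun w => mul_le_mul_right ?_ _)
    (mform_diag_le f n (∑ i, y i))
  have h3 : ∏ j, (∑ i, y i) (w j) = ∑ φ' : Fin n → Fin n, ∏ j, y (φ' j) (w j) := by
    simp only [Finset.sum_apply]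
    exact Finset.prod_univ_sum (fun _ => Finset.univ) (fun j i => y i (w j)) |>.trans (by
      rw [Fintype.piFinset_univ])
  rw [h3]
  have h4 : ∑ e : Equiv.Perm (Fin n), ∏ j, y (e j) (w j)
      = ∑ φ' ∈ Finset.univ.image (fun e : Equiv.Perm (Fin n) => (e : Fin n → Fin n)),
        ∏ j, y (φ' j) (w j) := by
    rw [Finset.sum_image]
    intro a _ b _ hab
    exact Equiv.coe_fn_injective hab
  rw [h4]
  exact Finset.sum_le_sum_of_subset (Finset.subset_univ _)

theorem mform_const_mul (f : MIdx → ℂ) {n : ℕ} (t : Fin n → ℝ≥0∞) (y : Fin n → Idx → ℝ≥0∞) :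
    mform f (fun i k => t i * y i k) = (∏ i, t i) * mform f y := by
  rw [mform, mform, ← ENNReal.tsum_mul_left]
  refine tsum_congr fun w => ?_
  rw [Finset.prod_mul_distrib]
  ring

/-- The multilinear forms of a bounded vector field are bounded. -/
theorem Bd.mform_le {s δ δ' M : ℝ} {A : FVF} (h : Bd s δ A M) (hδ' : 0 < δ') (hδ : δ' < δ)
    {n : ℕ} (x : Fin n → G s) :
    wNorm s (fun k => mform (A k) (fun i j => ‖x i j‖ₑ))
      ≤ ENNReal.ofReal (M * (n : ℝ) ^ n / (n ! * δ' ^ n) * ∏ i, ‖x i‖) := by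
  by_cases h0 : ∃ i, ‖x i‖ = 0
  · obtain ⟨i, hi⟩ := h0
    have hx : ∀ k, x i k = 0 := by
      intro k
      rw [norm_eq_zero.1 hi]
      rfl
    have : ∀ k, mform (A k) (fun i j => ‖x i j‖ₑ) = 0 := by
      intro k
      rw [mform, ENNReal.tsum_eq_zero]
      intro w
      rw [Finset.prod_eq_zero (Finset.mem_univ i) (by simp [hx]), mul_zero]
    simp only [this, wNorm_zero]
    exact zero_le
  push Not at h0
  have hpos : ∀ i, 0 < ‖x i‖ := fun i => lt_of_le_of_ne (norm_nonneg _) (Ne.symm (h0 i))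
  -- Each argument is rescaled to norm δ'/n, so that their sum lies in the ball of radius δ; undoing
  -- the scaling produces the factor n^n.
  set t : Fin n → ℝ := fun i => δ' / (n * ‖x i‖) with ht
  have hn : ∀ _ : Fin n, (0 : ℝ) < n := fun i => by exact_mod_cast i.pos
  have ht0 : ∀ i, 0 < t i := fun i => div_pos hδ' (mul_pos (hn i) (hpos i))
  have hsum : wNorm s (∑ i, fun k => ENNReal.ofReal (t i) * ‖x i k‖ₑ) < ENNReal.ofReal δ := by
    refine (wNorm_finset_sum_le s Finset.univ _).trans_lt ?_
    have e : ∀ i, wNorm s (fun k => ENNReal.ofReal (t i) * ‖x i k‖ₑ) = ENNReal.ofReal (δ' / n) := by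
      intro i
      have hni := hn i
      have hxi := hpos i
      rw [wNorm_const_mul, wNorm_eq_norm, ← ENNReal.ofReal_mul (ht0 i).le]
      congr 1
      rw [ht]
      field_simp
    rw [Finset.sum_congr rfl fun i _ => e i, Finset.sum_const, Finset.card_univ, Fintype.card_fin,
      nsmul_eq_mul, ← ENNReal.ofReal_natCast, ← ENNReal.ofReal_mul (by positivity),
      ENNReal.ofReal_lt_ofReal_iff (by linarith)]
    rcases Nat.eq_zero_or_pos n with hn0 | hn0
    · subst hn0
      simp
      linarith
    · have : (0 : ℝ) < n := by exact_mod_cast hn0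
      rw [mul_div_cancel₀ _ this.ne']
      exact hδ
  have h1 := h _ hsum
  have h2 : ∀ k, (n ! : ℝ≥0∞) * ((∏ i, ENNReal.ofReal (t i)) *
      mform (A k) (fun i j => ‖x i j‖ₑ)) ≤ serV A (∑ i, fun k => ENNReal.ofReal (t i) * ‖x i k‖ₑ) k := by
    intro k
    rw [← mform_const_mul]
    exact factorial_mul_mform_le (A k) fun i j => ENNReal.ofReal (t i) * ‖x i j‖ₑ
  have h3 := (wNorm_mono (s := s) h2).trans h1
  rw [wNorm_const_mul, wNorm_const_mul, ← ENNReal.ofReal_prod_of_nonneg (fun i _ => (ht0 i).le),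
    ← ENNReal.ofReal_natCast, ← mul_assoc, ← ENNReal.ofReal_mul (by positivity)] at h3
  have hT : 0 < (n ! : ℝ) * ∏ i, t i :=
    mul_pos (by exact_mod_cast Nat.factorial_pos n) (Finset.prod_pos fun i _ => ht0 i)
  have h4 : wNorm s (fun k => mform (A k) (fun i j => ‖x i j‖ₑ))
      ≤ ENNReal.ofReal (M / ((n ! : ℝ) * ∏ i, t i)) := by
    rw [ENNReal.ofReal_div_of_pos hT, ENNReal.le_div_iff_mul_le
      (Or.inl (by rw [ne_eq, ENNReal.ofReal_eq_zero, not_le]; exact hT))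
          (Or.inl ENNReal.ofReal_ne_top), mul_comm]
    exact h3
  refine h4.trans (le_of_eq ?_)
  congr 1
  have e : ∏ i, t i = δ' ^ n / ((n : ℝ) ^ n * ∏ i, ‖x i‖) := by
    rw [ht, Finset.prod_div_distrib, Finset.prod_mul_distrib]
    simp
  have hP : 0 < ∏ i, ‖x i‖ := Finset.prod_pos fun i _ => hpos i
  have hnn : (n : ℝ) ^ n ≠ 0 := by
    rcases Nat.eq_zero_or_pos n with hn0 | hn0
    · subst hn0; simp
    · positivity
  have hf : (n ! : ℝ) ≠ 0 := by exact_mod_cast (Nat.factorial_pos n).ne'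
  rw [e]
  field_simp

section power

variable {s δ M : ℝ} {A : FVF}

theorem Bd.mform_ne_top (h : Bd s δ A M) (hδ : 0 < δ) {n : ℕ} (x : Fin n → G s)
    (k : Idx) : mform (A k) (fun i j => ‖x i j‖ₑ) ≠ ⊤ :=
  apply_ne_top_of_wNorm_ne_top
    ((h.mform_le (half_pos hδ) (half_lt_self hδ) x).trans_lt ENNReal.ofReal_lt_top).ne k

theorem enorm_tsum_wcoeff_le (f : MIdx → ℂ) {n : ℕ} (x : Fin n → Idx → ℂ) :
    ‖∑' w : Fin n → Idx, wcoeff f w * ∏ i, x i (w i)‖ₑ ≤ mform f (fun i j => ‖x i j‖ₑ) := by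
  refine enorm_tsum_le_tsum_enorm.trans (le_of_eq (tsum_congr fun w => ?_))
  rw [enorm_mul]
  congr 1
  exact map_prod (⟨⟨enorm, enorm_one⟩, fun a b => enorm_mul a b⟩ : ℂ →* ℝ≥0∞) _ _

theorem summable_wcoeff {f : MIdx → ℂ} {n : ℕ} {x : Fin n → Idx → ℂ}
    (h : mform f (fun i j => ‖x i j‖ₑ) ≠ ⊤) :
    Summable fun w : Fin n → Idx => wcoeff f w * ∏ i, x i (w i) := by
  refine Summable.of_enorm (ne_top_of_le_ne_top h (le_of_eq (tsum_congr fun w => ?_)))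
  rw [enorm_mul]
  congr 1
  exact map_prod (⟨⟨enorm, enorm_one⟩, fun a b => enorm_mul a b⟩ : ℂ →* ℝ≥0∞) _ _

/-- The `n`-th multilinear form of a bounded vector field. -/
def Bd.multilinear (h : Bd s δ A M) (hδ : 0 < δ) (hM : 0 ≤ M) (n : ℕ) :
    ContinuousMultilinearMap ℂ (fun _ : Fin n => G s) (G s) :=
  have key : ∀ (x : Fin n → G s) k,
      toG s (fun k => ∑' w : Fin n → Idx, wcoeff (A k) w * ∏ i, x i (w i)) k
        = ∑' w : Fin n → Idx, wcoeff (A k) w * ∏ i, x i (w i) := fun x k =>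
    toG_apply (ne_top_of_le_ne_top
      ((h.mform_le (half_pos hδ) (half_lt_self hδ) x).trans_lt ENNReal.ofReal_lt_top).ne
      (wNorm_mono fun k => enorm_tsum_wcoeff_le (A k) fun i => x i)) k
  MultilinearMap.mkContinuous
    { toFun := fun x => toG s fun k => ∑' w : Fin n → Idx, wcoeff (A k) w * ∏ i, x i (w i)
      map_update_add' := by
        intro _ x i a b
        refine G.ext fun k => ?_
        rw [G.add_apply, key, key, key, ← (summable_wcoeff (h.mform_ne_top hδ _ k)).tsum_add
          (summable_wcoeff (h.mform_ne_top hδ _ k))]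
        refine tsum_congr fun w => ?_
        rw [← mul_add]
        congr 1
        rw [← Finset.mul_prod_erase _ _ (Finset.mem_univ i),
          ← Finset.mul_prod_erase _ (fun j => Function.update x i a j (w j)) (Finset.mem_univ i),
          ← Finset.mul_prod_erase _ (fun j => Function.update x i b j (w j)) (Finset.mem_univ i)]
        simp only [Function.update_self, G.add_apply]
        rw [add_mul]
        congr 2 <;>
        · refine Finset.prod_congr rfl fun j hj => ?_
          rw [Function.update_of_ne (Finset.ne_of_mem_erase hj),
            Function.update_of_ne (Finset.ne_of_mem_erase hj)]
      map_update_smul' := by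
        intro _ x i c a
        refine G.ext fun k => ?_
        rw [G.smul_apply, key, key, ← tsum_mul_left]
        refine tsum_congr fun w => ?_
        rw [mul_left_comm]
        congr 1
        rw [← Finset.mul_prod_erase _ _ (Finset.mem_univ i),
          ← Finset.mul_prod_erase _ (fun j => Function.update x i a j (w j)) (Finset.mem_univ i)]
        simp only [Function.update_self, G.smul_apply]
        rw [mul_assoc]
        congr 2
        refine Finset.prod_congr rfl fun j hj => ?_
        rw [Function.update_of_ne (Finset.ne_of_mem_erase hj),
          Function.update_of_ne (Finset.ne_of_mem_erase hj)] }
    (M * (n : ℝ) ^ n / (n ! * (δ / 2) ^ n)) fun x =>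
      norm_toG_le (by positivity) ((wNorm_mono fun k => enorm_tsum_wcoeff_le (A k) fun i => x
          i).trans
        (h.mform_le (half_pos hδ) (half_lt_self hδ) x))

theorem Bd.multilinear_apply (h : Bd s δ A M) (hδ : 0 < δ) (hM : 0 ≤ M) (n : ℕ) (x : Fin n → G s)
    (k : Idx) : h.multilinear hδ hM n x k = ∑' w : Fin n → Idx, wcoeff (A k) w * ∏ i, x i (w i) :=
  toG_apply (ne_top_of_le_ne_top
      ((h.mform_le (half_pos hδ) (half_lt_self hδ) x).trans_lt ENNReal.ofReal_lt_top).ne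
      (wNorm_mono fun k => enorm_tsum_wcoeff_le (A k) fun i => x i)) k

/-- Since n^n/n! ≤ e^n, polarisation costs only a geometric factor. The radius of convergence found
is δ/(2e), smaller than δ but enough for analyticity at the centre; other points are reached by
recentering. -/
theorem Bd.norm_multilinear_le (h : Bd s δ A M) (hδ : 0 < δ) (hM : 0 ≤ M) (n : ℕ) :
    ‖h.multilinear hδ hM n‖ ≤ M * (2 * Real.exp 1 / δ) ^ n := by
  refine (ContinuousMultilinearMap.opNorm_le_bound
    (M := M * (n : ℝ) ^ n / (n ! * (δ / 2) ^ n)) (by positivity) fun x => ?_).trans ?_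
  · refine norm_le_of_wNorm_le (by positivity) ((wNorm_mono fun k => ?_).trans
      (h.mform_le (half_pos hδ) (half_lt_self hδ) x))
    rw [h.multilinear_apply]
    exact enorm_tsum_wcoeff_le (A k) fun i => x i
  have h1 : (n : ℝ) ^ n / n ! ≤ Real.exp 1 ^ n := by
    rw [← Real.exp_nat_mul, mul_one]
    exact Real.pow_div_factorial_le_exp _ (by positivity) _
  have h2 : M * (n : ℝ) ^ n / (n ! * (δ / 2) ^ n) = M * ((n : ℝ) ^ n / n !) * (2 / δ) ^ n := by
    rw [div_pow, div_pow]
    field_simp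
  rw [h2, mul_assoc, mul_div_right_comm, mul_pow (2 / δ), mul_comm ((2 / δ) ^ n)]
  gcongr

/-- A bounded power series is analytic at the origin. -/
theorem Bd.analyticAt_zero (h : Bd s δ A M) (hδ : 0 < δ) (hM : 0 ≤ M) :
    AnalyticAt ℂ (EV s A) 0 := by
  set p : FormalMultilinearSeries ℂ (G s) (G s) := fun n => h.multilinear hδ hM n with hp
  set r : ℝ := δ / (2 * Real.exp 1) with hr
  have hr0 : 0 < r := by positivity
  have hrδ : r ≤ δ := by
    rw [hr, div_le_iff₀ (by positivity)]
    have := Real.add_one_le_exp (1 : ℝ)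
    nlinarith
  have hrinv : 2 * Real.exp 1 / δ = r⁻¹ := by rw [hr, inv_div]
  have hrad : (r.toNNReal : ℝ≥0∞) ≤ p.radius := by
    refine p.le_radius_of_bound M fun n => ?_
    rw [Real.coe_toNNReal _ hr0.le]
    have := h.norm_multilinear_le hδ hM n
    rw [hrinv] at this
    calc ‖p n‖ * r ^ n ≤ M * (r⁻¹) ^ n * r ^ n := by gcongr
      _ = M := by rw [mul_assoc, ← mul_pow, inv_mul_cancel₀ hr0.ne', one_pow, mul_one]
  refine HasFPowerSeriesOnBall.analyticAt (p := p) (r := r.toNNReal) ⟨hrad, by simpa using hr0, ?_⟩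
  intro x hx
  have hx' : ‖x‖ < r := by
    rw [mem_eball_zero_iff, ← ofReal_norm] at hx
    exact (ENNReal.ofReal_lt_ofReal_iff_of_nonneg (norm_nonneg _)).1 hx
  rw [zero_add]
  refine G.hasSum_of_coord ?_ fun k => ?_
  · refine Summable.of_norm_bounded (g := fun n => M * (r⁻¹ * ‖x‖) ^ n) ?_ fun n => ?_
    · refine Summable.mul_left _ (summable_geometric_of_lt_one (by positivity) ?_)
      rw [inv_mul_eq_div, div_lt_one hr0]
      exact hx'
    · have h1 := (h.multilinear hδ hM n).le_opNorm fun _ => x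
      have h2 := h.norm_multilinear_le hδ hM n
      rw [hrinv] at h2
      simp only [Finset.prod_const, Finset.card_univ, Fintype.card_fin] at h1
      refine h1.trans ?_
      rw [mul_pow, ← mul_assoc]
      exact mul_le_mul_of_nonneg_right h2 (by positivity)
  · rw [h.EV_apply (hx'.trans_le hrδ)]
    have hser := h.ser_ne_top (wNorm_lt_of_norm_lt (hx'.trans_le hrδ)) k
    have hw := hasSum_word (summable_norm_of_ser hser)
    refine hw.sigma fun n => ?_
    rw [h.multilinear_apply]
    refine (summable_wcoeff (h.mform_ne_top hδ _ k)).hasSum.congr_fun fun w => ?_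
    change A k (wordExp w) * mono x (wordExp w) / mult (wordExp w) = _
    rw [mono_wordExp, wcoeff]
    ring

end power

/-- A bounded vector field defines an analytic map. -/
theorem Bd.analyticOnNhd {s R B : ℝ} {V : FVF} (h : Bd s R V B) (hB : 0 ≤ B) :
    AnalyticOnNhd ℂ (EV s V) (Metric.ball 0 R) := by
  intro x₀ hx₀
  rw [mem_ball_zero_iff] at hx₀
  set δ := R - ‖x₀‖ with hδ
  have hδ0 : 0 < δ := by linarith
  have hlt : ∀ y : Idx → ℝ≥0∞, wNorm s y < ENNReal.ofReal δ →
      wNorm s ((fun i => ‖x₀ i‖ₑ) + y) < ENNReal.ofReal R := by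
    intro y hy
    refine (wNorm_add_le _ _ _).trans_lt ?_
    rw [wNorm_eq_norm, show R = ‖x₀‖ + δ by ring, ENNReal.ofReal_add (norm_nonneg _) hδ0.le]
    exact ENNReal.add_lt_add_left ENNReal.ofReal_ne_top hy
  have hA : Bd s δ (fun k => recentre (V k) x₀) B := fun y hy =>
    (wNorm_mono fun k => ser_recentre_le (V k) x₀ y).trans (h _ (hlt y hy))
  have h1 : AnalyticAt ℂ (fun x => EV s (fun k => recentre (V k) x₀) (x - x₀)) x₀ := by
    refine AnalyticAt.fun_comp (g := EV s fun k => recentre (V k) x₀) (f := fun x : G s => x - x₀)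
        ?_ ?_
    · rw [sub_self]
      exact hA.analyticAt_zero hδ0 hB
    · exact analyticAt_id.sub analyticAt_const
  refine h1.congr ?_
  filter_upwards [Metric.ball_mem_nhds x₀ hδ0] with x hx
  rw [mem_ball_iff_norm] at hx
  have hx2 : ‖x‖ < R := by
    have := norm_add_le x₀ (x - x₀)
    rw [add_sub_cancel] at this
    linarith
  refine G.ext fun k => ?_
  rw [hA.EV_apply hx, h.EV_apply hx2, ev_recentre (h.ser_ne_top (hlt _ (wNorm_lt_of_norm_lt hx)) k)]
  congr 1
  funext i
  simp [G.sub_apply]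

theorem exists_wNorm_lt_sub {s r : ℝ} {y : Idx → ℝ≥0∞} (hy : wNorm s y < ENNReal.ofReal r) :
    ∃ δ, 0 < δ ∧ wNorm s y < ENNReal.ofReal (r - δ) := by
  set a := (wNorm s y).toReal with ha
  have e : wNorm s y = ENNReal.ofReal a := (ENNReal.ofReal_toReal hy.ne_top).symm
  have ha0 : 0 ≤ a := ENNReal.toReal_nonneg
  have har : a < r := (ENNReal.ofReal_lt_ofReal_iff_of_nonneg ha0).1 (e ▸ hy)
  refine ⟨(r - a) / 2, by linarith, ?_⟩
  rw [e, ENNReal.ofReal_lt_ofReal_iff_of_nonneg ha0]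
  linarith

/-! ### Scalar power series: differentiation along directions. -/

section scalar

variable {s r M : ℝ} {f : MIdx → ℂ}

/-- The strict inequality at y leaves room for a small multiple of h. The direction h only needs
finite norm, which admits values of W including D(λ). -/
theorem SBd.tsum_dmono_ne_top (hf : SBd s r f M) {y h : Idx → ℝ≥0∞}
    (hy : wNorm s y < ENNReal.ofReal r) (hh : wNorm s h ≠ ⊤) :
    ∑' q, ‖f q‖ₑ * dmono y h q ≠ ⊤ := by
  obtain ⟨δ, hδ, hy'⟩ := exists_wNorm_lt_sub hy
  set A := (wNorm s h).toReal + 1 with hA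
  have hA0 : 0 < A := by positivity
  have hhA : wNorm s h ≤ ENNReal.ofReal A := by
    rw [← ENNReal.ofReal_toReal hh]
    exact ENNReal.ofReal_le_ofReal (by linarith)
  have h1 := mul_tsum_dmono_le f y h (ENNReal.ofReal (δ / A))
  have h2 := hf.ser_ne_top (wNorm_add_const_mul_lt hA0 hδ hy' hhA)
  intro hc
  rw [hc, ENNReal.mul_top (by simpa using div_pos hδ hA0), top_le_iff] at h1
  exact h2 h1

theorem hasDerivAt_mono (x h : Idx → ℂ) (q : MIdx) (z : ℂ) :
    HasDerivAt (fun z : ℂ => mono (fun i => x i + z * h i) q)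
      (dmono (fun i => x i + z * h i) h q) z := by
  induction q using midx_induction with
  | h0 =>
    simp only [mono_zero]
    have : dmono (fun i => x i + z * h i) h 0 = 0 := by simp [dmono]
    rw [this]
    exact hasDerivAt_const _ _
  | h1 q i ih =>
    rw [dmono_add_single]
    have e : (fun z : ℂ => mono (fun i => x i + z * h i) (q + Finsupp.single i 1))
        = fun z => mono (fun i => x i + z * h i) q * (x i + z * h i) := by
      funext z
      rw [mono_add, mono_single, pow_one]
    rw [e]
    have h1 : HasDerivAt (fun z : ℂ => x i + z * h i) (h i) z := by
      simpa using ((hasDerivAt_id z).mul_const (h i)).const_add (x i)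
    convert! ih.mul h1 using 1
    ring

/-- Termwise differentiation along a line. -/
theorem SBd.hasSum_deriv (hf : SBd s r f M) {x h : G s} (hx : ‖x‖ < r) :
    HasSum (fun q => f q * dmono x h q) (deriv (fun z : ℂ => ev f (x + z • h : G s)) 0) := by
  set ε := (r - ‖x‖) / (2 * (‖h‖ + 1)) with hε
  have hε0 : 0 < ε := div_pos (by linarith) (by positivity)
  -- The point |x| + ε|h| stays in the ball and dominates every term on the complex disc |z| < ε, so
  -- the series may be differentiated term by term.
  have hy : wNorm s ((fun i => ‖x i‖ₑ) + fun i => ENNReal.ofReal ε * ‖h i‖ₑ) < ENNReal.ofReal r := by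
    refine (wNorm_add_le _ _ _).trans_lt ?_
    rw [wNorm_const_mul, wNorm_eq_norm, wNorm_eq_norm, ← ENNReal.ofReal_mul hε0.le,
      ← ENNReal.ofReal_add (norm_nonneg _) (by positivity),
      ENNReal.ofReal_lt_ofReal_iff_of_nonneg (by positivity)]
    have : ε * ‖h‖ ≤ (r - ‖x‖) / 2 := by
      rw [hε, div_mul_eq_mul_div, div_le_div_iff₀ (by positivity) (by norm_num)]
      nlinarith [norm_nonneg h]
    linarith
  have hne := hf.ser_ne_top hy
  have key := Complex.hasSum_deriv_of_summable_norm (U := Metric.ball (0 : ℂ) ε)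
    (F := fun q z => f q * mono (fun i => x i + z * h i) q) (z := 0)
    (u := fun q => (‖f q‖ₑ * mono ((fun i => ‖x i‖ₑ) + fun i => ENNReal.ofReal ε * ‖h i‖ₑ)
        q).toReal)
    (ENNReal.summable_toReal hne)
    (fun q z _ => ((hasDerivAt_mono x h q z).const_mul (f
        q)).differentiableAt.differentiableWithinAt)
    Metric.isOpen_ball (fun q z hz => ?_) (Metric.mem_ball_self hε0)
  · refine key.congr_fun fun q => ?_
    have h0 : (fun i => x i + 0 * h i) = x := by funext i; simp
    rw [((hasDerivAt_mono x h q 0).const_mul (f q)).deriv, h0]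
  · rw [mem_ball_zero_iff] at hz
    rw [← toReal_enorm]
    refine ENNReal.toReal_mono (ENNReal.ne_top_of_tsum_ne_top hne q) ?_
    rw [enorm_mul, enorm_mono]
    refine mul_le_mul_right (mono_le_mono (fun i => ?_) q) _
    refine (enorm_add_le _ _).trans (add_le_add le_rfl ?_)
    rw [enorm_mul]
    refine mul_le_mul_left ?_ _
    rw [← ofReal_norm]
    exact ENNReal.ofReal_le_ofReal hz.le

/-- The series is placed in a single component of a vector field, and the statement for vector
fields is read off by a coordinate functional. -/
theorem SBd.analyticOnNhd (hf : SBd s r f M) :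
    AnalyticOnNhd ℂ (fun x : G s => ev f x) (Metric.ball 0 r) := by
  classical
  set k₀ : Idx := (0, 1)
  set V : FVF := fun k => if k = k₀ then f else 0 with hV
  have hb : Bd s r V (weight s k₀ * |M|) := by
    intro y hy
    have e : ∀ k, k ≠ k₀ → serV V y k = 0 := by
      intro k hk
      simp [serV, ser, hV, hk]
    have e' : serV V y k₀ = ser f y := by simp [serV, hV]
    unfold wNorm
    rw [tsum_eq_single k₀ (fun k hk => by rw [e k hk]; simp), e', ← ENNReal.rpow_natCast,
      ← ENNReal.rpow_mul]
    norm_num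
    rw [ENNReal.ofReal_mul (weight_pos s k₀).le]
    exact mul_le_mul_right ((hf y hy).trans (ENNReal.ofReal_le_ofReal (le_abs_self M))) _
  have h1 := hb.analyticOnNhd (mul_nonneg (weight_pos s k₀).le (abs_nonneg M))
  intro x hx
  have h2 := ((coordG s k₀).analyticAt _).comp (h1 x hx)
  refine h2.congr ?_
  filter_upwards [Metric.isOpen_ball.mem_nhds hx] with x' hx'
  rw [mem_ball_zero_iff] at hx'
  change EV s V x' k₀ = ev f x'
  rw [hb.EV_apply hx']
  simp [hV]

theorem SBd.fderiv_apply (hf : SBd s r f M) {x : G s} (hx : ‖x‖ < r) (h : G s) :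
    HasSum (fun q => f q * dmono x h q) (fderiv ℂ (fun x : G s => ev f x) x h) := by
  have h1 : HasDerivAt (fun z : ℂ => x + z • h) h 0 := by
    simpa using ((hasDerivAt_id (0 : ℂ)).smul_const h).const_add x
  have h2 := (hf.analyticOnNhd x (mem_ball_zero_iff.2 hx)).differentiableAt.hasFDerivAt
  have h3 : HasDerivAt (fun z : ℂ => ev f (x + z • h : G s))
      (fderiv ℂ (fun x : G s => ev f x) x h) 0 := by
    refine HasFDerivAt.comp_hasDerivAt (l := fun x : G s => ev f x) (f := fun z : ℂ => x + z • h)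
      0 ?_ h1
    simpa using h2
  rw [← h3.deriv]
  exact hf.hasSum_deriv hx

end scalar

/-! ### Evaluation of X[f]. -/

theorem tsum_mul_tsum_adiag {a b : MIdx → ℂ} (ha : Summable fun p => ‖a p‖)
    (hb : Summable fun p => ‖b p‖) :
    (∑' p, a p) * ∑' p, b p = ∑' q, ∑ p ∈ adiag q, a p.1 * b p.2 :=
  ha.of_norm.tsum_mul_tsum_eq_tsum_sum_antidiagonal hb.of_norm (summable_mul_of_summable_norm ha hb)

/-- The value of `X[f]` is the derivative of `f` in the direction of the value of `X`. -/
theorem hasSum_ev_act {X : FVF} {f : MIdx → ℂ} {x : Idx → ℂ}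
    (hD : ∑' q, ‖f q‖ₑ * dmono (fun i => ‖x i‖ₑ) (serV X fun i => ‖x i‖ₑ) q ≠ ⊤)
    (hX : ∀ j, ser (X j) (fun i => ‖x i‖ₑ) ≠ ⊤)
    (hj : ∀ j, ∑' b : MIdx, ‖((b j : ℂ) + 1) * f (b + Finsupp.single j 1) * mono x b‖ₑ ≠ ⊤) :
    HasSum (fun q => f q * dmono x (evalVF X x) q) (ev (act X f) x) := by
  set y : Idx → ℝ≥0∞ := fun i => ‖x i‖ₑ with hy
  have hn : ∀ n : ℕ, ‖((n : ℂ) + 1)‖ₑ = (n : ℝ≥0∞) + 1 := by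
    intro n
    rw [← Nat.cast_one, ← Nat.cast_add, ← ofReal_norm, Complex.norm_natCast,
      ENNReal.ofReal_natCast]
    push_cast; rfl
  have hs1 : Summable (Function.uncurry fun (j : Idx) (q : MIdx) => ∑ p ∈ adiag q,
      (X j p.1 * mono x p.1) * (((p.2 j : ℂ) + 1) * f (p.2 + Finsupp.single j 1) * mono x p.2)) := by
    refine Summable.of_enorm (ne_top_of_le_ne_top hD ?_)
    rw [ENNReal.tsum_prod', ← tsum_mul_deriv_eq]
    refine ENNReal.tsum_le_tsum fun j => ?_
    rw [serV, ser, tsum_mul_tsum_antidiagonal (fun p => ‖X j p‖ₑ * mono y p)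
      (fun p => ((p j : ℝ≥0∞) + 1) * ‖f (p + Finsupp.single j 1)‖ₑ * mono y p)]
    refine ENNReal.tsum_le_tsum fun q => ?_
    refine (enorm_sum_le _ _).trans (Finset.sum_le_sum fun p _ => le_of_eq ?_)
    simp only [enorm_mul, enorm_mono, hn, hy]
  have hs2 : Summable (Function.uncurry fun (j : Idx) (q : MIdx) =>
      f q * ((q j : ℂ) * evalVF X x j * mono x (q - Finsupp.single j 1))) := by
    refine Summable.of_enorm (ne_top_of_le_ne_top hD ?_)
    rw [ENNReal.tsum_prod', ENNReal.tsum_comm]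
    refine ENNReal.tsum_le_tsum fun q => ?_
    have : ∀ j, ‖Function.uncurry (fun (j : Idx) (q : MIdx) =>
        f q * ((q j : ℂ) * evalVF X x j * mono x (q - Finsupp.single j 1))) (j, q)‖ₑ
        ≤ ‖f q‖ₑ * ((q j : ℝ≥0∞) * serV X y j * mono y (q - Finsupp.single j 1)) := by
      intro j
      have hq : ‖(q j : ℂ)‖ₑ = (q j : ℝ≥0∞) := by
        rw [← ofReal_norm, Complex.norm_natCast, ENNReal.ofReal_natCast]
      simp only [Function.uncurry, enorm_mul, enorm_mono, hq]
      gcongr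
      exact enorm_ev_le (X j) x
    refine (ENNReal.tsum_le_tsum this).trans ?_
    rw [ENNReal.tsum_mul_left, dmono, tsum_eq_sum]
    intro j hj
    simp [Finsupp.notMem_support_iff.1 hj]
  have h1 : ∀ j, ∑' q, ∑ p ∈ adiag q,
      (X j p.1 * mono x p.1) * (((p.2 j : ℂ) + 1) * f (p.2 + Finsupp.single j 1) * mono x p.2)
      = ∑' q, f q * ((q j : ℂ) * evalVF X x j * mono x (q - Finsupp.single j 1)) := by
    intro j
    have ha := summable_norm_of_ser (hX j)
    have hb := tsum_enorm_ne_top_iff_summable_norm.1 (hj j)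
    rw [← tsum_mul_tsum_adiag (a := fun p => X j p * mono x p)
      (b := fun p => ((p j : ℂ) + 1) * f (p + Finsupp.single j 1) * mono x p) ha hb]
    change evalVF X x j * _ = _
    rw [← tsum_mul_left, ← tsum_add_single j
      (G := fun q : MIdx => f q * ((q j : ℂ) * evalVF X x j * mono x (q - Finsupp.single j 1)))
      (by intro q hq; simp [hq])]
    refine tsum_congr fun p => ?_
    simp only [Finsupp.coe_add, Pi.add_apply, Finsupp.single_eq_same, Nat.cast_add, Nat.cast_one,
      add_tsub_cancel_right]
    ring
  have h2 : ev (act X f) x = ∑' q, ∑' j,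
      f q * ((q j : ℂ) * evalVF X x j * mono x (q - Finsupp.single j 1)) := by
    rw [hs2.tsum_comm, ← tsum_congr h1, ← hs1.tsum_comm, ev]
    refine tsum_congr fun q => ?_
    rw [act_apply, ← tsum_mul_right]
    refine tsum_congr fun j => ?_
    rw [Finset.sum_mul]
    refine Finset.sum_congr rfl fun p hp => ?_
    rw [mem_adiag] at hp
    rw [← hp, mono_add]
    ring
  have h3 : ∀ q, ∑' j, f q * ((q j : ℂ) * evalVF X x j * mono x (q - Finsupp.single j 1))
      = f q * dmono x (evalVF X x) q := by
    intro q
    rw [tsum_mul_left, dmono, tsum_eq_sum]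
    intro j hj
    simp [Finsupp.notMem_support_iff.1 hj]
  rw [h2]
  refine (hs2.prod_symm.prod.hasSum).congr_fun fun q => ?_
  exact (h3 q).symm

/-- X is only required to have finite majorant at the given x, not to be bounded on a ball, so that
fields containing D(λ) are covered. Convergence of each ∂f/∂x_j follows by testing with the
indicator of {j}. -/
theorem SBd.hasSum_ev_act {s r M : ℝ} {f : MIdx → ℂ} {X : FVF} {x : Idx → ℂ}
    (hf : SBd s r f M) (hx : wNorm s (fun i => ‖x i‖ₑ) < ENNReal.ofReal r)
    (hX : wNorm s (serV X fun i => ‖x i‖ₑ) ≠ ⊤) :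
    HasSum (fun q => f q * dmono x (evalVF X x) q) (ev (ResonantNF.act X f) x) := by
  classical
  refine ResonantNF.hasSum_ev_act (hf.tsum_dmono_ne_top hx hX)
    (fun j => apply_ne_top_of_wNorm_ne_top hX j) fun j => ?_
  have h1 := hf.tsum_dmono_ne_top hx (wNorm_ne_top_of_finite_support s {j})
  rw [← tsum_mul_deriv_eq] at h1
  have h2 := ne_top_of_le_ne_top h1 (ENNReal.le_tsum j)
  simp only [Finset.coe_singleton, Set.indicator_of_mem (Set.mem_singleton j), one_mul] at h2
  refine ne_top_of_le_ne_top h2 (le_of_eq (tsum_congr fun b => ?_))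
  rw [enorm_mul, enorm_mul, enorm_mono]
  congr 2
  rw [← Nat.cast_one, ← Nat.cast_add, ← ofReal_norm, Complex.norm_natCast, ENNReal.ofReal_natCast]
  push_cast; rfl

theorem SBd.fderiv_EV {s r M A : ℝ} {f : MIdx → ℂ} {X : FVF} (hf : SBd s r f M) (hX : Bd s r X A)
    {x : G s} (hx : ‖x‖ < r) :
    fderiv ℂ (fun x : G s => ev f x) x (EV s X x) = ev (ResonantNF.act X f) x := by
  have h1 := hf.fderiv_apply hx (EV s X x)
  have e : ((EV s X x : G s) : Idx → ℂ) = evalVF X x := funext fun k => hX.EV_apply hx k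
  rw [e] at h1
  exact h1.unique (hf.hasSum_ev_act (wNorm_lt_of_norm_lt hx)
    ((hX _ (wNorm_lt_of_norm_lt hx)).trans_lt ENNReal.ofReal_lt_top).ne)

/-! ### The flow -/

/-- Taylor's remainder at 1 is at most (n+1)! θ^{n+1} M / n! = (n+1)θ^{n+1}M, which tends to 0 as θ
< 1. -/
theorem hasSum_taylor_unit {φ' : ℕ → ℝ → ℂ} {θ M : ℝ} (h0 : 0 ≤ θ) (h1 : θ < 1)
    (hd : ∀ n, ∀ t ∈ Set.Icc (0 : ℝ) 1, HasDerivWithinAt (φ' n) (φ' (n + 1) t) (Set.Icc 0 1) t)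
    (hb : ∀ n, ∀ t ∈ Set.Icc (0 : ℝ) 1, ‖φ' n t‖ ≤ n ! * θ ^ n * M) :
    HasSum (fun n : ℕ => ((n ! : ℕ) : ℂ)⁻¹ * φ' n 0) (φ' 0 1) := by
  have m0 : (0 : ℝ) ∈ Set.Icc (0 : ℝ) 1 := ⟨le_rfl, zero_le_one⟩
  have m1 : (1 : ℝ) ∈ Set.Icc (0 : ℝ) 1 := ⟨zero_le_one, le_rfl⟩
  have hu : UniqueDiffOn ℝ (Set.Icc (0 : ℝ) 1) := uniqueDiffOn_Icc zero_lt_one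
  have hit : ∀ n, ∀ t ∈ Set.Icc (0 : ℝ) 1,
      iteratedDerivWithin n (φ' 0) (Set.Icc 0 1) t = φ' n t := by
    intro n
    induction n with
    | zero => intro t _; rw [iteratedDerivWithin_zero]
    | succ n ih =>
      intro t ht
      rw [iteratedDerivWithin_succ, derivWithin_congr ih (ih t ht)]
      exact (hd n t ht).derivWithin (hu t ht)
  have hsm : ∀ n : ℕ, ContDiffOn ℝ (n + 1) (φ' 0) (Set.Icc 0 1) := by
    intro n
    have := contDiffOn_of_differentiableOn_deriv (𝕜 := ℝ) (n := ((n + 1 : ℕ) : ℕ∞))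
      (f := φ' 0) (s := Set.Icc 0 1) fun m _ t ht => by
        refine (DifferentiableWithinAt.congr (hd m t ht).differentiableWithinAt
          (fun t ht => hit m t ht) (hit m t ht))
    exact_mod_cast this
  have hM : 0 ≤ M := by
    have := (norm_nonneg _).trans (hb 0 0 m0)
    simpa using this
  have hs : Summable fun n : ℕ => ((n ! : ℕ) : ℂ)⁻¹ * φ' n 0 := by
    refine Summable.of_norm_bounded ((summable_geometric_of_lt_one h0 h1).mul_right M) fun n => ?_
    rw [norm_mul, norm_inv, Complex.norm_natCast, inv_mul_le_iff₀ (by positivity), ← mul_assoc]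
    exact hb n 0 m0
  have ht : Filter.Tendsto (fun n : ℕ => ∑ k ∈ Finset.range (n + 1), ((k ! : ℕ) : ℂ)⁻¹ * φ' k 0)
      Filter.atTop (nhds (φ' 0 1)) := by
    rw [tendsto_iff_norm_sub_tendsto_zero]
    have hz : Filter.Tendsto (fun n : ℕ => ((n : ℝ) * θ ^ n * θ + θ ^ n * θ) * M) Filter.atTop
        (nhds 0) := by
      have h2 := tendsto_self_mul_const_pow_of_lt_one h0 h1
      have h3 := tendsto_pow_atTop_nhds_zero_of_lt_one h0 h1
      simpa using ((h2.mul_const θ).add (h3.mul_const θ)).mul_const M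
    refine squeeze_zero (fun n => norm_nonneg _) (fun n => ?_) hz
    have := taylor_mean_remainder_bound (n := n) (x := 1) zero_le_one (hsm n) m1
      (C := (n + 1)! * θ ^ (n + 1) * M) (fun y hy => by rw [hit _ y hy]; exact hb _ y hy)
    rw [taylor_within_apply, norm_sub_rev] at this
    have e : ∑ k ∈ Finset.range (n + 1), ((k ! : ℝ)⁻¹ * (1 - 0) ^ k) •
        iteratedDerivWithin k (φ' 0) (Set.Icc 0 1) 0
        = ∑ k ∈ Finset.range (n + 1), ((k ! : ℕ) : ℂ)⁻¹ * φ' k 0 := by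
      refine Finset.sum_congr rfl fun k _ => ?_
      rw [hit k 0 m0]
      simp
    rw [e] at this
    refine this.trans (le_of_eq ?_)
    have hn : (n ! : ℝ) ≠ 0 := by exact_mod_cast (Nat.factorial_pos n).ne'
    rw [Nat.factorial_succ]
    push_cast
    field_simp
    ring
  have h3 := (hs.hasSum.tendsto_sum_nat).comp (Filter.tendsto_add_atTop_nat 1)
  have := tendsto_nhds_unique h3 ht
  exact this ▸ hs.hasSum

theorem iterate_lie_apply (F V : FVF) (n : ℕ) (k : Idx) :
    (lie F)^[n] V k = (act F)^[n] (V k) := by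
  induction n generalizing V with
  | zero => rfl
  | succ n ih => rw [Function.iterate_succ_apply, Function.iterate_succ_apply, ih]; rfl

/-- The identity as a vector field. -/
def idField : FVF := diagField fun _ => 1

theorem ser_diagField (lam : Idx → ℂ) (y : Idx → ℝ≥0∞) (k : Idx) :
    ser (diagField lam k) y = ‖lam k‖ₑ * y k := by
  rw [ser, tsum_eq_single (Finsupp.single k 1)]
  · simp [diagField]
  · intro q hq
    simp [diagField, hq]

theorem ev_diagField (lam : Idx → ℂ) (x : Idx → ℂ) (k : Idx) :
    ev (diagField lam k) x = lam k * x k := by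
  rw [ev, tsum_eq_single (Finsupp.single k 1)]
  · simp [diagField]
  · intro q hq
    simp [diagField, hq]

theorem bd_idField (s r : ℝ) : Bd s r idField r := by
  intro y hy
  have : serV idField y = y := funext fun k => by simp [serV, idField, ser_diagField]
  rw [this]
  exact hy.le

/-- The power series `∑_n F^n[x]/n!` of the time-one flow of `F`. -/
def flowSeries (F : FVF) : FVF := fun k q =>
  ∑' n : ℕ, ((n ! : ℕ) : ℂ)⁻¹ * (lie F)^[n] idField k q

section flow

variable {s R ρ f : ℝ} {F : FVF}

theorem flow_ratio_lt (hρ : 0 < ρ) (hf : f ≤ ρ / (8 * Real.exp 1)) :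
    Real.exp 1 * f / ρ ≤ 1 / 2 := by
  rw [le_div_iff₀ (by positivity)] at hf
  rw [div_le_iff₀ hρ]
  nlinarith

theorem flow_bound_le (hρ : 0 < ρ) (hf : f ≤ ρ / (8 * Real.exp 1)) : f ≤ ρ := by
  refine hf.trans (div_le_self hρ.le ?_)
  have := Real.add_one_le_exp (1 : ℝ)
  linarith

theorem Bd.iterate_lie_div (hF : Bd s R F f) (hf0 : 0 ≤ f) (hρ : 0 < ρ) {V : FVF} {B : ℝ}
    (hV : Bd s R V B) (hB : 0 ≤ B) (n : ℕ) :
    Bd s (R - ρ) (fun k q => ((n ! : ℕ) : ℂ)⁻¹ * (ResonantNF.lie F)^[n] V k q)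
      ((Real.exp 1 * f / ρ) ^ n * B) := by
  refine ((hF.iterate_lie hV hf0 hB hρ n).const_mul _).of_le (le_of_eq ?_)
  have hn : (n ! : ℝ) ≠ 0 := by exact_mod_cast (Nat.factorial_pos n).ne'
  rw [norm_inv, Complex.norm_natCast]
  field_simp

theorem hasSum_flowSeries (hF : Bd s R F f) (hf0 : 0 ≤ f) (hρ : 0 < ρ) (hR : ρ < R)
    (hf : f ≤ ρ / (8 * Real.exp 1)) (k : Idx) (q : MIdx) :
    HasSum (fun n : ℕ => ((n ! : ℕ) : ℂ)⁻¹ * (lie F)^[n] idField k q) (flowSeries F k q) := by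
  refine Summable.hasSum ?_
  obtain ⟨c, hc, H⟩ := exists_coeff_bound s (sub_pos.2 hR) k q
  have hθ := flow_ratio_lt hρ hf
  have hR0 : 0 ≤ R := by linarith
  have h0 : 0 ≤ Real.exp 1 * f / ρ := by positivity
  refine Summable.of_norm_bounded (g := fun n : ℕ => c * ((Real.exp 1 * f / ρ) ^ n * R)) ?_
    fun n => H _ _ (hF.iterate_lie_div hf0 hρ (bd_idField s R) hR0 n) (by positivity)
  exact Summable.mul_left _ (Summable.mul_right _ (summable_geometric_of_lt_one h0 (by linarith)))

theorem Bd.flowSeries (hF : Bd s R F f) (hf0 : 0 ≤ f) (hρ : 0 < ρ) (hR : ρ < R)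
    (hf : f ≤ ρ / (8 * Real.exp 1)) :
    Bd s (R - ρ) (flowSeries F) ((1 - Real.exp 1 * f / ρ)⁻¹ * R) := by
  have hθ := flow_ratio_lt hρ hf
  have hR0 : 0 ≤ R := by linarith
  have h0 : 0 ≤ Real.exp 1 * f / ρ := by positivity
  exact Bd.of_hasSum (fun n => hF.iterate_lie_div hf0 hρ (bd_idField s R) hR0 n)
    (fun n => by positivity) ((hasSum_geometric_of_lt_one h0 (by linarith)).mul_right R)
    (hasSum_flowSeries hF hf0 hρ hR hf)

theorem IsSolution.norm_sub_le {c : ℝ → G s} (hc : IsSolution s R F c) (hF : Bd s R F f)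
    (hf0 : 0 ≤ f) : ∀ t ∈ Set.Icc (0 : ℝ) 1, ‖c t - c 0‖ ≤ f := by
  choose! hlt v hv hd using hc
  intro t ht
  have hvE : ∀ t ∈ Set.Icc (0 : ℝ) 1, v t = EV s F (c t) := fun t ht =>
    G.ext fun k => by rw [hv t ht k, hF.EV_apply (hlt t ht)]; rfl
  have := norm_image_sub_le_of_norm_deriv_le_segment' (C := f) hd (fun t ht => by
    rw [hvE t (Set.Ico_subset_Icc_self ht)]
    exact hF.norm_EV_le hf0 (hlt t (Set.Ico_subset_Icc_self ht))) t ht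
  refine this.trans ?_
  rw [sub_zero]
  exact mul_le_of_le_one_right hf0 ht.2

/-- Along solutions, power series are given by their Lie series. -/
theorem IsSolution.hasSum_ev {c : ℝ → G s} (hc : IsSolution s R F c) (hF : Bd s R F f)
    (hf0 : 0 ≤ f) (hρ : 0 < ρ) (hf : f ≤ ρ / (8 * Real.exp 1))
    (h0 : ‖c 0‖ < R - 2 * ρ) {g : MIdx → ℂ} {M : ℝ} (hg : SBd s R g M) (hM : 0 ≤ M) :
    HasSum (fun n : ℕ => ((n ! : ℕ) : ℂ)⁻¹ * ev ((act F)^[n] g) (c 0)) (ev g (c 1)) := by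
  have hθ := flow_ratio_lt hρ hf
  have hθ0 : 0 ≤ Real.exp 1 * f / ρ := by positivity
  have hin : ∀ t ∈ Set.Icc (0 : ℝ) 1, ‖c t‖ < R - ρ := by
    intro t ht
    have h1 := hc.norm_sub_le hF hf0 t ht
    have h2 := flow_bound_le hρ hf
    have h3 := norm_le_norm_add_norm_sub' (c t) (c 0)
    linarith
  have hF' : Bd s (R - ρ) F f := hF.of_radius_le (by linarith)
  -- Along a solution the time derivative of a power series h is F[h], so the n-th derivative of g
  -- is F^n[g]; the n! growth of these bounds is what Taylor's formula tolerates.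
  refine hasSum_taylor_unit (φ' := fun n t => ev ((act F)^[n] g) (c t)) (θ := Real.exp 1 * f / ρ)
    (M := M) hθ0 (by linarith) (fun n t ht => ?_) fun n t ht => ?_
  · obtain ⟨hlt, v, hv, hd⟩ := hc t ht
    have hvE : v = EV s F (c t) := G.ext fun k => by rw [hv k, hF.EV_apply hlt]; rfl
    have hgn := hg.iterate_act hF hf0 hM hρ n
    have h1 := (hgn.analyticOnNhd (c t)
      (mem_ball_zero_iff.2 (hin t ht))).differentiableAt.hasFDerivAt
    have h2 := (h1.restrictScalars ℝ).comp_hasDerivWithinAt t hd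
    have h3 : fderiv ℂ (fun x : G s => ev ((act F)^[n] g) x) (c t) v
        = ev ((act F)^[n + 1] g) (c t) := by
      rw [hvE, hgn.fderiv_EV hF' (hin t ht), Function.iterate_succ_apply']
    rw [← h3]
    exact h2
  · have hgn := hg.iterate_act hF hf0 hM hρ n _ (wNorm_lt_of_norm_lt (hin t ht))
    have h4 := (enorm_ev_le ((act F)^[n] g) (c t)).trans hgn
    rw [← ofReal_norm] at h4
    exact (ENNReal.ofReal_le_ofReal_iff (by positivity)).1 h4

theorem sbd_idField (s R : ℝ) (k : Idx) : SBd s R (idField k) (R / weight s k) := by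
  intro y hy
  rw [idField, ser_diagField, enorm_one, one_mul, ENNReal.ofReal_div_of_pos (weight_pos s k),
    ENNReal.le_div_iff_mul_le (Or.inl (by simpa using weight_pos s k))
      (Or.inl ENNReal.ofReal_ne_top), mul_comm]
  exact (weight_mul_le_wNorm s y k).trans hy.le

/-- Solutions arrive at the value of the flow series. -/
theorem IsSolution.apply_one {c : ℝ → G s} (hc : IsSolution s R F c) (hF : Bd s R F f)
    (hf0 : 0 ≤ f) (hρ : 0 < ρ) (hR : 2 * ρ < R) (hf : f ≤ ρ / (8 * Real.exp 1))
    (h0 : ‖c 0‖ < R - 2 * ρ) : c 1 = EV s (flowSeries F) (c 0) := by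
  refine G.ext fun k => ?_
  have hθ := flow_ratio_lt hρ hf
  have hθ0 : 0 ≤ Real.exp 1 * f / ρ := by positivity
  have hR0 : 0 ≤ R := by linarith
  have h1 : ‖c 0‖ < R - ρ := by linarith
  rw [(hF.flowSeries hf0 hρ (by linarith) hf).EV_apply h1]
  have h2 := hc.hasSum_ev hF hf0 hρ hf h0 (sbd_idField s R k)
    (div_nonneg hR0 (weight_pos s k).le)
  rw [idField, ev_diagField, one_mul] at h2
  refine h2.unique ?_
  have hb : ∀ n, SBd s (R - ρ) ((act F)^[n] (idField k))
      (n ! * (Real.exp 1 * f / ρ) ^ n * (R / weight s k)) := fun n =>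
    (sbd_idField s R k).iterate_act hF hf0 (div_nonneg hR0 (weight_pos s k).le) hρ n
  have hw := weight_pos s k
  have h3 := hasSum_ev_of_hasSum (x := c 0)
    (f := fun (n : ℕ) q => ((n ! : ℕ) : ℂ)⁻¹ * (lie F)^[n] idField k q) (g := flowSeries F k) ?_
    (hasSum_flowSeries hF hf0 hρ (by linarith) hf k)
  · refine h3.congr_fun fun n => ?_
    rw [ev_const_mul, iterate_lie_apply]
    rfl
  · have hsum : Summable fun n : ℕ => (Real.exp 1 * f / ρ) ^ n * (R / weight s k) :=
      (summable_geometric_of_lt_one hθ0 (by linarith)).mul_right _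
    refine ne_top_of_le_ne_top (b := ∑' n : ℕ, ENNReal.ofReal
      ((Real.exp 1 * f / ρ) ^ n * (R / weight s k))) ?_ (ENNReal.tsum_le_tsum fun n => ?_)
    · rw [← ENNReal.ofReal_tsum_of_nonneg (fun n => by positivity) hsum]
      exact ENNReal.ofReal_ne_top
    · rw [ser_const_mul, iterate_lie_apply]
      refine (mul_le_mul_right (hb n _ (wNorm_lt_of_norm_lt h1)) _).trans (le_of_eq ?_)
      have hn : (n ! : ℝ) ≠ 0 := by exact_mod_cast (Nat.factorial_pos n).ne'
      rw [← ofReal_norm, ← ENNReal.ofReal_mul (norm_nonneg _), norm_inv, Complex.norm_natCast]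
      congr 1
      field_simp

/-- Cauchy's estimate on the complex line x + zh with |z| ≤ ρ/(2‖h‖): the line moves x by at most
ρ/2, so it stays in the ball where F is bounded by f. -/
theorem Bd.lipschitzOnWith (hF : Bd s R F f) (hf0 : 0 ≤ f) (hρ : 0 < ρ) {u : G s}
    (hu : ‖u‖ < R - 2 * ρ) :
    LipschitzOnWith (2 * f / ρ).toNNReal (EV s F) (Metric.closedBall u ρ) := by
  have hin : ∀ x ∈ Metric.closedBall u ρ, ‖x‖ < R - ρ := by
    intro x hx
    rw [mem_closedBall_iff_norm] at hx
    have h3 := norm_le_norm_add_norm_sub' x u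
    linarith
  refine Convex.lipschitzOnWith_of_nnnorm_fderiv_le (𝕜 := ℂ) (fun x hx =>
    (hF.analyticOnNhd hf0 x (mem_ball_zero_iff.2 (by linarith [hin x hx]))).differentiableAt)
    (fun x hx => ?_) (convex_closedBall u ρ)
  rw [← NNReal.coe_le_coe, coe_nnnorm, Real.coe_toNNReal _ (by positivity)]
  refine ContinuousLinearMap.opNorm_le_bound _ (by positivity) fun h => ?_
  by_cases hh : h = 0
  · simp [hh]
  have hh0 : 0 < ‖h‖ := norm_pos_iff.2 hh
  have hx' := hin x hx
  have hmem : ∀ z ∈ Metric.closedBall (0 : ℂ) (ρ / (2 * ‖h‖)), ‖x + z • h‖ < R := by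
    intro z hz
    rw [mem_closedBall_zero_iff] at hz
    have h1 : ‖z • h‖ ≤ ρ / 2 := by
      rw [norm_smul]
      calc _ ≤ ρ / (2 * ‖h‖) * ‖h‖ := by gcongr
        _ = ρ / 2 := by field_simp
    have := norm_add_le x (z • h)
    linarith
  have hline : ∀ z : ℂ, HasDerivAt (fun z : ℂ => x + z • h) h z := fun z => by
    simpa using ((hasDerivAt_id z).smul_const h).const_add x
  have hda : ∀ z ∈ Metric.closedBall (0 : ℂ) (ρ / (2 * ‖h‖)),
      HasDerivAt (fun z : ℂ => EV s F (x + z • h)) (fderiv ℂ (EV s F) (x + z • h) h) z := fun z hz =>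
    HasFDerivAt.comp_hasDerivAt (l := EV s F) (f := fun z : ℂ => x + z • h) z
      (hF.analyticOnNhd hf0 _ (mem_ball_zero_iff.2 (hmem z hz))).differentiableAt.hasFDerivAt
          (hline z)
  have hrad : 0 < ρ / (2 * ‖h‖) := by positivity
  have h2 := Complex.norm_deriv_le_of_forall_mem_sphere_norm_le (C := f) hrad
    (DifferentiableOn.diffContOnCl_ball (U := Metric.closedBall (0 : ℂ) (ρ / (2 * ‖h‖)))
      (fun z hz => (hda z hz).differentiableAt.differentiableWithinAt) subset_rfl)
    (fun z hz => hF.norm_EV_le hf0 (hmem z (Metric.sphere_subset_closedBall hz)))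
  rw [(hda 0 (Metric.mem_closedBall_self hrad.le)).deriv, zero_smul, add_zero] at h2
  refine h2.trans (le_of_eq ?_)
  field_simp

theorem Bd.exists_isSolution (hF : Bd s R F f) (hf0 : 0 ≤ f) (hρ : 0 < ρ)
    (hf : f ≤ ρ / (8 * Real.exp 1)) {u : G s} (hu : ‖u‖ < R - 2 * ρ) :
    ∃ c : ℝ → G s, IsSolution s R F c ∧ c 0 = u := by
  have hin : ∀ x ∈ Metric.closedBall u ρ, ‖x‖ < R := by
    intro x hx
    rw [mem_closedBall_iff_norm] at hx
    have h3 := norm_le_norm_add_norm_sub' x u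
    linarith
  have hPL : IsPicardLindelof (fun _ : ℝ => EV s F)
      (⟨0, le_rfl, zero_le_one⟩ : Set.Icc (0 : ℝ) 1) u ρ.toNNReal 0 f.toNNReal
      (2 * f / ρ).toNNReal := by
    refine ⟨fun t _ => ?_, fun x _ => continuousOn_const, fun t _ x hx => ?_, ?_⟩
    · rw [Real.coe_toNNReal _ hρ.le]
      exact hF.lipschitzOnWith hf0 hρ hu
    · rw [Real.coe_toNNReal _ hρ.le] at hx
      rw [Real.coe_toNNReal _ hf0]
      exact hF.norm_EV_le hf0 (hin x hx)
    · simp only [Real.coe_toNNReal _ hρ.le, Real.coe_toNNReal _ hf0]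
      simpa using flow_bound_le hρ hf
  -- The Picard fixed point is used directly because it comes with confinement to the closed ball of
  -- radius ρ about u, which `IsSolution` demands in addition to the equation.
  obtain ⟨α, hα⟩ := ODE.FunSpace.exists_isFixedPt_next hPL (Metric.mem_closedBall_self le_rfl)
  have hmem : ∀ t, α.compProj t ∈ Metric.closedBall u ρ := fun t => by
    have := α.compProj_mem_closedBall hPL.mul_max_le (t := t)
    rwa [Real.coe_toNNReal _ hρ.le] at this
  refine ⟨α.compProj, fun t ht => ⟨hin _ (hmem t), EV s F (α.compProj t),
    fun k => hF.EV_apply (hin _ (hmem t)) k, ?_⟩, ?_⟩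
  · have h1 := ODE.hasDerivWithinAt_picard_Icc (t₀ := 0) ⟨le_rfl, zero_le_one⟩
      hPL.continuousOn_uncurry
      α.continuous_compProj.continuousOn
      (fun _ _ => α.compProj_mem_closedBall hPL.mul_max_le) u ht
    refine h1.congr_of_mem ?_ ht
    intro t' ht'
    nth_rw 1 [← hα]
    rw [ODE.FunSpace.compProj_of_mem ht', ODE.FunSpace.next_apply]
  · have : α.compProj ((⟨0, le_rfl, zero_le_one⟩ : Set.Icc (0 : ℝ) 1) : ℝ) = u := by
      rw [ODE.FunSpace.compProj_val, ← hα, ODE.FunSpace.next_apply₀]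
    exact this

/-- The flow of a small vector field. -/
theorem Bd.isTimeOneFlow (hF : Bd s R F f) (hf0 : 0 ≤ f) (hρ : 0 < ρ) (hR : 2 * ρ < R)
    (hf : f ≤ ρ / (8 * Real.exp 1)) :
    IsTimeOneFlow s (R - 2 * ρ) R F (EV s (ResonantNF.flowSeries F)) := by
  intro u hu
  refine ⟨?_, ?_⟩
  · obtain ⟨c, hc, hc0⟩ := hF.exists_isSolution hf0 hρ hf hu
    exact ⟨c, hc, hc0, by rw [hc.apply_one hF hf0 hρ hR hf (by rwa [hc0]), hc0]⟩
  · intro c hc hc0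
    rw [hc.apply_one hF hf0 hρ hR hf (by rwa [hc0]), hc0]

theorem Bd.norm_flow_sub_le (hF : Bd s R F f) (hf0 : 0 ≤ f) (hρ : 0 < ρ) (hR : 2 * ρ < R)
    (hf : f ≤ ρ / (8 * Real.exp 1)) {u : G s} (hu : ‖u‖ < R - 2 * ρ) :
    ‖EV s (ResonantNF.flowSeries F) u - u‖ ≤ f := by
  obtain ⟨c, hc, hc0⟩ := hF.exists_isSolution hf0 hρ hf hu
  have h1 := hc.apply_one hF hf0 hρ hR hf (by rwa [hc0])
  have h2 := hc.norm_sub_le hF hf0 1 ⟨zero_le_one, le_rfl⟩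
  rwa [h1, hc0] at h2

theorem Bd.hasSum_ev_flow (hF : Bd s R F f) (hf0 : 0 ≤ f) (hρ : 0 < ρ) (hR : 2 * ρ < R)
    (hf : f ≤ ρ / (8 * Real.exp 1)) {u : G s} (hu : ‖u‖ < R - 2 * ρ) {g : MIdx → ℂ} {M : ℝ}
    (hg : SBd s R g M) (hM : 0 ≤ M) :
    HasSum (fun n : ℕ => ((n ! : ℕ) : ℂ)⁻¹ * ev ((act F)^[n] g) u)
      (ev g (EV s (ResonantNF.flowSeries F) u)) := by
  obtain ⟨c, hc, hc0⟩ := hF.exists_isSolution hf0 hρ hf hu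
  have h1 := hc.hasSum_ev hF hf0 hρ hf (by rwa [hc0]) hg hM
  rwa [hc.apply_one hF hf0 hρ hR hf (by rwa [hc0]), hc0] at h1

end flow

/-! ### The Leibniz rule for the Lie series -/

/-- A coefficient family as a formal power series. -/
def toPS (f : MIdx → ℂ) : MvPowerSeries Idx ℂ := f

/-- A vector field with finitely many components acting on a power series. -/
def tact (T : Finset Idx) (X : Idx → MvPowerSeries Idx ℂ) (f : MvPowerSeries Idx ℂ) :
    MvPowerSeries Idx ℂ := ∑ j ∈ T, X j * MvPowerSeries.pderiv ℂ j f

theorem coeff_mul_pderiv (X f : MvPowerSeries Idx ℂ) (j : Idx) (q : MIdx) :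
    MvPowerSeries.coeff q (X * MvPowerSeries.pderiv ℂ j f)
      = ∑ p ∈ adiag q, MvPowerSeries.coeff p.1 X *
          (((p.2 j : ℂ) + 1) * MvPowerSeries.coeff (p.2 + Finsupp.single j 1) f) := by
  classical
  rw [MvPowerSeries.coeff_mul]
  refine Finset.sum_congr rfl fun p _ => ?_
  rw [MvPowerSeries.coeff_pderiv]
  ring

theorem momF_tact {m : ℤ} {T : Finset Idx} {X : Idx → MvPowerSeries Idx ℂ}
    {f : MvPowerSeries Idx ℂ} (hX : ∀ j, MomF (mom j) fun q => MvPowerSeries.coeff q (X j))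
    (hf : MomF m fun q => MvPowerSeries.coeff q f) :
    MomF m fun q => MvPowerSeries.coeff q (tact T X f) := by
  intro q hq
  beta_reduce at hq
  rw [tact, map_sum] at hq
  obtain ⟨j, _, hj⟩ := Finset.exists_ne_zero_of_sum_ne_zero hq
  rw [coeff_mul_pderiv] at hj
  obtain ⟨p, hp, hne⟩ := Finset.exists_ne_zero_of_sum_ne_zero hj
  have h1 := hX j _ (left_ne_zero_of_mul hne)
  have h2 := hf _ (right_ne_zero_of_mul (right_ne_zero_of_mul hne))
  rw [momN_add, momN_single] at h2
  rw [← mem_adiag.1 hp, momN_add]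
  linarith

/-- A coefficient of X[f] depends on finitely many variables and coefficients, so X and f may be
replaced by series that agree with them only there. This freedom is needed for f' and X' that are
themselves truncated derivatives. -/
theorem act_eq_coeff_tact {m : ℤ} {f : MIdx → ℂ} {f' : MvPowerSeries Idx ℂ} {q : MIdx}
    {T : Finset Idx} {X : FVF} {X' : Idx → MvPowerSeries Idx ℂ} (hf : MomF m f)
    (hf' : MomF m fun q => MvPowerSeries.coeff q f') (hT : indexSet m q ⊆ T)
    (hX : ∀ j ∈ indexSet m q, ∀ p ∈ Set.Iic q, MvPowerSeries.coeff p (X' j) = X j p)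
    (hff : ∀ j ∈ indexSet m q, ∀ p ∈ Set.Iic q,
      MvPowerSeries.coeff (p + Finsupp.single j 1) f' = f (p + Finsupp.single j 1)) :
    act X f q = MvPowerSeries.coeff q (tact T X' f') := by
  rw [act_apply, tact, map_sum, tsum_eq_sum (s := T)]
  · refine Finset.sum_congr rfl fun j _ => ?_
    rw [coeff_mul_pderiv]
    refine Finset.sum_congr rfl fun p hp => ?_
    have hpq := mem_adiag.1 hp
    by_cases hj : j ∈ indexSet m q
    · rw [hX j hj p.1 (by rw [Set.mem_Iic, ← hpq]; exact le_self_add),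
        hff j hj p.2 (by rw [Set.mem_Iic, ← hpq]; exact le_add_self)]
    · have e1 : f (p.2 + Finsupp.single j 1) = 0 := by
        by_contra hne
        exact hj (mem_indexSet hf hpq hne)
      have e2 : MvPowerSeries.coeff (p.2 + Finsupp.single j 1) f' = 0 := by
        by_contra hne
        exact hj (mem_indexSet hf' hpq hne)
      rw [e1, e2]
      simp
  · intro j hj
    refine Finset.sum_eq_zero fun p hp => ?_
    have e1 : f (p.2 + Finsupp.single j 1) = 0 := by
      by_contra hne
      exact hj (by exact_mod_cast hT (mem_indexSet hf (mem_adiag.1 hp) hne))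
    rw [e1]
    simp

theorem eventually_indexSet_subset (m : ℤ) (q : MIdx) :
    ∀ᶠ T : Finset Idx in Filter.atTop, indexSet m q ⊆ T := by
  filter_upwards [Filter.eventually_ge_atTop (finite_indexSet m q).toFinset] with T hT
  intro j hj
  exact hT ((finite_indexSet m q).mem_toFinset.2 hj)

theorem eventually_coeff_tact {m : ℤ} {f : MIdx → ℂ} (hf : MomF m f) (X : FVF) (q : MIdx) :
    ∀ᶠ T : Finset Idx in Filter.atTop,
      MvPowerSeries.coeff q (tact T (fun j => toPS (X j)) (toPS f)) = act X f q := by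
  filter_upwards [eventually_indexSet_subset m q] with T hT
  exact (act_eq_coeff_tact hf hf hT (fun _ _ _ _ => rfl) fun _ _ _ _ => rfl).symm

theorem eventually_coeff_tact_shift {m : ℤ} {f : MIdx → ℂ} (hf : MomF m f) (X : FVF) (q : MIdx) :
    ∀ᶠ T : Finset Idx in Filter.atTop, ∀ j ∈ indexSet m q, ∀ p ∈ Set.Iic q,
      MvPowerSeries.coeff (p + Finsupp.single j 1) (tact T (fun j => toPS (X j)) (toPS f))
        = act X f (p + Finsupp.single j 1) :=
  (Filter.eventually_all_finite (finite_indexSet m q)).2 fun _ _ =>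
    (Filter.eventually_all_finite (Set.finite_Iic q)).2 fun _ _ => eventually_coeff_tact hf X _

theorem eventually_coeff_tact_lie {m : ℤ} {X Y : FVF} (hY : MomV Y) (q : MIdx) :
    ∀ᶠ T : Finset Idx in Filter.atTop, ∀ j ∈ indexSet m q, ∀ p ∈ Set.Iic q,
      MvPowerSeries.coeff p (tact T (fun j => toPS (X j)) (toPS (Y j))) = act X (Y j) p :=
  (Filter.eventually_all_finite (finite_indexSet m q)).2 fun j _ =>
    (Filter.eventually_all_finite (Set.finite_Iic q)).2 fun _ _ => eventually_coeff_tact (hY j) X _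

theorem pderiv_comm (i j : Idx) (f : MvPowerSeries Idx ℂ) :
    MvPowerSeries.pderiv ℂ i (MvPowerSeries.pderiv ℂ j f)
      = MvPowerSeries.pderiv ℂ j (MvPowerSeries.pderiv ℂ i f) := by
  classical
  ext q
  simp only [MvPowerSeries.coeff_pderiv, Finsupp.coe_add, Pi.add_apply, Nat.cast_add]
  rw [add_right_comm q]
  by_cases hij : i = j
  · subst hij; rfl
  · rw [Finsupp.single_eq_of_ne hij, Finsupp.single_eq_of_ne (Ne.symm hij)]
    simp only [Nat.cast_zero, add_zero]
    ring

/-- Both compositions contain the same second-order terms because partial derivatives commute; the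
first-order terms form the commutator field. -/
theorem tact_tact (T : Finset Idx) (F Y : Idx → MvPowerSeries Idx ℂ) (g : MvPowerSeries Idx ℂ) :
    tact T F (tact T Y g)
      = tact T (fun j => tact T F (Y j) - tact T Y (F j)) g + tact T Y (tact T F g) := by
  have key : ∀ F Y : Idx → MvPowerSeries Idx ℂ, tact T F (tact T Y g)
      = (∑ j ∈ T, tact T F (Y j) * MvPowerSeries.pderiv ℂ j g) + ∑ i ∈ T, ∑ j ∈ T,
        F i * Y j * MvPowerSeries.pderiv ℂ i (MvPowerSeries.pderiv ℂ j g) := by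
    intro F Y
    have e : ∑ j ∈ T, tact T F (Y j) * MvPowerSeries.pderiv ℂ j g
        = ∑ i ∈ T, ∑ j ∈ T, F i * MvPowerSeries.pderiv ℂ i (Y j) * MvPowerSeries.pderiv ℂ j g := by
      rw [Finset.sum_comm]
      refine Finset.sum_congr rfl fun j _ => ?_
      rw [tact, Finset.sum_mul]
    rw [e, ← Finset.sum_add_distrib, tact]
    refine Finset.sum_congr rfl fun i _ => ?_
    rw [tact, map_sum, Finset.mul_sum, ← Finset.sum_add_distrib]
    refine Finset.sum_congr rfl fun j _ => ?_
    rw [Derivation.leibniz, smul_eq_mul, smul_eq_mul]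
    ring
  have e2 : ∑ i ∈ T, ∑ j ∈ T, F i * Y j * MvPowerSeries.pderiv ℂ i (MvPowerSeries.pderiv ℂ j g)
      = ∑ i ∈ T, ∑ j ∈ T, Y i * F j * MvPowerSeries.pderiv ℂ i (MvPowerSeries.pderiv ℂ j g) := by
    rw [Finset.sum_comm]
    refine Finset.sum_congr rfl fun i _ => Finset.sum_congr rfl fun j _ => ?_
    rw [pderiv_comm i j]
    ring
  have e3 : tact T (fun j => tact T F (Y j) - tact T Y (F j)) g
      = (∑ j ∈ T, tact T F (Y j) * MvPowerSeries.pderiv ℂ j g)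
        - ∑ j ∈ T, tact T Y (F j) * MvPowerSeries.pderiv ℂ j g := by
    rw [tact, ← Finset.sum_sub_distrib]
    exact Finset.sum_congr rfl fun j _ => sub_mul _ _ _
  rw [key F Y, key Y F, e2, e3]
  ring

/-- The bracket acts as the commutator. -/
theorem act_act {m : ℤ} {F Y : FVF} {g : MIdx → ℂ} (hF : MomV F) (hY : MomV Y) (hg : MomF m g) :
    act F (act Y g) = act (bracket F Y) g + act Y (act F g) := by
  funext q
  -- For T large, all truncated coefficients entering at q are exact, so the identity of the finite
  -- case transfers to this coefficient.
  have hT : ∀ᶠ T : Finset Idx in Filter.atTop, act F (act Y g) q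
      = act (bracket F Y) g q + act Y (act F g) q := by
    filter_upwards [eventually_indexSet_subset m q, eventually_coeff_tact_shift hg Y q,
      eventually_coeff_tact_shift hg F q, eventually_coeff_tact_lie (m := m) (X := F) hY q,
      eventually_coeff_tact_lie (m := m) (X := Y) hF q] with T h0 h1 h2 h3 h4
    rw [act_eq_coeff_tact (X := F) (hg.act hY) (momF_tact (T := T) (X := fun j => toPS (Y j))
        (f := toPS g)
        hY hg) h0 (X' := fun j => toPS (F j)) (fun _ _ _ _ => rfl) h1,
      act_eq_coeff_tact (X := Y) (hg.act hF) (momF_tact (T := T) (X := fun j => toPS (F j))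
          (f := toPS g)
        hF hg) h0 (X' := fun j => toPS (Y j)) (fun _ _ _ _ => rfl) h2,
      act_eq_coeff_tact (X := bracket F Y) hg (f' := toPS g) hg h0
        (X' := fun j => tact T (fun i => toPS (F i)) (toPS (Y j))
          - tact T (fun i => toPS (Y i)) (toPS (F j))) (fun j hj p hp => ?_) fun _ _ _ _ => rfl,
      ← map_add, tact_tact]
    rw [map_sub, h3 j hj p hp, h4 j hj p hp, bracket_eq hF hY]
    rfl
  exact hT.exists.choose_spec

theorem MomF.const_mul {m : ℤ} {f : MIdx → ℂ} (hf : MomF m f) (c : ℂ) :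
    MomF m fun q => c * f q := fun q hq => hf q (right_ne_zero_of_mul hq)

theorem MomF.iterate_act {m : ℤ} {F : FVF} {f : MIdx → ℂ} (hf : MomF m f) (hF : MomV F) (n : ℕ) :
    MomF m ((ResonantNF.act F)^[n] f) := by
  induction n with
  | zero => exact hf
  | succ n ih => rw [Function.iterate_succ_apply']; exact ih.act hF

theorem MomF.sum {m : ℤ} {ι : Type*} {T : Finset ι} {f : ι → MIdx → ℂ}
    (hf : ∀ i ∈ T, MomF m (f i)) : MomF m (∑ i ∈ T, f i) := by
  intro q hq
  rw [Finset.sum_apply] at hq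
  obtain ⟨i, hi, hne⟩ := Finset.exists_ne_zero_of_sum_ne_zero hq
  exact hf i hi q hne

theorem act_zero_right (X : FVF) : act X 0 = 0 := by
  funext q
  simp [act]

theorem act_sum_right {m : ℤ} {ι : Type*} (X : FVF) {T : Finset ι} {f : ι → MIdx → ℂ}
    (hf : ∀ i ∈ T, MomF m (f i)) : act X (∑ i ∈ T, f i) = ∑ i ∈ T, act X (f i) := by
  classical
  induction T using Finset.induction_on with
  | empty => simp [act_zero_right]
  | insert a T ha ih =>
    have hf' : ∀ i ∈ T, MomF m (f i) := fun i hi => hf i (Finset.mem_insert_of_mem hi)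
    rw [Finset.sum_insert ha, Finset.sum_insert ha, act_add_right X
      (hf a (Finset.mem_insert_self _ _)) (MomF.sum hf'), ih hf']

theorem act_const_mul_left (c : ℂ) (X : FVF) (f : MIdx → ℂ) :
    act (fun k q => c * X k q) f = fun q => c * act X f q := by
  funext q
  simp only [act, ← tsum_mul_left, Finset.mul_sum]
  refine tsum_congr fun j => Finset.sum_congr rfl fun p _ => by ring

/-- `ad_F^n W / n!`. -/
def adDiv (F W : FVF) (n : ℕ) : FVF := fun k q => ((n ! : ℕ) : ℂ)⁻¹ * (bracket F)^[n] W k q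

/-- `F^n[g] / n!`. -/
def actDiv (F : FVF) (g : MIdx → ℂ) (n : ℕ) : MIdx → ℂ := fun q =>
  ((n ! : ℕ) : ℂ)⁻¹ * (act F)^[n] g q

theorem momF_actDiv {m : ℤ} {F : FVF} {g : MIdx → ℂ} (hF : MomV F) (hg : MomF m g) (n : ℕ) :
    MomF m (actDiv F g n) := (hg.iterate_act hF n).const_mul _

theorem momV_adDiv {F W : FVF} (hF : MomV F) (hW : MomV W) (n : ℕ) : MomV (adDiv F W n) :=
  fun k => (momV_iterate_bracket hF hW n k).const_mul _

theorem inv_factorial_eq (n : ℕ) :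
    ((n ! : ℕ) : ℂ)⁻¹ = ((n : ℂ) + 1) * (((n + 1) ! : ℕ) : ℂ)⁻¹ := by
  have h1 : ((n ! : ℕ) : ℂ) ≠ 0 := by exact_mod_cast (Nat.factorial_pos n).ne'
  have h2 : (n : ℂ) + 1 ≠ 0 := by exact_mod_cast n.succ_ne_zero
  rw [Nat.factorial_succ]
  push_cast
  field_simp

theorem act_actDiv (F : FVF) (g : MIdx → ℂ) (n : ℕ) :
    act F (actDiv F g n) = fun q => ((n : ℂ) + 1) * actDiv F g (n + 1) q := by
  have e : actDiv F g n = fun q => ((n ! : ℕ) : ℂ)⁻¹ * (act F)^[n] g q := rfl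
  rw [e, act_const_mul]
  funext q
  rw [actDiv, inv_factorial_eq, Function.iterate_succ_apply', mul_assoc]

theorem bracket_const_mul_right (F X : FVF) (c : ℂ) :
    bracket F (fun k q => c * X k q) = fun k q => c * bracket F X k q := by
  funext k q
  simp only [bracket, ← tsum_mul_left, Finset.mul_sum]
  refine tsum_congr fun j => Finset.sum_congr rfl fun p _ => by ring

theorem bracket_adDiv (F W : FVF) (n : ℕ) :
    bracket F (adDiv F W n) = fun k q => ((n : ℂ) + 1) * adDiv F W (n + 1) k q := by
  have e : adDiv F W n = fun k q => ((n ! : ℕ) : ℂ)⁻¹ * (bracket F)^[n] W k q := rfl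
  rw [e, bracket_const_mul_right]
  funext k q
  rw [adDiv, inv_factorial_eq, Function.iterate_succ_apply', mul_assoc]

/-- The Leibniz rule for the iterates of a vector field. -/
theorem actDiv_act {m : ℤ} {F W : FVF} {g : MIdx → ℂ} (hF : MomV F) (hW : MomV W) (hg : MomF m g)
    (n : ℕ) : actDiv F (act W g) n
      = ∑ p ∈ Finset.HasAntidiagonal.antidiagonal n, act (adDiv F W p.1) (actDiv F g p.2) := by
  induction n with
  | zero =>
    have e1 : adDiv F W 0 = W := by funext k q; simp [adDiv]
    have e2 : ∀ g : MIdx → ℂ, actDiv F g 0 = g := by intro g; funext q; simp [actDiv]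
    simp [e1, e2]
  | succ n ih =>
    have h1 := act_actDiv F (act W g) n
    rw [ih, act_sum_right F (m := m) (fun p _ => (momF_actDiv hF hg p.2).act
        (momV_adDiv hF hW p.1))]
      at h1
    have h2 : ∀ p : ℕ × ℕ, act F (act (adDiv F W p.1) (actDiv F g p.2))
        = (fun q => ((p.1 : ℂ) + 1) * act (adDiv F W (p.1 + 1)) (actDiv F g p.2) q)
          + fun q => ((p.2 : ℂ) + 1) * act (adDiv F W p.1) (actDiv F g (p.2 + 1)) q := by
      intro p
      rw [act_act hF (momV_adDiv hF hW p.1) (momF_actDiv hF hg p.2), bracket_adDiv, act_actDiv,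
        act_const_mul, act_const_mul_left]
    -- Multiply by n + 1 = p₁ + p₂ and split: the weight p₁ accounts for the shift in `adDiv`, the
    -- weight p₂ for that in `actDiv`.
    have h3 : ∀ q, ((n : ℂ) + 1) * actDiv F (act W g) (n + 1) q = ((n : ℂ) + 1) *
        (∑ p ∈ Finset.HasAntidiagonal.antidiagonal (n + 1), act (adDiv F W p.1) (actDiv F g p.2)) q := by
      intro q
      rw [← congrFun h1 q, Finset.sum_apply, Finset.sum_apply, Finset.mul_sum]
      have e1 : ∑ p ∈ Finset.HasAntidiagonal.antidiagonal (n + 1), ((n : ℂ) + 1) *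
            act (adDiv F W p.1) (actDiv F g p.2) q
          = (∑ p ∈ Finset.HasAntidiagonal.antidiagonal (n + 1), (p.1 : ℂ) * act (adDiv F W p.1)
              (actDiv F g p.2) q)
            + ∑ p ∈ Finset.HasAntidiagonal.antidiagonal (n + 1),
              (p.2 : ℂ) * act (adDiv F W p.1) (actDiv F g p.2) q := by
        rw [← Finset.sum_add_distrib]
        refine Finset.sum_congr rfl fun p hp => ?_
        have : ((p.1 + p.2 : ℕ) : ℂ) = ((n + 1 : ℕ) : ℂ) := by
          rw [Finset.HasAntidiagonal.mem_antidiagonal.1 hp]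
        push_cast at this
        rw [← this]
        ring
      rw [e1, Finset.Nat.sum_antidiagonal_succ (f := fun p : ℕ × ℕ => (p.1 : ℂ) * _),
        Finset.Nat.sum_antidiagonal_succ' (f := fun p : ℕ × ℕ => (p.2 : ℂ) * _)]
      simp only [Nat.cast_zero, zero_mul, zero_add]
      rw [← Finset.sum_add_distrib]
      refine Finset.sum_congr rfl fun p _ => ?_
      rw [h2 p]
      push_cast
      rfl
    funext q
    have hn : (n : ℂ) + 1 ≠ 0 := by exact_mod_cast n.succ_ne_zero
    exact mul_left_cancel₀ hn (h3 q)

/-! ### Conjugation -/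

theorem ev_sum {ι : Type*} {T : Finset ι} {f : ι → MIdx → ℂ} {x : Idx → ℂ}
    (h : ∀ i ∈ T, ser (f i) (fun i => ‖x i‖ₑ) ≠ ⊤) : ev (∑ i ∈ T, f i) x = ∑ i ∈ T, ev (f i) x := by
  have := (hasSum_sum fun i hi => hasSum_ev (h i hi)).tsum_eq
  rw [← this, ev]
  refine tsum_congr fun q => ?_
  rw [Finset.sum_apply, Finset.sum_mul]

theorem enorm_dmono_le (x h : Idx → ℂ) (q : MIdx) :
    ‖dmono x h q‖ₑ ≤ dmono (fun i => ‖x i‖ₑ) (fun i => ‖h i‖ₑ) q := by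
  refine (enorm_sum_le _ _).trans (Finset.sum_le_sum fun j _ => le_of_eq ?_)
  rw [enorm_mul, enorm_mul, enorm_mono]
  congr 2
  rw [← ofReal_norm, Complex.norm_natCast, ENNReal.ofReal_natCast]

theorem SBd.tsum_dmono_le {s r δ A M : ℝ} {f : MIdx → ℂ} (hf : SBd s r f M) {y h : Idx → ℝ≥0∞}
    (hδ : 0 < δ) (hA : 0 ≤ A) (hy : wNorm s y < ENNReal.ofReal (r - δ))
    (hh : wNorm s h ≤ ENNReal.ofReal A) :
    ∑' q, ‖f q‖ₑ * dmono y h q ≤ ENNReal.ofReal (A * (M / δ)) := by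
  refine le_of_forall_le_ofReal_mul fun A' hA' => ?_
  have hA'0 : 0 < A' := hA.trans_lt hA'
  refine le_ofReal_of_mul_le hA'0 hδ ((mul_tsum_dmono_le f y h _).trans (hf _ ?_))
  exact wNorm_add_const_mul_lt hA'0 hδ hy (hh.trans (ENNReal.ofReal_le_ofReal hA'.le))

theorem Bd.sbd {s r B : ℝ} {V : FVF} (h : Bd s r V B) (k : Idx) :
    SBd s r (V k) (B / weight s k) := by
  intro y hy
  rw [ENNReal.ofReal_div_of_pos (weight_pos s k),
    ENNReal.le_div_iff_mul_le (Or.inl (by simpa using weight_pos s k))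
      (Or.inl ENNReal.ofReal_ne_top), mul_comm]
  exact (weight_mul_le_wNorm s (serV V y) k).trans (h y hy)

theorem SBd.actDiv {s R ρ f M : ℝ} {F : FVF} {g : MIdx → ℂ} (hg : SBd s R g M) (hF : Bd s R F f)
    (hf0 : 0 ≤ f) (hM : 0 ≤ M) (hρ : 0 < ρ) (n : ℕ) :
    SBd s (R - ρ) (actDiv F g n) ((Real.exp 1 * f / ρ) ^ n * M) := by
  intro y hy
  unfold ResonantNF.actDiv
  rw [ser_const_mul]
  refine (mul_le_mul_right (hg.iterate_act hF hf0 hM hρ n y hy) _).trans (le_of_eq ?_)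
  have hn : (n ! : ℝ) ≠ 0 := by exact_mod_cast (Nat.factorial_pos n).ne'
  rw [← ofReal_norm, ← ENNReal.ofReal_mul (norm_nonneg _), norm_inv, Complex.norm_natCast]
  congr 1
  field_simp

theorem serV_add_le (V V' : FVF) (y : Idx → ℝ≥0∞) (k : Idx) :
    serV (V + V') y k ≤ (serV V y + serV V' y) k := ser_add_le (V k) (V' k) y

/-- `D(λ)` is bounded from `g_{s'}` to `g_s` for `s' > s`. -/
theorem wNorm_serV_diagField_ne_top {s s' : ℝ} (hs : s < s') {lam : Idx → ℂ}
    (hlam : ∀ k, ‖lam k‖ ≤ 2 * bra k ^ 2) {y : Idx → ℝ≥0∞} (hy : wNorm s' y ≠ ⊤) :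
    wNorm s (serV (diagField lam) y) ≠ ⊤ := by
  set σ := s' - s with hσ
  have hσ0 : 0 < σ := by linarith
  have hle : ∀ k, serV (diagField lam) y k ≤ ENNReal.ofReal (48 / σ ^ 4) *
      (ENNReal.ofReal (Real.exp (σ * √(bra k))) * y k) := by
    intro k
    -- The fourth term t⁴/4! of e^t at t = σ√⟨k⟩ controls ⟨k⟩², and 48 = 2·4!.
    have h1 : ‖lam k‖ ≤ 48 / σ ^ 4 * Real.exp (σ * √(bra k)) := by
      have h2 := Real.pow_div_factorial_le_exp (σ * √(bra k)) (by positivity) 4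
      have h3 : (σ * √(bra k)) ^ 4 = σ ^ 4 * bra k ^ 2 := by
        rw [mul_pow]
        congr 1
        rw [show (4 : ℕ) = 2 * 2 from rfl, pow_mul, Real.sq_sqrt (bra_pos k).le]
      rw [h3] at h2
      norm_num [Nat.factorial] at h2
      rw [div_mul_eq_mul_div, le_div_iff₀ (by positivity)]
      have h4 := mul_le_mul_of_nonneg_right (hlam k) (by positivity : (0 : ℝ) ≤ σ ^ 4)
      linarith
    rw [serV, ser_diagField, ← mul_assoc, ← ENNReal.ofReal_mul (by positivity), ← ofReal_norm]
    exact mul_le_mul_left (ENNReal.ofReal_le_ofReal h1) _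
  refine ne_top_of_le_ne_top ?_ (wNorm_mono hle)
  rw [wNorm_const_mul, ← wNorm_add_eq, show s + σ = s' by ring]
  exact ENNReal.mul_ne_top ENNReal.ofReal_ne_top hy

theorem act_idField (W : FVF) (k : Idx) : act W (idField k) = W k := by
  funext q
  rw [idField, act_diagField_right, one_mul]

section conj

variable {s R ρ f g B : ℝ} {F U : FVF} {lam : Idx → ℂ}

/-- The terms of the Lie exponential are summable as elements of `g_s`. -/
theorem exists_adDiv_bound {W : FVF} (hF : Bd s R F f) (hf0 : 0 ≤ f) (hρ : 0 < ρ)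
    (hf : f ≤ ρ / (8 * Real.exp 1)) (hmF : MomV F)
    (hG : Bd s (R - ρ) (bracket F W) g) (hg : 0 ≤ g) (hmG : MomV (bracket F W))
    {y : Idx → ℝ≥0∞} (hy : wNorm s y < ENNReal.ofReal (R - 2 * ρ))
    (hW : wNorm s (serV W y) ≠ ⊤) :
    ∃ A : ℕ → ℝ, (∀ a, 0 ≤ A a) ∧ Summable A ∧
      ∀ a, wNorm s (serV (adDiv F W a) y) ≤ ENNReal.ofReal (A a) := by
  set θ := Real.exp 1 * (2 * f) / (ρ / 2) with hθ
  have hθ0 : 0 ≤ θ := by positivity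
  have hθ1 : θ < 1 := by
    rw [le_div_iff₀ (by positivity)] at hf
    rw [hθ, div_lt_one (by positivity)]
    nlinarith
  -- From the first bracket on, the iterates are bounded fields. The term a = 0 is W itself, for
  -- which only finiteness at y is available.
  have hb : ∀ a, Bd s (R - ρ - ρ / 2) (adDiv F W (a + 1)) (θ ^ a * g) := by
    intro a
    refine (((hF.of_radius_le (by linarith)).iterate_bracket hG hmF hmG hf0 hg (half_pos hρ)
      a).const_mul ((((a + 1) ! : ℕ) : ℂ)⁻¹)).of_le ?_
    rw [norm_inv, Complex.norm_natCast, mul_assoc, ← mul_assoc]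
    refine mul_le_of_le_one_left (by positivity) ?_
    rw [inv_mul_le_one₀ (by positivity)]
    exact_mod_cast Nat.factorial_le (by omega)
  refine ⟨fun a => Nat.casesOn a (wNorm s (serV W y)).toReal fun a => θ ^ a * g, ?_, ?_, ?_⟩
  · rintro (_ | a)
    · exact ENNReal.toReal_nonneg
    · exact mul_nonneg (pow_nonneg hθ0 a) hg
  · exact (summable_nat_add_iff 1).1 ((summable_geometric_of_lt_one hθ0 hθ1).mul_right g)
  · rintro (_ | a)
    · have e1 : adDiv F W 0 = W := by funext k q; simp [adDiv]
      rw [e1]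
      exact (ENNReal.ofReal_toReal hW).ge
    · exact hb a y (hy.trans_le (ENNReal.ofReal_le_ofReal (by linarith)))

/-- The flow of `F` conjugates `W` to `exp(L_F) W`. -/
theorem conjugates_flow {Wp : FVF} (hF : Bd s R F f) (hf0 : 0 ≤ f) (hρ : 0 < ρ) (hR : 2 * ρ < R)
    (hf : f ≤ ρ / (8 * Real.exp 1)) (hmF : MomV F) (hU : Bd s R U B) (hB : 0 ≤ B) (hmU : MomV U)
    (hG : Bd s (R - ρ) (bracket F (diagField lam + U)) g) (hg : 0 ≤ g)
    (hlam : ∀ k, ‖lam k‖ ≤ 2 * bra k ^ 2)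
    (hexp : IsLieExp F (diagField lam + U) Wp) :
    Conjugates s (R - 2 * ρ) (EV s (flowSeries F)) (diagField lam + U) Wp := by
  intro s' hs x hx'
  set W := diagField lam + U with hW
  have hmW : MomV W := (momV_diagField lam).add hmU
  set y : Idx → ℝ≥0∞ := fun i => ‖x i‖ₑ with hy
  have hxs : wNorm s y < ENNReal.ofReal (R - 2 * ρ) := (wNorm_le_of_le hs.le y).trans_lt hx'
  have hx : ‖x‖ < R - 2 * ρ := norm_lt_of_wNorm_lt hxs
  have hxs1 : wNorm s y < ENNReal.ofReal (R - ρ - ρ) := by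
    rwa [show R - ρ - ρ = R - 2 * ρ by ring]
  have hxs2 : wNorm s y < ENNReal.ofReal (R - ρ) :=
    hxs.trans_le (ENNReal.ofReal_le_ofReal (by linarith))
  have hWy : wNorm s (serV W y) ≠ ⊤ := by
    refine ne_top_of_le_ne_top ?_ ((wNorm_mono (serV_add_le (diagField lam) U y)).trans
      (wNorm_add_le _ _ _))
    refine ENNReal.add_ne_top.2 ⟨wNorm_serV_diagField_ne_top hs hlam
      (hx'.trans ENNReal.ofReal_lt_top).ne, ?_⟩
    exact ((hU y (hxs.trans_le (ENNReal.ofReal_le_ofReal (by linarith)))).trans_lt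
      ENNReal.ofReal_lt_top).ne
  obtain ⟨A, hA0, hAs, hA⟩ := exists_adDiv_bound hF hf0 hρ hf hmF hG hg (hmF.bracket hmW) hxs hWy
  have hAne : ∀ a, wNorm s (serV (adDiv F W a) y) ≠ ⊤ := fun a =>
    ((hA a).trans_lt ENNReal.ofReal_lt_top).ne
  -- the vector `v = W₊(x)`
  have hva : ∀ a, wNorm s (fun k => ‖evalVF (adDiv F W a) x k‖ₑ) ≤ ENNReal.ofReal (A a) := fun a =>
    (wNorm_mono fun k => enorm_ev_le (adDiv F W a k) x).trans (hA a)
  set va : ℕ → G s := fun a => toG s (evalVF (adDiv F W a) x) with hvadef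
  have hvac : ∀ a k, va a k = ev (adDiv F W a k) x := fun a k =>
    toG_apply ((hva a).trans_lt ENNReal.ofReal_lt_top).ne k
  have hvan : ∀ a, ‖va a‖ ≤ A a := fun a => norm_toG_le (hA0 a) (hva a)
  have hvs : HasSum va (∑' a, va a) := (Summable.of_norm_bounded hAs hvan).hasSum
  set v := ∑' a, va a with hv
  have hvk : ∀ k, v k = evalVF Wp x k := by
    intro k
    have h1 := (coordG s k).hasSum hvs
    refine h1.unique ?_
    have h2 := hasSum_ev_of_hasSum (f := fun a => adDiv F W a k) (g := Wp k) (x := x) ?_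
      (hexp k)
    · exact h2.congr_fun fun a => hvac a k
    · refine apply_ne_top_of_wNorm_ne_top (ne_top_of_le_ne_top ?_
        (wNorm_tsum_le s fun a => serV (adDiv F W a) y)) k
      refine ne_top_of_le_ne_top ?_ (ENNReal.tsum_le_tsum hA)
      rw [← ENNReal.ofReal_tsum_of_nonneg hA0 hAs]
      exact ENNReal.ofReal_ne_top
  refine ⟨v, fderiv ℂ (EV s (flowSeries F)) x v, hvk, fun k => ?_, rfl⟩
  set θ := Real.exp 1 * f / ρ with hθ
  have hθ0 : 0 ≤ θ := by positivity
  have hθ1 : θ < 1 := by linarith [flow_ratio_lt hρ hf]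
  have hw := weight_pos s k
  set M := R / weight s k with hM
  have hR0 : 0 ≤ R := by linarith
  have hM0 : 0 ≤ M := div_nonneg hR0 hw.le
  set γ : ℕ → MIdx → ℂ := fun b => actDiv F (idField k) b with hγ
  have hγb : ∀ b, SBd s (R - ρ) (γ b) (θ ^ b * M) := fun b =>
    (sbd_idField s R k).actDiv hF hf0 hM0 hρ b
  have hΨ := hF.flowSeries hf0 hρ (by linarith) hf
  have hxR : ‖x‖ < R - ρ := by linarith
  -- the derivative of the flow series
  have h1 : (fderiv ℂ (EV s (flowSeries F)) x v) k
      = fderiv ℂ (fun x : G s => ev (flowSeries F k) x) x v := by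
    have hd := (hΨ.analyticOnNhd (mul_nonneg (inv_nonneg.2 (by linarith)) hR0) x
      (mem_ball_zero_iff.2 hxR)).differentiableAt.hasFDerivAt
    have hd2 := (coordG s k).hasFDerivAt.comp x hd
    have hd3 : HasFDerivAt (fun x : G s => ev (flowSeries F k) x)
        ((coordG s k).comp (fderiv ℂ (EV s (flowSeries F)) x)) x := by
      refine hd2.congr_of_eventuallyEq ?_
      filter_upwards [Metric.isOpen_ball.mem_nhds (mem_ball_zero_iff.2 hxR)] with x' hx'
      exact (hΨ.EV_apply (mem_ball_zero_iff.1 hx') k).symm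
    rw [hd3.fderiv]
    rfl
  have hsq : Summable (Function.uncurry fun (b : ℕ) (q : MIdx) => γ b q * dmono x v q) := by
    refine Summable.of_enorm ?_
    rw [ENNReal.tsum_prod']
    have hb : ∀ b, ∑' q, ‖Function.uncurry (fun (b : ℕ) (q : MIdx) => γ b q * dmono x v q) (b, q)‖ₑ
        ≤ ENNReal.ofReal (‖v‖ * (θ ^ b * M / ρ)) := by
      intro b
      refine le_trans (ENNReal.tsum_le_tsum fun q => ?_)
        ((hγb b).tsum_dmono_le hρ (norm_nonneg v) hxs1 (wNorm_eq_norm s v).le)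
      rw [Function.uncurry, enorm_mul]
      exact mul_le_mul_right (enorm_dmono_le x v q) _
    refine ne_top_of_le_ne_top ?_ (ENNReal.tsum_le_tsum hb)
    rw [← ENNReal.ofReal_tsum_of_nonneg (fun b => by positivity)
      ((((summable_geometric_of_lt_one hθ0 hθ1).mul_right M).div_const ρ).mul_left ‖v‖)]
    exact ENNReal.ofReal_ne_top
  have h2 : fderiv ℂ (fun x : G s => ev (flowSeries F k) x) x v
      = ∑' b, fderiv ℂ (fun x : G s => ev (γ b) x) x v := by
    rw [← ((hΨ.sbd k).fderiv_apply hxR v).tsum_eq]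
    have e : ∀ b, fderiv ℂ (fun x : G s => ev (γ b) x) x v = ∑' q, γ b q * dmono x v q := fun b =>
      ((hγb b).fderiv_apply hxR v).tsum_eq.symm
    simp_rw [e]
    rw [← hsq.tsum_comm]
    refine tsum_congr fun q => ?_
    rw [tsum_mul_right]
    congr 1
    have := hasSum_flowSeries hF hf0 hρ (by linarith) hf k q
    rw [← this.tsum_eq]
    refine tsum_congr fun b => ?_
    rw [iterate_lie_apply]
    rfl
  -- the double series
  set e : ℕ → ℕ → ℂ := fun a b => ev (act (adDiv F W a) (γ b)) x with he
  have h3 : ∀ a b, fderiv ℂ (fun x : G s => ev (γ b) x) x (va a) = e a b := by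
    intro a b
    have h4 := (hγb b).fderiv_apply hxR (va a)
    rw [show ((va a : G s) : Idx → ℂ) = evalVF (adDiv F W a) x from funext (hvac a)] at h4
    exact h4.unique ((hγb b).hasSum_ev_act hxs2 (hAne a))
  have h4 : ∀ a b, ‖e a b‖ ≤ A a * (θ ^ b * M / ρ) := by
    intro a b
    have h5 := (enorm_ev_le (act (adDiv F W a) (γ b)) x).trans ((ser_act_le _ _ _).trans
      ((hγb b).tsum_dmono_le hρ (hA0 a) hxs1 (hA a)))
    rw [← ofReal_norm] at h5
    exact (ENNReal.ofReal_le_ofReal_iff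
      (mul_nonneg (hA0 a) (div_nonneg (mul_nonneg (pow_nonneg hθ0 b) hM0) hρ.le))).1 h5
  -- Absolute convergence of the double series: the values of the terms of W_+ are summable in a,
  -- and the derivatives of the terms of the flow series are geometric in b. It permits summation
  -- along diagonals.
  have hes : Summable fun p : ℕ × ℕ => e p.1 p.2 := by
    refine Summable.of_norm_bounded (g := fun p : ℕ × ℕ => A p.1 * (θ ^ p.2 * M / ρ)) ?_
      fun p => h4 p.1 p.2
    refine hAs.mul_of_nonneg (((summable_geometric_of_lt_one hθ0 hθ1).mul_right M).div_const ρ)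
      hA0 fun b => ?_
    exact div_nonneg (mul_nonneg (pow_nonneg hθ0 b) hM0) hρ.le
  have h5 : ∀ b, fderiv ℂ (fun x : G s => ev (γ b) x) x v = ∑' a, e a b := by
    intro b
    rw [← ((fderiv ℂ (fun x : G s => ev (γ b) x) x).hasSum hvs).tsum_eq]
    exact tsum_congr fun a => h3 a b
  have h6 : ∑' b, ∑' a, e a b = ∑' p : ℕ × ℕ, e p.1 p.2 := by
    have h7 : Summable (Function.uncurry e) := hes
    rw [h7.tsum_comm]
    exact (h7.tsum_prod).symm
  have h7 : HasSum (fun n : ℕ => ∑ p ∈ Finset.HasAntidiagonal.antidiagonal n, e p.1 p.2)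
      (∑' p : ℕ × ℕ, e p.1 p.2) := by
    have h8 := (Finset.HasAntidiagonal.sigmaAntidiagonalEquivProd (A := ℕ)).hasSum_iff.2 hes.hasSum
    refine (h8.sigma fun n => hasSum_fintype _).congr_fun fun n => ?_
    exact (Finset.sum_coe_sort (Finset.HasAntidiagonal.antidiagonal n)
      fun p : ℕ × ℕ => e p.1 p.2).symm
  have hWk : SBd s R (W k) (‖lam k‖ * M + B / weight s k) := by
    intro z hz
    refine (ser_add_le (diagField lam k) (U k) z).trans ?_
    rw [ENNReal.ofReal_add (mul_nonneg (norm_nonneg _) hM0) (div_nonneg hB hw.le)]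
    refine add_le_add ?_ (hU.sbd k z hz)
    have h8 := sbd_idField s R k z hz
    rw [idField, ser_diagField, enorm_one, one_mul] at h8
    rw [ser_diagField, ENNReal.ofReal_mul (norm_nonneg _), ofReal_norm]
    exact mul_le_mul_right h8 _
  have h8 := hF.hasSum_ev_flow hf0 hρ hR hf hx hWk
    (add_nonneg (mul_nonneg (norm_nonneg _) hM0) (div_nonneg hB hw.le))
  have h9 : ∀ n : ℕ, ((n ! : ℕ) : ℂ)⁻¹ * ev ((act F)^[n] (W k)) x
      = ∑ p ∈ Finset.HasAntidiagonal.antidiagonal n, e p.1 p.2 := by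
    intro n
    rw [← ev_const_mul]
    change ev (actDiv F (W k) n) x = _
    -- W_k is W applied to the coordinate x_k, so the Leibniz rule splits the Lie series of W_k into
    -- iterated brackets of W and iterates of F on x_k.
    rw [← act_idField W k, actDiv_act (g := idField k) hmF hmW (momV_diagField (fun _ => 1) k),
        ev_sum]
    intro p _
    exact ne_top_of_le_ne_top ((hγb p.2).tsum_dmono_ne_top hxs2 (hAne p.1)) (ser_act_le _ _ _)
  rw [h1, h2, tsum_congr h5, h6]
  exact (h7.congr_fun fun n => h9 n).unique h8

end conj

/-! ### Assembling the flow and the final estimates. -/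

theorem Superlinear.norm_le {C : ℝ} {lam : Idx → ℂ} (h : Superlinear C lam) (k : Idx) :
    ‖lam k‖ ≤ 2 * bra k ^ 2 := by
  obtain ⟨θ, hθ, -⟩ := h
  have h1 : ‖(bra k : ℂ) ^ 2 * Complex.exp (θ k * Complex.I)‖ = bra k ^ 2 := by
    rw [norm_mul, Complex.norm_exp_ofReal_mul_I, mul_one, norm_pow, Complex.norm_real,
      Real.norm_of_nonneg (bra_pos k).le]
  have h2 := norm_sub_norm_le (lam k) ((bra k : ℂ) ^ 2 * Complex.exp (θ k * Complex.I))
  have h3 := one_le_bra k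
  have h4 := hθ k
  nlinarith

/-- The flow part of the step: on every smaller space the time-one map is given by the Lie
series. -/
theorem exists_flow {s r ρ f : ℝ} {lam : Idx → ℂ} {F U Wp : FVF} (hρ : 0 < ρ) (hr : 5 * ρ < r)
    {B g : ℝ} (hF : Bd s (r - 3 * ρ) F f) (hf0 : 0 ≤ f) (hf : f ≤ ρ / (8 * Real.exp 1))
    (hmF : MomV F) (hF0 : ∀ k, F k 0 = 0)
    (hU : Bd s (r - 3 * ρ) U B) (hB : 0 ≤ B) (hmU : MomV U) (hU0 : ∀ k, U k 0 = 0)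
    (hG : Bd s (r - 4 * ρ) (bracket F (diagField lam + U)) g) (hg : 0 ≤ g)
    (hmG : MomV (bracket F (diagField lam + U)))
    (hG0 : ∀ k, bracket F (diagField lam + U) k 0 = 0)
    (hlam : ∀ k, ‖lam k‖ ≤ 2 * bra k ^ 2) (hexp : IsLieExp F (diagField lam + U) Wp)
    {s₁ : ℝ} (hs₁ : s ≤ s₁) :
    ∃ Φ : G s₁ → G s₁,
      IsTimeOneFlow s₁ (r - 5 * ρ) (r - 3 * ρ) F Φ ∧
      Set.MapsTo Φ (Metric.ball 0 (r - 5 * ρ)) (Metric.ball 0 (r - 3 * ρ)) ∧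
      AnalyticOnNhd ℂ Φ (Metric.ball 0 (r - 5 * ρ)) ∧
      (∀ u : G s₁, ‖u‖ < r - 5 * ρ → ‖Φ u - u‖ ≤ f) ∧
      Conjugates s₁ (r - 5 * ρ) Φ (diagField lam + U) Wp := by
  have hR : 2 * ρ < r - 3 * ρ := by linarith
  have e5 : r - 5 * ρ = r - 3 * ρ - 2 * ρ := by ring
  have e4 : r - 4 * ρ = r - 3 * ρ - ρ := by ring
  rw [e5]
  rw [e4] at hG
  have hF' := hF.of_le_exponent hs₁ hmF hF0
  have hU' := hU.of_le_exponent hs₁ hmU hU0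
  have hG' := hG.of_le_exponent hs₁ hmG hG0
  have hθ := flow_ratio_lt hρ hf
  have hdist : ∀ u : G s₁, ‖u‖ < r - 3 * ρ - 2 * ρ → ‖EV s₁ (flowSeries F) u - u‖ ≤ f :=
    fun u hu => hF'.norm_flow_sub_le hf0 hρ hR hf hu
  refine ⟨EV s₁ (flowSeries F), hF'.isTimeOneFlow hf0 hρ hR hf, fun u hu => ?_, ?_, hdist,
    conjugates_flow hF' hf0 hρ hR hf hmF hU' hB hmU hG' hg hlam hexp⟩
  · rw [mem_ball_zero_iff] at hu ⊢
    have h1 := norm_le_norm_add_norm_sub' (EV s₁ (flowSeries F) u) u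
    have h2 := hdist u hu
    have h3 := flow_bound_le hρ hf
    linarith
  · refine ((hF'.flowSeries hf0 hρ (by linarith) hf).analyticOnNhd ?_).mono
      (Metric.ball_subset_ball (by linarith))
    exact mul_nonneg (inv_nonneg.2 (by linarith)) (by linarith)

/-- With w = u⁴E⁴T³y, one has w²(a+b) ≤ w²T = u⁸E⁸T⁷y², which explains the exponents 8 and 7. In the
second bound w ≤ 1 also allows w² ≤ w, so one factor a + b + y can be kept. -/
theorem remainder_bound_le {u E a b y γ x n z : ℝ} (hu : 1 ≤ u) (hE : 1 ≤ E) (ha : 0 ≤ a)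
    (hb : 0 ≤ b) (hy : 0 ≤ y) (hγ : 0 < γ) (hle : u ^ 4 * E ^ 4 * (1 + a + b) ^ 3 * y ≤ 1 / 100000)
    (hz : z = γ * y)
    (hx : x ≤ 1300000000 * γ * (u ^ 4 * E ^ 4 * (1 + a + b) ^ 3 * y * y +
      (u ^ 4 * E ^ 4 * (1 + a + b) ^ 3 * y) ^ 2 * (a + b)))
    (hn : n ≤ 1300000000 * γ * (u ^ 4 * E ^ 4 * (1 + a + b) ^ 3 * y * y +
      (u ^ 4 * E ^ 4 * (1 + a + b) ^ 3 * y) ^ 2 * (a + b)) +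
        55440 * γ * (u ^ 4 * E ^ 4 * (1 + a + b) ^ 3 * y) * (a + b)) :
    x ≤ 10 ^ 10 * u ^ 8 * γ⁻¹ * E ^ 8 * (1 + a + b) ^ 7 * z ^ 2 ∧
      n ≤ 10 ^ 10 * u ^ 8 * E ^ 8 * (1 + a + b) ^ 7 * (a + b + y) * z := by
  subst hz
  have hT : 1 ≤ 1 + a + b := by linarith
  set T := 1 + a + b with hTdef
  set w := u ^ 4 * E ^ 4 * T ^ 3 * y with hw
  have hw0 : 0 ≤ w := by positivity
  set P := u ^ 8 * E ^ 8 * T ^ 7 with hP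
  have hP0 : 0 ≤ P := by positivity
  have hwP : w ≤ P * y := by
    rw [hw, hP]
    gcongr <;> first | assumption | norm_num
  have hw2 : w ^ 2 * (a + b) ≤ P * y * y := by
    have : w ^ 2 * (a + b) ≤ w ^ 2 * T := by gcongr; linarith
    exact this.trans (le_of_eq (by rw [hw, hP]; ring))
  constructor
  · have e : 10 ^ 10 * u ^ 8 * γ⁻¹ * E ^ 8 * T ^ 7 * (γ * y) ^ 2 = 10 ^ 10 * γ * (P * y * y) := by
      rw [hP]; field_simp
    rw [e]
    have h1 : w * y ≤ P * y * y := by gcongr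
    have h2 : 0 ≤ P * y * y := by positivity
    have h3 : w * y + w ^ 2 * (a + b) ≤ 2 * (P * y * y) := by linarith
    have h4 : 1300000000 * γ * (w * y + w ^ 2 * (a + b)) ≤ 1300000000 * γ * (2 * (P * y * y)) := by
      gcongr
    have h5 : 0 ≤ γ * (P * y * y) := by positivity
    linarith
  · have e : 10 ^ 10 * u ^ 8 * E ^ 8 * T ^ 7 * (a + b + y) * (γ * y)
        = 10 ^ 10 * γ * (P * y * (a + b + y)) := by
      rw [hP]; ring
    rw [e]
    have h1 : w ^ 2 * (a + b) ≤ w * (a + b) := by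
      have : w ^ 2 ≤ w := by nlinarith
      gcongr
    have h2 : w * (a + b + y) ≤ P * y * (a + b + y) := by gcongr
    have h3 : γ * (w * (a + b + y)) ≤ γ * (P * y * (a + b + y)) := by gcongr
    have h4 : γ * (w ^ 2 * (a + b)) ≤ γ * (w * (a + b)) := by gcongr
    have h5 : 0 ≤ γ * (w * y) := by positivity
    have h6 : 0 ≤ γ * (w * (a + b)) := by positivity
    linarith

end

end ResonantNF

theorem lemma4p4 :
    ∃ K₁ : ℝ, 0 < K₁ ∧ ∃ K : ℝ, 0 < K ∧
    ∀ τ C : ℝ, 0 < C → ∃ c : ℝ, 0 < c ∧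
    ∀ (lam : Idx → ℂ) (γ : ℝ), 0 < γ →
      BoundedGenerators lam → Superlinear C lam → DiophantineMod γ τ lam →
    ∀ Mst : ℕ, sInf (resonanceDegrees lam) ≤ Mst →
    ∀ s r ρ σ : ℝ, 0 < s → 0 < ρ → ρ < r / 5 → 0 < σ →
    ∀ Z X N : FVF,
      MemV s r Z → ResonantDiag lam Z → OrderGE 1 Z → DegreeLT Mst Z →
      MemV s r X → OrderGE Mst X → SuppIn (J0 lam ∪ (J1 lam \ J2 lam)) X →
      MemV s r N → OrderGE Mst N → SuppIn (J2 lam) N →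
      (1 + bnorm lam s r Z / γ + bnorm lam s r N / γ) ^ 3 * (bnorm lam s r X / γ)
        ≤ K₁ * (ρ ^ 4 / r ^ 4) * Real.exp (-(2 ^ 8 * c / σ ^ 6)) →
    ∃ F Xp Np : FVF,
      (MemV (s + 2 * σ) (r - 3 * ρ) F ∧ OrderGE Mst F ∧
        SuppIn (J0 lam ∪ (J1 lam \ J2 lam)) F) ∧
      bnorm lam (s + 2 * σ) (r - 3 * ρ) F ≤ ρ / (8 * Real.exp 1 * (r - 3 * ρ)) ∧
      (MemV (s + 2 * σ) (r - 5 * ρ) Xp ∧ OrderGE Mst Xp ∧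
        SuppIn (J0 lam ∪ (J1 lam \ J2 lam)) Xp) ∧
      (MemV (s + 2 * σ) (r - 5 * ρ) Np ∧ OrderGE Mst Np ∧ SuppIn (J2 lam) Np) ∧
      IsLieExp F (diagField lam + Z + X + N) (diagField lam + Z + Xp + Np) ∧
      (∀ s₁ : ℝ, s + 2 * σ ≤ s₁ → ∃ Φ : G s₁ → G s₁,
        IsTimeOneFlow s₁ (r - 5 * ρ) (r - 3 * ρ) F Φ ∧
        Set.MapsTo Φ (Metric.ball 0 (r - 5 * ρ)) (Metric.ball 0 (r - 3 * ρ)) ∧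
        AnalyticOnNhd ℂ Φ (Metric.ball 0 (r - 5 * ρ)) ∧
        (∀ u : G s₁, ‖u‖ < r - 5 * ρ →
          ‖Φ u - u‖ ≤ (r + ρ) * vnorm (s + 2 * σ) (r - 3 * ρ) F) ∧
        Conjugates s₁ (r - 5 * ρ) Φ (diagField lam + Z + X + N)
          (diagField lam + Z + Xp + Np)) ∧
      bnorm lam (s + 2 * σ) (r - 3 * ρ) F
        ≤ K * (r / ρ) ^ 3 * Real.exp (2 ^ 8 * c / σ ^ 6) * (bnorm lam s r X / γ) *
          (1 + bnorm lam s r Z / γ + bnorm lam s r N / γ) ^ 3 ∧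
      bnorm lam (s + 2 * σ) (r - 5 * ρ) Xp
        ≤ K * (r / ρ) ^ 8 * γ⁻¹ * Real.exp (2 ^ 9 * c / σ ^ 6) *
          (1 + bnorm lam s r Z / γ + bnorm lam s r N / γ) ^ 7 * bnorm lam s r X ^ 2 ∧
      bnorm lam (s + 2 * σ) (r - 5 * ρ) (N - Np)
        ≤ K * (r / ρ) ^ 8 * Real.exp (2 ^ 9 * c / σ ^ 6) *
          (1 + bnorm lam s r Z / γ + bnorm lam s r N / γ) ^ 7 *
          (bnorm lam s r Z / γ + bnorm lam s r N / γ + bnorm lam s r X / γ) *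
          bnorm lam s r X := by
  -- The smallness 1/100000 makes F at most ρ/(8e) before normalisation; 10^10 exceeds all numerical
  -- constants in the bounds for F, X_+ and N - N_+.
  refine ⟨1 / 100000, by norm_num, 10 ^ 10, by norm_num, fun τ C hC => ?_⟩
  obtain ⟨c, hc, hsmall⟩ := small_divisor τ C hC
  refine ⟨c, hc, ?_⟩
  intro lam γ hγ hgen hsup hdio Mst hMst s r ρ σ hs hρ hρr hσ Z X N hZ hdZ hoZ _ hX hoX hsX
    hN hoN hsN hle
  have hr5 : 5 * ρ < r := by linarith
  have hr : 0 < r := by linarith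
  have hu1 : 1 ≤ r / ρ := (one_le_div hρ).2 (by linarith)
  rw [J0_union] at hsX ⊢
  have hD : StepData lam Mst Z X N :=
    ⟨hgen, hMst, hZ.momV, hdZ, hoZ, hX.momV, hoX, hsX, hN.momV, hoN, hsN⟩
  have ha : 0 ≤ bnorm lam s r Z / γ := div_nonneg (bnorm_nonneg _ _ _ _) hγ.le
  have hb : 0 ≤ bnorm lam s r N / γ := div_nonneg (bnorm_nonneg _ _ _ _) hγ.le
  have hy : 0 ≤ bnorm lam s r X / γ := div_nonneg (bnorm_nonneg _ _ _ _) hγ.le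
  have hXγ : bnorm lam s r X = γ * (bnorm lam s r X / γ) := by field_simp
  have hbX := hX.bd_bnorm hr lam
  have hbZ := hZ.bd_bnorm hr lam
  have hbN := hN.bd_bnorm hr lam
  have hZγ : bnorm lam s r Z = γ * (bnorm lam s r Z / γ) := by field_simp
  have hNγ : bnorm lam s r N = γ * (bnorm lam s r N / γ) := by field_simp
  rw [hXγ] at hbX
  rw [hZγ] at hbZ
  rw [hNγ] at hbN
  set a := bnorm lam s r Z / γ
  set b := bnorm lam s r N / γ
  set y := bnorm lam s r X / γ
  obtain ⟨E, hE⟩ : ∃ E, E = Real.exp (c / (σ / 2) ^ 6) := ⟨_, rfl⟩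
  have hE1 : 1 ≤ E := by rw [hE]; exact Real.one_le_exp (by positivity)
  -- The halved σ contributes 2⁶ to the exponent and the four divisions contribute 4, hence 2⁸; the
  -- quadratic remainders contain E⁸.
  have hE4 : Real.exp (2 ^ 8 * c / σ ^ 6) = E ^ 4 := by
    rw [hE, ← Real.exp_nat_mul]; congr 1; field_simp; norm_num
  have hE8 : Real.exp (2 ^ 9 * c / σ ^ 6) = E ^ 8 := by
    rw [hE, ← Real.exp_nat_mul]; congr 1; field_simp; norm_num
  rw [Real.exp_neg, hE4] at hle
  rw [hE4, hE8]
  have hle' : (r / ρ) ^ 4 * E ^ 4 * (1 + a + b) ^ 3 * y ≤ 1 / 100000 := by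
    have h1 : (r / ρ) ^ 4 * E ^ 4 * ((1 + a + b) ^ 3 * y)
        ≤ (r / ρ) ^ 4 * E ^ 4 * (1 / 100000 * (ρ ^ 4 / r ^ 4) * (E ^ 4)⁻¹) := by gcongr
    have hE0 : E ≠ 0 := by positivity
    have h2 : (r / ρ) ^ 4 * E ^ 4 * (1 / 100000 * (ρ ^ 4 / r ^ 4) * (E ^ 4)⁻¹) = 1 / 100000 := by
      field_simp
    rw [h2] at h1
    linarith
  obtain ⟨F, Xp, Np, f, hf0, hf1, hf2, hbF, hmF, hoF, hsF, hXp, hoXp, hsXp, hNp, hoNp, hsNp, hG,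
    hexp, hXpb, hNpb⟩ := hD.formal_step hρ hr5 hσ hγ hc hE ha hb hy hbX hbZ hbN
      (hsmall lam γ hγ hgen.1 hsup hdio) hle'
  have hR : 0 < r - 3 * ρ := by linarith
  have hMemF : MemV (s + 2 * σ) (r - 3 * ρ) F := hmF.memV hoF.apply_zero hR hbF
  have hbn := bnorm_le_of_bd (lam := lam) hR hf0 hbF
  have hrem := remainder_bound_le hu1 hE1 ha hb hy hγ hle' hXγ hXpb hNpb
  refine ⟨F, Xp, Np, ⟨hMemF, hoF, hsF⟩, ?_, ⟨hXp, hoXp, hsXp⟩, ⟨hNp, hoNp, hsNp⟩, hexp, ?_, ?_,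
    hrem.1, hrem.2⟩
  · refine hbn.trans ?_
    rw [← div_div]
    gcongr
  · intro s₁ hs₁
    obtain ⟨hmG, hG0, g, hg, hbG⟩ := hG _ rfl
    have hv : vnorm (s + 2 * σ) (r - 3 * ρ) F ≤ f / (r - 3 * ρ) := vnorm_le_of_bd hR hf0 hbF
    have hv0 := vnorm_nonneg (s + 2 * σ) (r - 3 * ρ) F
    have hfv : (r - 3 * ρ) * vnorm (s + 2 * σ) (r - 3 * ρ) F ≤ f := by
      rw [le_div_iff₀ hR] at hv; linarith
    have hW : diagField lam + Z + X + N = diagField lam + (Z + X + N) := by abel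
    rw [hW] at hmG hG0 hbG hexp ⊢
    have hmU : MomV (Z + X + N) := (hZ.momV.add hX.momV).add hN.momV
    have hU0 : ∀ k, (Z + X + N) k 0 = 0 := fun k => by
      simp [hZ.1 k, hX.1 k, hN.1 k]
    have hU := ((hbZ.add hbX (by positivity) (by positivity)).add hbN (by positivity)
      (by positivity)).of_le_exponent (s' := s + 2 * σ) (by linarith) hmU hU0
    -- The flow is applied with the norm of F itself instead of the a priori bound f, so the
    -- displacement is at most (r - 3ρ) times that norm.
    obtain ⟨Φ, h1, h2, h3, h4, h5⟩ := exists_flow hρ hr5 (hMemF.bd hR) (by positivity)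
      (hfv.trans hf2) hmF hoF.apply_zero (hU.of_radius_le (by linarith)) (by positivity) hmU hU0
      hbG hg hmG hG0 hsup.norm_le hexp hs₁
    refine ⟨Φ, h1, h2, h3, fun u hu => (h4 u hu).trans ?_, h5⟩
    gcongr
    linarith
  · refine hbn.trans ?_
    rw [div_le_iff₀ hR]
    set w := (r / ρ) ^ 3 * E ^ 4 * (1 + a + b) ^ 3 * y with hw
    have hw0 : 0 ≤ w := by positivity
    have e : 10 ^ 10 * (r / ρ) ^ 3 * E ^ 4 * y * (1 + a + b) ^ 3 = 10 ^ 10 * w := by rw [hw]; ring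
    rw [e]
    -- As ρ < r/5, the radius r - 3ρ is at least 2r/5, so normalising by it costs a factor 5/2.
    have h1 : r * w ≤ 5 / 2 * (r - 3 * ρ) * w := by gcongr; linarith
    have h2 : 0 ≤ w * (r - 3 * ρ) := by positivity
    refine hf1.trans ?_
    linarith
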